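/- Let $n\ge 1$, $\alpha>0$, $p=1/\sqrt{1+\alpha^2}\in(0,1)$, let $D$ be the open unit ball of $\mathbb R^n$, $r(y)=\sqrt{\alpha^2+(1-|y|)^2}$, and let $f:\mathbb R^n\to\mathbb C$ vanish outside $D$. Put $Rf(y)=\int_{|x-y|=r(y)}f\,dS$ (surface measure). For $\Theta\in S^{n-1}$ and $\lambda>0$ write $Rf(\lambda,\Theta)=Rf(t\Theta)$ with $t=\sqrt{1+\alpha^2}/(2\lambda)$, and put $Rf(\lambda,\Theta)=0$ for $\lambda\le 0$ (the surface $\lambda(1-|px|^2)=p-(px)\cdot\Theta$, which for $\lambda>0$ is the sphere $|x-t\Theta|=r(t\Theta)$, does not meet $D$ when $\lambda\le 0$). Let $\Psi(y,\Theta)=\dfrac{p-y\cdot\Theta}{1-|y|^2}$, and for $u$ supported in $D$ let $$\mathcal Ru(\lambda,\Theta)=\int|\nabla_y\Psi|\,\delta(\lambda-\Psi(y,\Theta))\,u(y)\,dy=\lim_{\varepsilon\to0^+}\frac1{2\varepsilon}\int_{|\lambda-\Psi(y,\Theta)|<\varepsilon}|\nabla_y\Psi(y,\Theta)|\,u(y)\,dy$$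 be the equidistant sphere transform. Let $\tilde f(y)=f(y/p)$. (1) If $f$ is integrable, then for every $\Theta$ and almost every $\lambda\in\mathbb R$ the transform $\mathcal R\tilde f(\lambda,\Theta)$ exists, $f$ is integrable over the sphere with parameters $(\lambda,\Theta)$ if $\lambda>0$, and $$Rf(\lambda,\Theta)=\frac1{p^{n-1}}\,\mathcal R\tilde f(\lambda,\Theta).$$ If $f$ is continuous, $\mathcal R\tilde f(\lambda,\Theta)$ exists and this identity holds for every $\lambda\in\mathbb R$ and every $\Theta$. (2) For data $g$ on $\mathbb R\times S^{n-1}$ let $\mathcal R^{-1}g$ be the filtered backprojection $$\mathcal R^{-1}g(y)=\lim_{\varepsilon\to0^+}\frac{(n-1)!\,(1-|y|^2)}{(2\pi)^n D_n(y)}\int_{S^{n-1}}\int_{\mathbb R}\operatorname{Re}\frac{1}{\big(\varepsilon+i(\lambda-\Psi(y,\Theta))\big)^{n}}\;\frac{g(\lambda,\Theta)}{\sqrt{1-4p\lambda+4\lambda^2}}\,d\lambda\,d\Theta,$$ $$D_n(y)=\frac1{|S^{n-1}|}\int_{S^{n-1}}\frac{d\Theta}{|\nabla_y\Psi(y,\Theta)|^n},$$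 the limit being taken in $L^2(K)$ for every compact $K\subset D$ (so that $\mathcal R^{-1}g$ is determined almost everywhere in $D$). If $f\in L^2(\mathbb R^n)$ (in particular if $f\in L^2_c(D)$), then $\mathcal R^{-1}(p^{n-1}Rf)$ exists and $$f(x)=\mathcal R^{-1}\big(p^{n-1}Rf\big)(px)\qquad\text{for almost every }x\in D.$$ -/

import Mathlib

open MeasureTheory Filter Topology Metric

noncomputable section

namespace SphRadon

/-- Euclidean space `ℝⁿ`. -/
abbrev E (n : ℕ) : Type := EuclideanSpace ℝ (Fin n)

/-- The unit sphere `S^{n-1}`. Its surface measure is `surf n`. -/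
abbrev S (n : ℕ) : Type := sphere (0 : E n) 1

/-- Surface measure on the unit sphere, of total mass `n * vol (unit ball)`. -/
def surf (n : ℕ) : Measure (S n) := (volume : Measure (E n)).toSphere

/-- `∫ f dS` over the sphere with center `c` and radius `ρ`. -/
def sphereIntegral {n : ℕ} (c : E n) (ρ : ℝ) (f : E n → ℂ) : ℂ :=
  (ρ ^ (n - 1) : ℝ) • ∫ ω : S n, f (c + ρ • (ω : E n)) ∂(surf n)

/-- `f` is integrable over the sphere with center `c` and radius `ρ`. -/
def SphereIntegrable {n : ℕ} (c : E n) (ρ : ℝ) (f : E n → ℂ) : Prop :=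
  Integrable (fun ω : S n => f (c + ρ • (ω : E n))) (surf n)

/-- The spherical Radon transform `Rf(y) = ∫_{S(y)} f dS`, where `S(y)` is the sphere with
center `y` and radius `r y`. -/
def radon {n : ℕ} (r : E n → ℝ) (f : E n → ℂ) (y : E n) : ℂ :=
  sphereIntegral y (r y) f

/-- The radius function `r(y) = √(α² + (1 - |y|)²)`. -/
def radius {n : ℕ} (α : ℝ) (y : E n) : ℝ := √(α ^ 2 + (1 - ‖y‖) ^ 2)

/-- The center `tΘ` of the sphere with parameters `(lam, Θ)`: `lam = √(1+α²) / (2t)`, that is,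
`t = √(1+α²) / (2 lam)`. -/
def center {n : ℕ} (α lam : ℝ) (Θ : S n) : E n := (√(1 + α ^ 2) / (2 * lam)) • (Θ : E n)

/-- `Rf(lam, Θ)`: the transform `Rf` for the radius `√(α² + (1 - |y|)²)` in the parameters
`(lam, Θ)` of its spheres. As `lam` runs through `(0, ∞)` and `Θ` through `S^{n-1}`, the center
`tΘ` runs through all `y ≠ 0`. For `lam ≤ 0` the surface
`lam (1 - |p x|²) = p - (p x) · Θ`, `p = 1 / √(1+α²)`, does not meet the open unit ball,
hence the integral over it of a function supported there is `0`. -/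
def radonPolar {n : ℕ} (α : ℝ) (f : E n → ℂ) (lam : ℝ) (Θ : S n) : ℂ :=
  if 0 < lam then radon (radius α) f (center α lam Θ) else 0

/-- The value of `∫ δ(lam - ψ(y)) h(y) dy` is `v`, the Dirac delta being the limit of
`(2ε)⁻¹ 1_{(-ε, ε)}` as `ε → 0+`. -/
def HasDeltaIntegral {n : ℕ} (ψ : E n → ℝ) (h : E n → ℂ) (lam : ℝ) (v : ℂ) : Prop :=
  Tendsto (fun ε : ℝ => (1 / (2 * ε)) • ∫ y in {y : E n | |lam - ψ y| < ε}, h y)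
    (𝓝[>] 0) (𝓝 v)

/-- `Ψ₂(y, Θ) = (p - y · Θ) / (1 - |y|²)`. -/
def phase {n : ℕ} (p : ℝ) (Θ : S n) (y : E n) : ℝ :=
  (p - inner ℝ y (Θ : E n)) / (1 - ‖y‖ ^ 2)

/-- The equidistant sphere transform at `(lam, Θ)`,
`∫ |∇_y Ψ₂(y, Θ)| δ(lam - Ψ₂(y, Θ)) u(y) dy`, of a function `u` that is supported in the
open unit ball, exists and equals `v`. -/
def HasEquidistantTransform {n : ℕ} (p : ℝ) (u : E n → ℂ) (lam : ℝ) (Θ : S n) (v : ℂ) : Prop :=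
  HasDeltaIntegral (phase p Θ) (fun y => ‖gradient (phase p Θ) y‖ • u y) lam v

/-- On the sphere `Ψ₂(y, Θ) = lam` one has `|∇_y Ψ₂(y, Θ)| = weight p lam / (1 - |y|²)`. -/
def weight (p lam : ℝ) : ℝ := √(1 - 4 * p * lam + 4 * lam ^ 2)

/-- `D_n(y)`: the mean over `Θ ∈ S^{n-1}` of `|∇_y Ψ₂(y, Θ)|⁻ⁿ`. -/
def normalizer {n : ℕ} (p : ℝ) (y : E n) : ℝ :=
  ⨍ Θ : S n, (‖gradient (phase p Θ) y‖ ^ n)⁻¹ ∂(surf n)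

/-- The filter `Re (ε + i s)⁻ⁿ = Re (iⁿ (s - i ε)ⁿ)⁻¹`. Since
`(n-1)! Re (ε + i s)⁻ⁿ = ½ ∫ |σ|ⁿ⁻¹ exp (-ε |σ| - i σ s) dσ`,
this is (up to a constant) the ramp filter `|σ|ⁿ⁻¹` of filtered backprojection with the cutoff
`exp (-ε |σ|)`. As `ε → 0+` it tends to `iⁿ s⁻ⁿ` (finite part) for even `n`, and to
`π iⁿ⁻¹ δ⁽ⁿ⁻¹⁾(s) / (n-1)!` for odd `n`. -/
def filterKernel (n : ℕ) (ε s : ℝ) : ℝ :=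
  ((((ε : ℂ) + (s : ℂ) * Complex.I) ^ n)⁻¹).re

/-- Filtered backprojection for the equidistant sphere transform, with cutoff `ε`. The data are
divided by `weight p lam`, which turns the transform of `u` into
`∫ δ(lam - Ψ₂(y, Θ)) u(y) / (1 - |y|²) dy`; these are filtered in `lam`,
backprojected and divided by `D_n(y)`, which recovers `u(y) / (1 - |y|²)` in the limit. -/
def backprojection {n : ℕ} (p ε : ℝ) (g : ℝ → S n → ℂ) (y : E n) : ℂ :=
  (((n - 1).factorial : ℝ) * (1 - ‖y‖ ^ 2) / ((2 * Real.pi) ^ n * normalizer p y)) •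
    ∫ Θ : S n, (∫ lam : ℝ, (filterKernel n ε (lam - phase p Θ y) / weight p lam) • g lam Θ)
      ∂(surf n)

/-- `h` is the image of the data `g` under the explicit inverse of the equidistant sphere
transform: the filtered backprojections of `g` tend to `h`, in mean square on every
compact subset of the open unit ball, as the cutoff is removed. -/
def HasEquidistantInverse {n : ℕ} (p : ℝ) (g : ℝ → S n → ℂ) (h : E n → ℂ) : Prop :=
  AEStronglyMeasurable h (volume.restrict (ball (0 : E n) 1)) ∧
  ∀ K : Set (E n), IsCompact K → K ⊆ ball 0 1 →
    Tendsto (fun ε : ℝ => eLpNorm (fun y => backprojection p ε g y - h y) 2 (volume.restrict K))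
      (𝓝[>] 0) (𝓝 0)

end SphRadon

end

noncomputable section
namespace SphRadon
open Set
open scoped ENNReal

/-! ### Polar coordinates on the sphere times the half line -/

section Polar

variable {n : ℕ}

/-! Part (1) is geometry plus a coarea formula. Inside the unit ball the level set `phase p Θ =
lam`, for `lam > 0`, lies on the sphere with center `Θ / (2 lam)` and radius `weight p lam / (2
lam)`; dilation by `1/p` carries this sphere to the one over which `Rf(lam, Θ)` integrates
(`center_add_radius_smul`), and the surface measures differ by the factor `p ^ (n - 1)`. The map
`levelChart` straightens all these level sets simultaneously into concentric spheres of radius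
`lam`, with an explicit Jacobian, so polar integration gives the coarea formula
`integral_smul_levelIntegral`. The equidistant transform is then a symmetric derivative of the
primitive of `levelIntegral`. It exists almost everywhere by Lebesgue differentiation, and for
continuous data wherever `levelIntegral` is continuous, that is for `lam ≠ 0`; the value `lam = 0`
needs a direct estimate (`hasEquidistantTransform_zero`).

Part (2) is an approximate identity argument. By the coarea formula, backprojecting the data of `u`
means applying, to `v = u / (1 - |x|²)`, the integral operator with kernel `∫ Re (ε + i(Ψ(x,Θ) -
Ψ(y,Θ)))⁻ⁿ dΘ` (`backprojection_levelIntegral`). The phase difference is affine in `Θ`, of the form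
`a - ⟨b, Θ⟩`, and satisfies `|a| ≤ p |b|` and `|x - y| ≤ |b|`. The spherical mean of `(z - i⟨b,
Θ⟩)⁻ⁿ` is a multiple of `z (z² + |b|²)^(-(n+1)/2)`: for real `z` this is the Fourier transform of
`exp (-z|ξ|)` computed in two ways, and analytic continuation gives the rest of the half plane. At
`z = ε + ia` with `|a| ≤ p |b|` and `p < 1`, the quantity `z² + |b|²` stays away from the cut, and
the real part is dominated by the Poisson kernel at height `ε`
(`exists_abs_backprojectionKernel_le`).

This domination supplies everything else. It permits passage to the limit after the rescaling `x = y
+ εz`, where the kernel tends to the mean of `Re (1 + i⟨∇Ψ, z⟩)⁻ⁿ`, whose total mass is `(2π)ⁿ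
D_n(y) / (n-1)!` (`integral_integral_filterKernel`). It also bounds the operators on `L²` uniformly
in `ε` by Schur's test, so that convergence extends by density from continuous functions to `L²`.
The prefactor of `backprojection` is the reciprocal of that mass times `1 - |y|²`. The constant in
the Poisson formula is never needed, since the mass is computed separately. -/

instance (n : ℕ) : IsFiniteMeasure (surf n) := by unfold surf; infer_instance

/-- This is `volumeIoiPow` with exponent 0, whose density is 1. -/
instance : SigmaFinite (Measure.comap (Subtype.val : Ioi (0 : ℝ) → ℝ) volume) := by
  have := (inferInstance : SigmaFinite (Measure.volumeIoiPow 0))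
  simpa [Measure.volumeIoiPow] using this

theorem measurePreserving_prodMap_subtypeVal (n : ℕ) :
    MeasurePreserving (Prod.map id (Subtype.val : Ioi (0 : ℝ) → ℝ))
      ((surf n).prod (Measure.comap Subtype.val volume))
      ((surf n).prod (volume.restrict (Ioi (0 : ℝ)))) := by
  refine MeasurePreserving.prod (MeasurePreserving.id _) ⟨measurable_subtype_coe, ?_⟩
  exact map_comap_subtype_coe measurableSet_Ioi volume

theorem surf_prod_volumeIoiPow (n : ℕ) :
    (surf n).prod (Measure.volumeIoiPow (n - 1)) =
      ((surf n).prod (Measure.comap (Subtype.val : Ioi (0 : ℝ) → ℝ) volume)).withDensity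
        (fun q => ((Real.toNNReal (q.2.1 ^ (n - 1)) : NNReal) : ENNReal)) := by
  have : SigmaFinite ((Measure.comap (Subtype.val : Ioi (0 : ℝ) → ℝ) volume).withDensity
      fun r ↦ ENNReal.ofReal (r.1 ^ (n - 1))) :=
    (inferInstance : SigmaFinite (Measure.volumeIoiPow (n - 1)))
  have := prod_withDensity_right (μ := surf n)
    (ν := Measure.comap (Subtype.val : Ioi (0 : ℝ) → ℝ) volume)
    (g := fun r ↦ ENNReal.ofReal (r.1 ^ (n - 1))) (by fun_prop)
  exact this

/-- `homeomorphUnitSphereProd` gives polar coordinates on the complement of the origin, with the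
radius in a subtype; the radial density is pulled out and the subtype replaced by a restricted
measure on `ℝ`, which is the convenient form for Fubini. -/
theorem integrable_polar (hn : 1 ≤ n) {F : E n → ℂ} :
    (Integrable F ↔ Integrable (fun q : S n × ℝ => q.2 ^ (n - 1) • F (q.2 • (q.1 : E n)))
      ((surf n).prod (volume.restrict (Ioi (0 : ℝ))))) ∧
    ∫ x, F x = ∫ q : S n × ℝ, q.2 ^ (n - 1) • F (q.2 • (q.1 : E n))
      ∂((surf n).prod (volume.restrict (Ioi (0 : ℝ)))) := by
  have : Nontrivial (E n) := by
    have : Nonempty (Fin n) := ⟨⟨0, hn⟩⟩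
    exact inferInstance
  have mp := (volume : Measure (E n)).measurePreserving_homeomorphUnitSphereProd
  have emb := Homeomorph.measurableEmbedding (homeomorphUnitSphereProd (E n))
  have hd : Module.finrank ℝ (E n) = n := by simp
  rw [hd] at mp
  change MeasurePreserving _ _ ((surf n).prod _) at mp
  rw [surf_prod_volumeIoiPow] at mp
  have mpv := measurePreserving_prodMap_subtypeVal n
  have embv : MeasurableEmbedding (Prod.map id (Subtype.val : Ioi (0 : ℝ) → ℝ) :
      S n × Ioi (0 : ℝ) → S n × ℝ) :=
    MeasurableEmbedding.id.prodMap (MeasurableEmbedding.subtype_coe measurableSet_Ioi)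
  have hcomp : ∀ x : ({0}ᶜ : Set (E n)),
      F (((homeomorphUnitSphereProd (E n)) x).2.1 • (((homeomorphUnitSphereProd (E n)) x).1 : E n))
        = F x := by
    intro x
    congr 1
    have hx : ‖(x : E n)‖ ≠ 0 := norm_ne_zero_iff.mpr x.2
    simp [smul_smul, mul_inv_cancel₀ hx]
  have hm : Measurable fun q : S n × Ioi (0 : ℝ) => Real.toNNReal (q.2.1 ^ (n - 1)) := by fun_prop
  have hsm : ∀ q : S n × Ioi (0 : ℝ), (Real.toNNReal (q.2.1 ^ (n - 1))) • F (q.2.1 • (q.1 : E n))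
      = q.2.1 ^ (n - 1) • F (q.2.1 • (q.1 : E n)) := by
    intro q
    rw [NNReal.smul_def, Real.coe_toNNReal _ (pow_nonneg q.2.2.out.le _)]
  constructor
  · have h1 := mp.integrable_comp_emb emb (g := fun q => F (q.2.1 • (q.1 : E n)))
    have h2 := mpv.integrable_comp_emb embv
      (g := fun q => q.2 ^ (n - 1) • F (q.2 • (q.1 : E n)))
    rw [← h2, ← restrict_compl_singleton (μ := (volume : Measure (E n))) 0, ← IntegrableOn,
      integrableOn_iff_comap_subtypeVal (by measurability)]
    rw [integrable_withDensity_iff_integrable_smul hm] at h1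
    simp only [Function.comp_def, hcomp, hsm] at h1
    exact h1
  · have h1 := mp.integral_comp emb (fun q => F (q.2.1 • (q.1 : E n)))
    have h2 := mpv.integral_comp embv (fun q => q.2 ^ (n - 1) • F (q.2 • (q.1 : E n)))
    rw [← h2, ← restrict_compl_singleton (μ := (volume : Measure (E n))) 0,
      ← integral_subtype_comap (measurableSet_singleton _).compl]
    rw [integral_withDensity_eq_integral_smul hm] at h1
    simp only [hcomp, hsm] at h1
    exact h1

end Polar

/-! ### The subordination integral -/

section Subordination

/-- Cauchy–Schlömilch substitution. With `φ v = v - c / v` the exponent is `-φ² - 2c`. Since `φ`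
maps the half line bijectively onto `ℝ`, the integral of `(1 + c / v²) exp (-φ²)` is the Gaussian
integral. The inversion `v ↦ c / v` preserves `φ²`, so the two summands contribute equally, each `√π
/ 2`. -/
theorem integral_exp_neg_sq_sub_sq {c : ℝ} (hc : 0 < c) :
    IntegrableOn (fun v : ℝ => Real.exp (-v ^ 2 - c ^ 2 / v ^ 2)) (Ioi 0) ∧
    ∫ v in Ioi (0 : ℝ), Real.exp (-v ^ 2 - c ^ 2 / v ^ 2) = √Real.pi / 2 * Real.exp (-2 * c) := by
  set φ : ℝ → ℝ := fun v => v - c / v with hφ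
  have hd : ∀ v ∈ Ioi (0 : ℝ), HasDerivWithinAt φ (1 + c / v ^ 2) (Ioi 0) v := by
    intro v hv
    have hv' : v ≠ 0 := ne_of_gt hv
    have := ((hasDerivAt_id v).sub ((hasDerivAt_const v c).div (hasDerivAt_id v) hv'))
    refine (this.congr_deriv ?_).hasDerivWithinAt
    simp only [id]
    field_simp
    ring
  have hmono : StrictMonoOn φ (Ioi 0) := by
    intro x hx y hy hxy
    have hx' : (0 : ℝ) < x := hx
    have : c / y < c / x := div_lt_div_of_pos_left hc hx' hxy
    simp only [hφ]; linarith
  have himg : φ '' Ioi 0 = univ := by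
    refine eq_univ_of_forall fun w => ?_
    have h1 : |w| < √(w ^ 2 + 4 * c) := by
      rw [← Real.sqrt_sq_eq_abs]
      exact Real.sqrt_lt_sqrt (sq_nonneg _) (by linarith)
    have h2 : √(w ^ 2 + 4 * c) ^ 2 = w ^ 2 + 4 * c := Real.sq_sqrt (by positivity)
    have h3 : 0 < w + √(w ^ 2 + 4 * c) := by linarith [neg_abs_le w]
    refine ⟨(w + √(w ^ 2 + 4 * c)) / 2, by simp only [mem_Ioi]; linarith, ?_⟩
    simp only [hφ]
    field_simp
    nlinarith
  have hψd : ∀ v ∈ Ioi (0 : ℝ), HasDerivWithinAt (fun v => c / v) (-(c / v ^ 2)) (Ioi 0) v := by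
    intro v hv
    have hv' : v ≠ 0 := ne_of_gt hv
    have := (hasDerivAt_const v c).div (hasDerivAt_id v) hv'
    refine (this.congr_deriv ?_).hasDerivWithinAt
    simp only [id]
    field_simp
    ring
  have hψi : InjOn (fun v : ℝ => c / v) (Ioi 0) := by
    intro x hx y hy hxy
    have hx' : x ≠ 0 := ne_of_gt hx
    have hy' : y ≠ 0 := ne_of_gt hy
    simp only at hxy
    field_simp at hxy
    exact hxy.symm
  have hψimg : (fun v : ℝ => c / v) '' Ioi 0 = Ioi 0 := by
    ext w
    constructor
    · rintro ⟨v, hv, rfl⟩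
      exact div_pos hc hv
    · intro hw
      have hw' : w ≠ 0 := ne_of_gt hw
      exact ⟨c / w, div_pos hc hw, by simp only; field_simp⟩
  have hgi : Integrable (fun w : ℝ => Real.exp (-w ^ 2)) := by
    simpa using integrable_exp_neg_mul_sq (b := 1) one_pos
  have i1 : IntegrableOn (fun v => |1 + c / v ^ 2| • Real.exp (-(φ v) ^ 2)) (Ioi 0) := by
    rw [← integrableOn_image_iff_integrableOn_abs_deriv_smul measurableSet_Ioi hd hmono.injOn
      (fun w => Real.exp (-w ^ 2)), himg, integrableOn_univ]
    exact hgi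
  have e1 : ∫ v in Ioi 0, |1 + c / v ^ 2| • Real.exp (-(φ v) ^ 2) = √Real.pi := by
    rw [← integral_image_eq_integral_abs_deriv_smul measurableSet_Ioi hd hmono.injOn
      (fun w => Real.exp (-w ^ 2)), himg, setIntegral_univ]
    simpa using integral_gaussian 1
  have i2 : IntegrableOn (fun v => Real.exp (-(φ v) ^ 2)) (Ioi 0) := by
    refine Integrable.mono' i1 ?_ ?_
    · have : Measurable φ := by fun_prop
      fun_prop
    · filter_upwards [ae_restrict_mem measurableSet_Ioi] with v hv
      have : 0 ≤ c / v ^ 2 := by positivity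
      rw [Real.norm_of_nonneg (Real.exp_nonneg _), abs_of_nonneg (by linarith), smul_eq_mul]
      exact le_mul_of_one_le_left (Real.exp_nonneg _) (by linarith)
  have e2 : ∫ v in Ioi 0, Real.exp (-(φ v) ^ 2) =
      ∫ v in Ioi 0, (c / v ^ 2) * Real.exp (-(φ v) ^ 2) := by
    conv_lhs => rw [← hψimg]
    rw [integral_image_eq_integral_abs_deriv_smul measurableSet_Ioi hψd hψi]
    refine setIntegral_congr_fun measurableSet_Ioi fun v hv => ?_
    have hv' : v ≠ 0 := ne_of_gt hv
    have : 0 ≤ c / v ^ 2 := by positivity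
    simp only [abs_neg, abs_of_nonneg this, smul_eq_mul, hφ]
    congr 3
    field_simp
    ring
  have e3 : ∫ v in Ioi 0, Real.exp (-(φ v) ^ 2) = √Real.pi / 2 := by
    have h : ∀ v ∈ Ioi (0 : ℝ), |1 + c / v ^ 2| • Real.exp (-(φ v) ^ 2) =
        Real.exp (-(φ v) ^ 2) + (c / v ^ 2) * Real.exp (-(φ v) ^ 2) := by
      intro v hv
      have : 0 ≤ c / v ^ 2 := by positivity
      rw [abs_of_nonneg (by linarith), smul_eq_mul]; ring
    have i3 : IntegrableOn (fun v => (c / v ^ 2) * Real.exp (-(φ v) ^ 2)) (Ioi 0) := by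
      have := i1.sub i2
      refine (integrableOn_congr_fun (fun v hv => ?_) measurableSet_Ioi).mp this
      simp only [Pi.sub_apply, h v hv]; ring
    rw [setIntegral_congr_fun measurableSet_Ioi h, integral_add i2 i3, ← e2] at e1
    linarith
  have hk : ∀ v ∈ Ioi (0 : ℝ), Real.exp (-(φ v) ^ 2) * Real.exp (-2 * c) =
      Real.exp (-v ^ 2 - c ^ 2 / v ^ 2) := by
    intro v hv
    have hv' : v ≠ 0 := ne_of_gt hv
    rw [← Real.exp_add]
    congr 1
    simp only [hφ]
    field_simp
    ring
  refine ⟨(integrableOn_congr_fun hk measurableSet_Ioi).mp (i2.mul_const _), ?_⟩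
  rw [← setIntegral_congr_fun measurableSet_Ioi hk, integral_mul_const, e3]

end Subordination

/-! ### Laplace transform of a monomial at complex argument -/

section Laplace

theorem integrableOn_pow_mul_exp_neg_mul (m : ℕ) {r : ℝ} (hr : 0 < r) :
    IntegrableOn (fun t : ℝ => t ^ m * Real.exp (-(t * r))) (Ioi 0) := by
  have := integrableOn_rpow_mul_exp_neg_mul_rpow (p := 1) (s := m) (b := r)
    (by have : (0 : ℝ) ≤ m := by positivity
        linarith) one_pos hr
  refine (integrableOn_congr_fun (fun t ht => ?_) measurableSet_Ioi).mp this
  simp only [Real.rpow_natCast, Real.rpow_one]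
  ring_nf

theorem integrableOn_pow_mul_cexp_neg_mul (m : ℕ) {z : ℂ} (hz : 0 < z.re) :
    IntegrableOn (fun t : ℝ => (t : ℂ) ^ m * Complex.exp (-(t * z))) (Ioi 0) := by
  refine Integrable.mono' (integrableOn_pow_mul_exp_neg_mul m hz)
    (Continuous.aestronglyMeasurable (by fun_prop)) ?_
  filter_upwards [ae_restrict_mem measurableSet_Ioi] with t ht
  have ht' : (0 : ℝ) < t := ht
  rw [norm_mul, norm_pow, Complex.norm_real, Complex.norm_exp, Real.norm_of_nonneg ht'.le]
  simp

/-- Induction by parts. The formula represents an inverse power as a superposition of exponentials,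
which links the filter `(ε + is)⁻ⁿ` to Fourier integrals. -/
theorem integral_pow_mul_cexp_neg_mul (m : ℕ) {z : ℂ} (hz : 0 < z.re) :
    ∫ t in Ioi (0 : ℝ), (t : ℂ) ^ m * Complex.exp (-(t * z)) = m.factorial * (z ^ (m + 1))⁻¹ := by
  have hz0 : z ≠ 0 := by rintro rfl; simp at hz
  have hlim : ∀ k : ℕ, Tendsto (fun t : ℝ => -((t : ℂ) ^ k * Complex.exp (-(t * z)) / z)) atTop
      (𝓝 0) := by
    intro k
    rw [tendsto_zero_iff_norm_tendsto_zero]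
    have h1 := (tendsto_rpow_mul_exp_neg_mul_atTop_nhds_zero k z.re hz).div_const ‖z‖
    rw [zero_div] at h1
    refine h1.congr' ?_
    filter_upwards [eventually_gt_atTop 0] with t ht
    rw [norm_neg, norm_div, norm_mul, norm_pow, Complex.norm_real, Complex.norm_exp,
      Real.norm_of_nonneg ht.le, Real.rpow_natCast]
    simp [mul_comm]
  have hexp : ∀ t : ℝ, HasDerivAt (fun t : ℝ => Complex.exp (-(t * z)))
      (Complex.exp (-(t * z)) * (-z)) t := by
    intro t
    have h0 : HasDerivAt (fun t : ℝ => (t : ℂ)) 1 t := Complex.ofRealCLM.hasDerivAt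
    have h1 : HasDerivAt (fun t : ℝ => -((t : ℂ) * z)) (-z) t := by
      exact ((h0.mul_const z).neg).congr_deriv (by simp)
    exact h1.cexp
  induction m with
  | zero =>
    have h := integral_Ioi_of_hasDerivAt_of_tendsto
      (f := fun t : ℝ => -((t : ℂ) ^ 0 * Complex.exp (-(t * z)) / z))
      (f' := fun t : ℝ => (t : ℂ) ^ 0 * Complex.exp (-(t * z))) (a := 0) (m := 0)
      (by fun_prop) ?_ (integrableOn_pow_mul_cexp_neg_mul 0 hz) (hlim 0)
    · rw [h]; simp
    · intro t _
      have h1 := ((hexp t).div_const z).neg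
      simp only [pow_zero, one_mul]
      refine h1.congr_deriv ?_
      field_simp
  | succ m ih =>
    have hi1 := integrableOn_pow_mul_cexp_neg_mul (m + 1) hz
    have hi2 := (integrableOn_pow_mul_cexp_neg_mul m hz).const_mul ((m + 1 : ℂ) / z)
    have h := integral_Ioi_of_hasDerivAt_of_tendsto
      (f := fun t : ℝ => -((t : ℂ) ^ (m + 1) * Complex.exp (-(t * z)) / z))
      (f' := fun t : ℝ => (t : ℂ) ^ (m + 1) * Complex.exp (-(t * z)) -
        (m + 1 : ℂ) / z * ((t : ℂ) ^ m * Complex.exp (-(t * z)))) (a := 0) (m := 0)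
      (by fun_prop) ?_ (hi1.sub hi2) (hlim (m + 1))
    · rw [integral_sub hi1 hi2, integral_const_mul, ih] at h
      simp only [Complex.ofReal_zero, ne_eq, Nat.add_eq_zero_iff, one_ne_zero, and_false,
        not_false_eq_true, zero_pow, zero_mul, zero_div, neg_zero, sub_zero] at h
      rw [sub_eq_zero.mp h, Nat.factorial_succ]
      push_cast
      field_simp
      ring
    · intro t _
      have h0 : HasDerivAt (fun t : ℝ => (t : ℂ)) 1 t := Complex.ofRealCLM.hasDerivAt
      have h1 := (((h0.pow (m + 1)).mul (hexp t)).div_const z).neg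
      refine h1.congr_deriv ?_
      simp only [Nat.add_sub_cancel, Nat.cast_add, Nat.cast_one, mul_one, Pi.pow_apply]
      field_simp
      ring

end Laplace

/-! ### The Fourier transform of the exponential of the norm -/

section Poisson

variable {n : ℕ}

theorem integral_gaussian_character {B : ℝ} (hB : 0 < B) (b : E n) :
    ∫ ξ : E n, Complex.exp (-((B * ‖ξ‖ ^ 2 : ℝ) : ℂ) + (inner ℝ b ξ : ℝ) * Complex.I) =
      (((Real.pi / B) ^ ((n : ℝ) / 2) * Real.exp (-(‖b‖ ^ 2 / (4 * B))) : ℝ) : ℂ) := by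
  have h := GaussianFourier.integral_cexp_neg_mul_sq_norm_add (b := (B : ℂ)) (V := E n)
    (by simpa using hB) Complex.I b
  have hc : (((Real.pi / B) ^ ((n : ℝ) / 2) : ℝ) : ℂ) = (Real.pi / B : ℂ) ^ ((n : ℂ) / 2) := by
    rw [Complex.ofReal_cpow (by positivity)]
    push_cast
    rfl
  rw [Complex.ofReal_mul, hc]
  simp only [finrank_euclideanSpace, Fintype.card_fin, Complex.I_sq] at h
  convert h using 3
  · push_cast; ring_nf
  · push_cast; ring_nf

theorem exp_neg_eq_integral {s : ℝ} (hs : 0 < s) :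
    Real.exp (-s) = 2 / √Real.pi * ∫ v in Ioi (0 : ℝ), Real.exp (-v ^ 2 - s ^ 2 / (4 * v ^ 2)) := by
  have h := (integral_exp_neg_sq_sub_sq (half_pos hs)).2
  have : ∀ v : ℝ, -v ^ 2 - (s / 2) ^ 2 / v ^ 2 = -v ^ 2 - s ^ 2 / (4 * v ^ 2) := by
    intro v; rw [div_pow, div_div]; norm_num
  simp only [this] at h
  rw [h]
  have : √Real.pi ≠ 0 := by positivity
  field_simp

theorem integrable_exp_neg_mul_norm (hn : 1 ≤ n) {ζ : ℝ} (hζ : 0 < ζ) :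
    Integrable (fun ξ : E n => Real.exp (-(ζ * ‖ξ‖))) := by
  have : Nontrivial (E n) := by
    have : Nonempty (Fin n) := ⟨⟨0, hn⟩⟩
    exact inferInstance
  rw [integrable_fun_norm_addHaar volume (f := fun t => Real.exp (-(ζ * t)))]
  simpa [mul_comm ζ] using integrableOn_pow_mul_exp_neg_mul (n - 1) hζ

theorem integrable_exp_neg_norm_character (hn : 1 ≤ n) {ζ : ℝ} (hζ : 0 < ζ) (b : E n) :
    Integrable (fun ξ : E n =>
      Complex.exp (-((ζ * ‖ξ‖ : ℝ) : ℂ) + (inner ℝ b ξ : ℝ) * Complex.I)) := by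
  refine (integrable_exp_neg_mul_norm hn hζ).mono'
    (Continuous.aestronglyMeasurable (by fun_prop)) (Eventually.of_forall fun ξ => ?_)
  rw [Complex.norm_exp]
  simp

/-- The Fourier transform of `exp (-ζ ‖ξ‖)` is a multiple of the Poisson kernel. -/
theorem exists_integral_exp_neg_norm_character (hn : 1 ≤ n) : ∃ c : ℝ, ∀ (ζ : ℝ), 0 < ζ →
    ∀ b : E n, ∫ ξ : E n, Complex.exp (-((ζ * ‖ξ‖ : ℝ) : ℂ) + (inner ℝ b ξ : ℝ) * Complex.I) =
      ((c * (ζ * (ζ ^ 2 + ‖b‖ ^ 2) ^ (-((n : ℝ) + 1) / 2)) : ℝ) : ℂ) := by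
  have : Nontrivial (E n) := by
    have : Nonempty (Fin n) := ⟨⟨0, hn⟩⟩
    exact inferInstance
  refine ⟨2 / √Real.pi * ((4 * Real.pi) ^ ((n : ℝ) / 2) *
    ((1 / 2) * Real.Gamma (((n : ℝ) + 1) / 2))), fun ζ hζ b => ?_⟩
  set μ := (volume : Measure ℝ).restrict (Ioi 0) with hμ
  -- Subordination: integrating out `v` gives `exp (-ζ‖ξ‖)` times the character and a constant,
  -- while for fixed `v` the function is Gaussian in `ξ`. Integrating in the other order leaves a
  -- Gamma integral in `v`.
  set F : E n × ℝ → ℂ := fun q => Complex.exp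
    (-((q.2 ^ 2 + ζ ^ 2 * ‖q.1‖ ^ 2 / (4 * q.2 ^ 2) : ℝ) : ℂ) + (inner ℝ b q.1 : ℝ) * Complex.I)
    with hF
  have hFm : AEStronglyMeasurable F ((volume : Measure (E n)).prod μ) := by
    apply Measurable.aestronglyMeasurable
    fun_prop
  have hnorm : ∀ ξ v, ‖F (ξ, v)‖ = Real.exp (-v ^ 2 - (ζ * ‖ξ‖) ^ 2 / (4 * v ^ 2)) := by
    intro ξ v
    simp only [hF]
    rw [Complex.norm_exp]
    congr 1
    simp [-Complex.ofReal_add, -Complex.ofReal_div, -Complex.ofReal_mul, -Complex.ofReal_pow,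
      Complex.ofReal_re, Complex.ofReal_im]
    ring
  have hinner : ∀ ξ : E n, ξ ≠ 0 → ∫ v, F (ξ, v) ∂μ = ((√Real.pi / 2 : ℝ) : ℂ) *
      Complex.exp (-((ζ * ‖ξ‖ : ℝ) : ℂ) + (inner ℝ b ξ : ℝ) * Complex.I) := by
    intro ξ hξ
    have hs : 0 < ζ * ‖ξ‖ := by positivity
    have h1 : ∀ v : ℝ, F (ξ, v) = ((Real.exp (-v ^ 2 - (ζ * ‖ξ‖) ^ 2 / (4 * v ^ 2)) : ℝ) : ℂ) *
        Complex.exp ((inner ℝ b ξ : ℝ) * Complex.I) := by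
      intro v
      simp only [hF]
      rw [Complex.ofReal_exp, ← Complex.exp_add]
      congr 1
      push_cast
      ring
    simp only [h1]
    rw [integral_mul_const, integral_complex_ofReal, Complex.exp_add, ← mul_assoc]
    congr 1
    have h2 := exp_neg_eq_integral hs
    rw [← Complex.ofReal_neg, ← Complex.ofReal_exp, ← Complex.ofReal_mul, h2]
    congr 1
    have : √Real.pi ≠ 0 := by positivity
    rw [← mul_assoc, show √Real.pi / 2 * (2 / √Real.pi) = 1 by field_simp, one_mul]
  have hFi : Integrable F ((volume : Measure (E n)).prod μ) := by
    rw [integrable_prod_iff hFm]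
    have hne : ∀ᵐ ξ : E n, ξ ≠ 0 := by
      simp [ae_iff]
    constructor
    · filter_upwards [hne] with ξ hξ
      have hs : 0 < ζ * ‖ξ‖ := by positivity
      have h1 := (integral_exp_neg_sq_sub_sq (half_pos hs)).1
      rw [← integrable_norm_iff (by
        apply Measurable.aestronglyMeasurable
        fun_prop)]
      simp only [hnorm]
      refine h1.congr (Eventually.of_forall fun v => ?_)
      simp only
      rw [div_pow, div_div]; norm_num
    · refine ((integrable_exp_neg_mul_norm hn hζ).const_mul (√Real.pi / 2)).congr ?_
      filter_upwards [hne] with ξ hξ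
      have hs : 0 < ζ * ‖ξ‖ := by positivity
      simp only [hnorm]
      rw [exp_neg_eq_integral hs]
      have : √Real.pi ≠ 0 := by positivity
      rw [← mul_assoc, show √Real.pi / 2 * (2 / √Real.pi) = 1 by field_simp, one_mul]
  have houter : ∀ v ∈ Ioi (0 : ℝ), ∫ ξ : E n, F (ξ, v) =
      (((4 * Real.pi) ^ ((n : ℝ) / 2) * ζ ^ (-(n : ℝ)) *
        (v ^ (n : ℝ) * Real.exp (-((ζ ^ 2 + ‖b‖ ^ 2) / ζ ^ 2) * v ^ (2 : ℝ))) : ℝ) : ℂ) := by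
    intro v hv
    have hv' : (0 : ℝ) < v := hv
    have hB : 0 < ζ ^ 2 / (4 * v ^ 2) := by positivity
    have h := integral_gaussian_character hB b
    have h1 : ∀ ξ : E n, F (ξ, v) = ((Real.exp (-v ^ 2) : ℝ) : ℂ) *
        Complex.exp (-((ζ ^ 2 / (4 * v ^ 2) * ‖ξ‖ ^ 2 : ℝ) : ℂ) + (inner ℝ b ξ : ℝ) * Complex.I) := by
      intro ξ
      simp only [hF]
      rw [Complex.ofReal_exp, ← Complex.exp_add]
      congr 1
      push_cast
      ring
    simp only [h1]
    rw [integral_const_mul, h, ← Complex.ofReal_mul]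
    congr 1
    have e1 : Real.pi / (ζ ^ 2 / (4 * v ^ 2)) = (4 * Real.pi) * (v / ζ) ^ (2 : ℝ) := by
      rw [Real.rpow_two]; field_simp
    rw [e1, Real.mul_rpow (by positivity) (by positivity), ← Real.rpow_mul (by positivity),
      Real.div_rpow hv'.le hζ.le]
    have e2 : (2 : ℝ) * (n / 2) = n := by ring
    rw [e2, Real.rpow_neg hζ.le, Real.rpow_two]
    have e3 : Real.exp (-((ζ ^ 2 + ‖b‖ ^ 2) / ζ ^ 2) * v ^ 2) =
        Real.exp (-v ^ 2) * Real.exp (-(‖b‖ ^ 2 / (4 * (ζ ^ 2 / (4 * v ^ 2))))) := by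
      rw [← Real.exp_add]
      congr 1
      field_simp
      ring
    rw [e3]
    ring
  have hswap := integral_integral_swap (f := fun ξ v => F (ξ, v)) hFi
  have hl : ∫ ξ : E n, ∫ v, F (ξ, v) ∂μ = ((√Real.pi / 2 : ℝ) : ℂ) *
      ∫ ξ : E n, Complex.exp (-((ζ * ‖ξ‖ : ℝ) : ℂ) + (inner ℝ b ξ : ℝ) * Complex.I) := by
    rw [← integral_const_mul]
    refine integral_congr_ae ?_
    have hne : ∀ᵐ ξ : E n, ξ ≠ 0 := by
      simp [ae_iff]
    filter_upwards [hne] with ξ hξ using hinner ξ hξ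
  rw [hl, setIntegral_congr_fun measurableSet_Ioi houter, integral_complex_ofReal,
    integral_const_mul, integral_rpow_mul_exp_neg_mul_rpow (by norm_num)
    (by have : (0 : ℝ) ≤ n := by positivity
        linarith) (by positivity)] at hswap
  have hpi : ((√Real.pi / 2 : ℝ) : ℂ) ≠ 0 := by
    rw [Complex.ofReal_ne_zero]; positivity
  apply mul_left_cancel₀ hpi
  rw [hswap, ← Complex.ofReal_mul]
  congr 1
  rw [Real.div_rpow (by positivity) (by positivity), ← Real.rpow_two ζ, ← Real.rpow_mul hζ.le]
  have e1 : (2 : ℝ) * (-((n : ℝ) + 1) / 2) = -(n : ℝ) + -1 := by ring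
  rw [e1, Real.rpow_add hζ, Real.rpow_neg_one]
  have h1 : ζ ^ (-(n : ℝ)) ≠ 0 := (Real.rpow_pos_of_pos hζ _).ne'
  have : √Real.pi ≠ 0 := by positivity
  field_simp

end Poisson

/-! ### Spherical means of plane waves and the Poisson bound -/

section SphereKernel

variable {n : ℕ}

theorem re_sub_mul_I (z : ℂ) (t : ℝ) : (z - t * Complex.I).re = z.re := by simp

theorem sub_mul_I_ne_zero {z : ℂ} (hz : 0 < z.re) (t : ℝ) : z - t * Complex.I ≠ 0 := by
  intro h
  have := re_sub_mul_I z t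
  rw [h] at this
  simp at this
  linarith

theorem norm_inv_pow_le {z : ℂ} (hz : 0 < z.re) (t : ℝ) (k : ℕ) :
    ‖((z - t * Complex.I) ^ k)⁻¹‖ ≤ (z.re ^ k)⁻¹ := by
  rw [norm_inv, norm_pow]
  have h := Complex.abs_re_le_norm (z - t * Complex.I)
  rw [re_sub_mul_I, abs_of_pos hz] at h
  gcongr

theorem integrable_inv_pow {z : ℂ} (hz : 0 < z.re) (b : E n) (k : ℕ) :
    Integrable (fun Θ : S n => ((z - (inner ℝ b (Θ : E n) : ℝ) * Complex.I) ^ k)⁻¹) (surf n) := by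
  refine (integrable_const ((z.re ^ k)⁻¹)).mono' ?_
    (Eventually.of_forall fun Θ => norm_inv_pow_le hz _ k)
  apply Continuous.aestronglyMeasurable
  refine Continuous.inv₀ (by fun_prop) fun Θ => ?_
  exact pow_ne_zero _ (sub_mul_I_ne_zero hz _)

/-- In polar coordinates the radial part of the Fourier integral of `exp (-ζ‖ξ‖)` is a Laplace
integral equal to `(n-1)! (ζ - i⟨b, Θ⟩)⁻ⁿ`; what remains is the spherical mean. -/
theorem exists_integral_sphere_real (hn : 1 ≤ n) : ∃ c : ℝ, ∀ (ζ : ℝ), 0 < ζ → ∀ b : E n,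
    ∫ Θ : S n, ((((ζ : ℂ) - (inner ℝ b (Θ : E n) : ℝ) * Complex.I) ^ n)⁻¹) ∂(surf n) =
      ((c * (ζ * (ζ ^ 2 + ‖b‖ ^ 2) ^ (-((n : ℝ) + 1) / 2)) : ℝ) : ℂ) := by
  obtain ⟨c, hc⟩ := exists_integral_exp_neg_norm_character hn
  refine ⟨c / ((n - 1).factorial : ℝ), fun ζ hζ b => ?_⟩
  have hz : 0 < (ζ : ℂ).re := by simpa using hζ
  have hi := integrable_exp_neg_norm_character hn hζ b
  obtain ⟨h1, h2⟩ := integrable_polar hn (F := fun ξ : E n =>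
      Complex.exp (-((ζ * ‖ξ‖ : ℝ) : ℂ) + (inner ℝ b ξ : ℝ) * Complex.I))
  have h3 := h1.mp hi
  rw [integral_prod _ h3, hc ζ hζ b] at h2
  have h4 : ∀ Θ : S n, ∫ t in Ioi (0 : ℝ), t ^ (n - 1) •
      Complex.exp (-((ζ * ‖t • (Θ : E n)‖ : ℝ) : ℂ) +
        (inner ℝ b (t • (Θ : E n)) : ℝ) * Complex.I) =
      ((n - 1).factorial : ℂ) * (((ζ : ℂ) - (inner ℝ b (Θ : E n) : ℝ) * Complex.I) ^ n)⁻¹ := by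
    intro Θ
    have hz' : 0 < ((ζ : ℂ) - (inner ℝ b (Θ : E n) : ℝ) * Complex.I).re := by
      rwa [re_sub_mul_I]
    have h5 := integral_pow_mul_cexp_neg_mul (n - 1) hz'
    rw [Nat.sub_add_cancel hn] at h5
    rw [← h5]
    refine setIntegral_congr_fun measurableSet_Ioi fun t ht => ?_
    have ht' : (0 : ℝ) < t := ht
    have hΘ : ‖(Θ : E n)‖ = 1 := norm_eq_of_mem_sphere Θ
    simp only [norm_smul, hΘ, Real.norm_of_nonneg ht'.le, inner_smul_right, Complex.real_smul]
    push_cast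
    congr 2
    ring
  simp only [h4] at h2
  rw [integral_const_mul] at h2
  have hf : ((n - 1).factorial : ℂ) ≠ 0 := by exact_mod_cast Nat.factorial_ne_zero _
  apply mul_left_cancel₀ hf
  rw [← h2]
  push_cast
  field_simp

/-- The right half plane. -/
def rightHalfPlane : Set ℂ := {z | 0 < z.re}

theorem isOpen_rightHalfPlane : IsOpen rightHalfPlane :=
  isOpen_lt continuous_const Complex.continuous_re

theorem isPreconnected_rightHalfPlane : IsPreconnected rightHalfPlane :=
  (convex_halfSpace_re_gt 0).isPreconnected

/-- Keeps the principal branch of the power in the Poisson kernel holomorphic on the whole right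
half plane. -/
theorem sq_add_mem_slitPlane {z : ℂ} (hz : 0 < z.re) (β : ℝ) :
    z ^ 2 + (β : ℂ) ^ 2 ∈ Complex.slitPlane := by
  rw [Complex.mem_slitPlane_iff]
  by_cases h : z.im = 0
  · left
    simp [pow_two, h]
    nlinarith [mul_self_nonneg β]
  · right
    simp [pow_two]
    intro h'
    have : z.re * z.im = 0 := by linarith
    rcases mul_eq_zero.mp this with h1 | h1
    · exact hz.ne' h1
    · exact h h1

theorem differentiableOn_integral_sphere (b : E n) (k : ℕ) :
    DifferentiableOn ℂ (fun z => ∫ Θ : S n,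
      (((z - (inner ℝ b (Θ : E n) : ℝ) * Complex.I) ^ k)⁻¹) ∂(surf n)) rightHalfPlane := by
  intro z hz
  have hz : 0 < z.re := hz
  apply DifferentiableAt.differentiableWithinAt
  set s : Set ℂ := {w | z.re / 2 < w.re} with hs
  have hsn : s ∈ 𝓝 z :=
    (isOpen_lt continuous_const Complex.continuous_re).mem_nhds (by simp only [mem_ofPred_eq]; linarith)
  have hspos : ∀ w ∈ s, 0 < w.re := fun w hw => by
    have : z.re / 2 < w.re := hw
    linarith
  have hd := hasDerivAt_integral_of_dominated_loc_of_deriv_le (μ := surf n)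
    (F := fun w (Θ : S n) => ((w - (inner ℝ b (Θ : E n) : ℝ) * Complex.I) ^ k)⁻¹)
    (F' := fun w (Θ : S n) => -(k : ℂ) * (w - (inner ℝ b (Θ : E n) : ℝ) * Complex.I) ^ (k - 1) *
      (((w - (inner ℝ b (Θ : E n) : ℝ) * Complex.I) ^ k)⁻¹) ^ 2)
    (bound := fun _ => k * ((z.re / 2)⁻¹) ^ (k + 1)) hsn ?_ (integrable_inv_pow hz b k) ?_ ?_
    (integrable_const _) ?_
  · exact hd.2.differentiableAt
  · filter_upwards [hsn] with w hw
    exact (integrable_inv_pow (hspos w hw) b k).aestronglyMeasurable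
  · apply Continuous.aestronglyMeasurable
    have : Continuous fun Θ : S n => ((z - (inner ℝ b (Θ : E n) : ℝ) * Complex.I) ^ k)⁻¹ :=
      Continuous.inv₀ (by fun_prop) fun Θ => pow_ne_zero _ (sub_mul_I_ne_zero hz _)
    fun_prop
  · refine Eventually.of_forall fun Θ w hw => ?_
    have h0 := sub_mul_I_ne_zero (hspos w hw) (inner ℝ b (Θ : E n))
    set q := w - (inner ℝ b (Θ : E n) : ℝ) * Complex.I with hq
    have e : -(k : ℂ) * q ^ (k - 1) * ((q ^ k)⁻¹) ^ 2 = -(k : ℂ) * (q ^ (k + 1))⁻¹ := by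
      rcases Nat.eq_zero_or_pos k with rfl | hk
      · simp
      · obtain ⟨m, rfl⟩ : ∃ m, k = m + 1 := ⟨k - 1, by omega⟩
        simp only [Nat.add_sub_cancel]
        field_simp
        ring
    rw [e, norm_mul, norm_neg, Complex.norm_natCast]
    gcongr
    refine (norm_inv_pow_le (hspos w hw) _ (k + 1)).trans ?_
    rw [inv_pow]
    have : z.re / 2 < w.re := hw
    gcongr
  · refine Eventually.of_forall fun Θ w hw => ?_
    have h0 := sub_mul_I_ne_zero (hspos w hw) (inner ℝ b (Θ : E n))
    have h1 := (((hasDerivAt_id w).sub_const ((inner ℝ b (Θ : E n) : ℝ) * Complex.I)).pow k).inv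
      (pow_ne_zero k h0)
    refine h1.congr_deriv ?_
    simp only [id, Pi.pow_apply, mul_one]
    field_simp

/-- The mean of plane waves `(z - i ⟨b, Θ⟩)⁻ⁿ` over the unit sphere is a multiple of the Poisson
kernel at complex height `z`. -/
theorem exists_integral_sphere_complex (hn : 1 ≤ n) : ∃ c : ℝ, ∀ (z : ℂ), 0 < z.re → ∀ b : E n,
    ∫ Θ : S n, (((z - (inner ℝ b (Θ : E n) : ℝ) * Complex.I) ^ n)⁻¹) ∂(surf n) =
      c * (z * (z ^ 2 + (‖b‖ : ℂ) ^ 2) ^ (((-((n : ℝ) + 1) / 2 : ℝ) : ℂ))) := by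
  obtain ⟨c, hc⟩ := exists_integral_sphere_real hn
  refine ⟨c, fun z hz b => ?_⟩
  have a1 : AnalyticOnNhd ℂ (fun z => ∫ Θ : S n,
      (((z - (inner ℝ b (Θ : E n) : ℝ) * Complex.I) ^ n)⁻¹) ∂(surf n)) rightHalfPlane :=
    (differentiableOn_integral_sphere b n).analyticOnNhd isOpen_rightHalfPlane
  have a2 : AnalyticOnNhd ℂ (fun z : ℂ =>
      c * (z * (z ^ 2 + (‖b‖ : ℂ) ^ 2) ^ (((-((n : ℝ) + 1) / 2 : ℝ) : ℂ)))) rightHalfPlane := by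
    refine DifferentiableOn.analyticOnNhd (fun w hw => ?_) isOpen_rightHalfPlane
    apply DifferentiableAt.differentiableWithinAt
    have hb : DifferentiableAt ℂ (fun z : ℂ => z ^ 2 + (‖b‖ : ℂ) ^ 2) w := by fun_prop
    exact (differentiableAt_id.mul (hb.cpow (differentiableAt_const _)
      (sq_add_mem_slitPlane hw _))).const_mul _
  refine a1.eqOn_of_preconnected_of_frequently_eq a2 isPreconnected_rightHalfPlane
    (z₀ := 1) (by simp [rightHalfPlane]) ?_ hz
  -- The identity theorem needs agreement only along real points accumulating at 1.
  have ht : Tendsto (fun k : ℕ => (((1 + 1 / ((k : ℝ) + 1) : ℝ)) : ℂ)) atTop (𝓝[≠] (1 : ℂ)) := by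
    rw [tendsto_nhdsWithin_iff]
    constructor
    · have h1 : Tendsto (fun k : ℕ => (1 + 1 / ((k : ℝ) + 1) : ℝ)) atTop (𝓝 (1 + 0)) :=
        tendsto_const_nhds.add tendsto_one_div_add_atTop_nhds_zero_nat
      have h2 := (Complex.continuous_ofReal.tendsto _).comp h1
      simpa [Function.comp_def] using h2
    · refine Eventually.of_forall fun k => ?_
      have h1 : (0 : ℝ) < 1 / ((k : ℝ) + 1) := by positivity
      intro h
      have h' : (1 + 1 / ((k : ℝ) + 1) : ℝ) = 1 := by
        rw [mem_singleton_iff, Complex.ofReal_eq_one] at h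
        exact h
      linarith
  refine ht.frequently (Eventually.frequently (Eventually.of_forall fun k => ?_))
  have hk : (0 : ℝ) < 1 + 1 / ((k : ℝ) + 1) := by positivity
  rw [hc _ hk b, Complex.ofReal_mul, Complex.ofReal_mul, Complex.ofReal_cpow (by positivity)]
  push_cast
  rfl

/-- The right side is `tan |arg q|`. -/
theorem abs_arg_le_div {q : ℂ} (hq : 0 < q.re) : |q.arg| ≤ |q.im| / q.re := by
  have h1 : |q.arg| < Real.pi / 2 := Complex.abs_arg_lt_pi_div_two_iff.mpr (Or.inl hq)
  have h2 : |q.arg| ≤ Real.tan |q.arg| := Real.le_tan (abs_nonneg _) h1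
  have h3 : Real.tan |q.arg| = |q.im| / q.re := by
    rcases abs_cases q.arg with ⟨h, h'⟩ | ⟨h, h'⟩
    · rw [h, Complex.tan_arg, abs_of_nonneg (Complex.arg_nonneg_iff.mp h')]
    · rw [h, Real.tan_neg, Complex.tan_arg, abs_of_neg (Complex.arg_neg_iff.mp h')]
      ring
  rwa [h3] at h2

/-- Off the light cone the real part of the Poisson kernel at the complex height `ε + i a` is
bounded by the Poisson kernel at the height `ε`. -/
theorem abs_re_poisson_le {m p ε a β : ℝ} (hm : 0 ≤ m) (hp0 : 0 ≤ p) (hp1 : p < 1) (hε : 0 < ε)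
    (ha : |a| ≤ p * β) :
    |((((ε : ℂ) + a * Complex.I) *
        (((ε : ℂ) + a * Complex.I) ^ 2 + (β : ℂ) ^ 2) ^ ((-m : ℝ) : ℂ))).re| ≤
      (1 - p ^ 2) ^ (-m) * (1 + 2 * m / (1 - p ^ 2)) * (ε * (ε ^ 2 + β ^ 2) ^ (-m)) := by
  set q : ℂ := ((ε : ℂ) + a * Complex.I) ^ 2 + (β : ℂ) ^ 2 with hq
  set κ := 1 - p ^ 2 with hκ
  have hκ0 : 0 < κ := by rw [hκ]; nlinarith
  have hR : 0 < ε ^ 2 + β ^ 2 := by positivity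
  have hqre : q.re = ε ^ 2 - a ^ 2 + β ^ 2 := by simp [hq, pow_two]
  have hqim : q.im = 2 * ε * a := by simp [hq, pow_two]; ring
  have ha2 : a ^ 2 ≤ p ^ 2 * β ^ 2 := by
    rw [← mul_pow, ← sq_abs a]
    exact pow_le_pow_left₀ (abs_nonneg _) ha 2
  have ha3 : a ^ 2 ≤ ε ^ 2 + β ^ 2 := by nlinarith [sq_nonneg β, sq_nonneg ε, sq_nonneg p]
  -- Here `p < 1` enters: `q` is comparable to `ε² + β²` and lies in the right half plane, uniformly
  -- in `a`.
  have hre : κ * (ε ^ 2 + β ^ 2) ≤ q.re := by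
    rw [hqre, hκ]; nlinarith [sq_nonneg β, sq_nonneg ε, sq_nonneg p, mul_nonneg (sq_nonneg p) (sq_nonneg ε)]
  have hre0 : 0 < q.re := lt_of_lt_of_le (by positivity) hre
  have hq0 : q ≠ 0 := by rintro h; rw [h] at hre0; simp at hre0
  have hnq : κ * (ε ^ 2 + β ^ 2) ≤ ‖q‖ := hre.trans ((le_abs_self _).trans (Complex.abs_re_le_norm q))
  have hpow : ‖q‖ ^ (-m) ≤ κ ^ (-m) * (ε ^ 2 + β ^ 2) ^ (-m) := by
    rw [← Real.mul_rpow hκ0.le hR.le]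
    exact Real.rpow_le_rpow_of_nonpos (by positivity) hnq (by linarith)
  have hqp : q ^ ((-m : ℝ) : ℂ) = (‖q‖ ^ (-m) : ℝ) *
      (Real.cos (q.arg * (-m)) + Real.sin (q.arg * (-m)) * Complex.I) := by
    rw [Complex.cpow_def_of_ne_zero hq0, Complex.log, add_mul, Complex.exp_add,
      ← Complex.ofReal_mul, ← Complex.ofReal_exp, mul_right_comm, ← Complex.ofReal_mul,
      Complex.exp_mul_I, ← Complex.ofReal_cos, ← Complex.ofReal_sin,
      Real.rpow_def_of_pos (norm_pos_iff.mpr hq0)]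
  have hval : (((ε : ℂ) + a * Complex.I) * q ^ ((-m : ℝ) : ℂ)).re =
      ‖q‖ ^ (-m) * (ε * Real.cos (q.arg * (-m)) - a * Real.sin (q.arg * (-m))) := by
    rw [hqp]
    simp only [Complex.mul_re, Complex.mul_im, Complex.add_re, Complex.add_im, Complex.ofReal_re,
      Complex.ofReal_im, Complex.I_re, Complex.I_im]
    ring
  -- The term with `a` carries no visible factor `ε`. It gains one from `Im q = 2εa`, which makes
  -- the argument of `q` of order `ε|a| / Re q`; the resulting `a² / Re q` is bounded by `1/κ`.
  have hsin : |a * Real.sin (q.arg * (-m))| ≤ ε * (2 * m / κ) := by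
    rw [abs_mul]
    have h1 : |Real.sin (q.arg * (-m))| ≤ |q.im| / q.re * m := by
      refine Real.abs_sin_le_abs.trans ?_
      rw [abs_mul, abs_neg, abs_of_nonneg hm]
      exact mul_le_mul_of_nonneg_right (abs_arg_le_div hre0) hm
    have h2 : |q.im| = 2 * ε * |a| := by rw [hqim, abs_mul, abs_of_pos (by positivity)]
    rw [h2] at h1
    calc |a| * |Real.sin (q.arg * (-m))| ≤ |a| * (2 * ε * |a| / q.re * m) := by gcongr
      _ = 2 * ε * m * (a ^ 2 / q.re) := by rw [← sq_abs a]; ring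
      _ ≤ 2 * ε * m * (1 / κ) := by
        gcongr 2 * ε * m * ?_
        rw [div_le_div_iff₀ hre0 hκ0]
        nlinarith
      _ = ε * (2 * m / κ) := by ring
  have hcos : |ε * Real.cos (q.arg * (-m))| ≤ ε := by
    rw [abs_mul, abs_of_pos hε]
    exact mul_le_of_le_one_right hε.le (Real.abs_cos_le_one _)
  rw [hval, abs_mul, abs_of_nonneg (by positivity)]
  calc ‖q‖ ^ (-m) * |ε * Real.cos (q.arg * (-m)) - a * Real.sin (q.arg * (-m))|
      ≤ (κ ^ (-m) * (ε ^ 2 + β ^ 2) ^ (-m)) * (ε + ε * (2 * m / κ)) := by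
        gcongr
        exact (abs_sub _ _).trans (add_le_add hcos hsin)
    _ = _ := by ring

/-- The backprojected filter is bounded by the Poisson kernel. -/
theorem exists_abs_integral_filterKernel_le (hn : 1 ≤ n) {p : ℝ} (hp0 : 0 ≤ p) (hp1 : p < 1) :
    ∃ C : ℝ, 0 ≤ C ∧ ∀ (ε a : ℝ) (b : E n), 0 < ε → |a| ≤ p * ‖b‖ →
      |∫ Θ : S n, filterKernel n ε (a - inner ℝ b (Θ : E n)) ∂(surf n)| ≤
        C * (ε * (ε ^ 2 + ‖b‖ ^ 2) ^ (-(((n : ℝ) + 1) / 2))) := by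
  obtain ⟨c, hc⟩ := exists_integral_sphere_complex hn
  have hm : 0 ≤ ((n : ℝ) + 1) / 2 := by positivity
  have hκ0 : 0 < 1 - p ^ 2 := by nlinarith
  refine ⟨|c| * ((1 - p ^ 2) ^ (-(((n : ℝ) + 1) / 2)) *
    (1 + 2 * (((n : ℝ) + 1) / 2) / (1 - p ^ 2))), by positivity, fun ε a b hε ha => ?_⟩
  -- The shift `a` is absorbed into a complex height, so the averaged filter is the real part of the
  -- spherical mean at `z`.
  set z : ℂ := (ε : ℂ) + a * Complex.I with hz
  have hz0 : 0 < z.re := by simpa [hz] using hε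
  have h1 : ∀ Θ : S n, filterKernel n ε (a - inner ℝ b (Θ : E n)) =
      RCLike.re (((z - (inner ℝ b (Θ : E n) : ℝ) * Complex.I) ^ n)⁻¹) := by
    intro Θ
    simp only [filterKernel, RCLike.re_eq_complex_re]
    congr 3
    rw [hz]; push_cast; ring
  simp only [h1]
  rw [integral_re (integrable_inv_pow hz0 b n), hc z hz0 b, RCLike.re_eq_complex_re,
    Complex.re_ofReal_mul, abs_mul, mul_assoc]
  gcongr
  have := abs_re_poisson_le hm hp0 hp1 hε ha
  rwa [neg_div]

end SphereKernel

/-! ### The phase function, its gradient and its bounds -/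

section Phase

variable {n : ℕ} {p : ℝ} {Θ : S n} {y : E n}

theorem one_sub_norm_sq_pos (hy : ‖y‖ < 1) : 0 < 1 - ‖y‖ ^ 2 := by
  nlinarith [norm_nonneg y]

theorem norm_sphere (Θ : S n) : ‖(Θ : E n)‖ = 1 := norm_eq_of_mem_sphere Θ

/-- The radicand is `(2 lam - p)² + 1 - p²`. -/
theorem weight_sq_pos (hp0 : 0 < p) (hp1 : p < 1) (lam : ℝ) :
    1 - p ^ 2 ≤ 1 - 4 * p * lam + 4 * lam ^ 2 ∧ 0 < 1 - 4 * p * lam + 4 * lam ^ 2 := by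
  constructor
  · nlinarith [sq_nonneg (2 * lam - p)]
  · nlinarith [sq_nonneg (2 * lam - p)]

theorem weight_pos (hp0 : 0 < p) (hp1 : p < 1) (lam : ℝ) : 0 < weight p lam :=
  Real.sqrt_pos.mpr (weight_sq_pos hp0 hp1 lam).2

theorem weight_sq (hp0 : 0 < p) (hp1 : p < 1) (lam : ℝ) :
    weight p lam ^ 2 = 1 - 4 * p * lam + 4 * lam ^ 2 :=
  Real.sq_sqrt (weight_sq_pos hp0 hp1 lam).2.le

theorem sqrt_le_weight (hp0 : 0 < p) (hp1 : p < 1) (lam : ℝ) : √(1 - p ^ 2) ≤ weight p lam :=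
  Real.sqrt_le_sqrt (weight_sq_pos hp0 hp1 lam).1

theorem continuous_weight (p : ℝ) : Continuous (weight p) := by
  unfold weight; fun_prop

theorem measurable_phase (p : ℝ) (Θ : S n) : Measurable (phase p Θ) := by
  unfold phase; fun_prop

theorem hasGradientAt_phase (hy : ‖y‖ < 1) :
    HasGradientAt (phase p Θ) ((1 - ‖y‖ ^ 2)⁻¹ • ((2 * phase p Θ y) • y - (Θ : E n))) y := by
  have h0 := (one_sub_norm_sq_pos hy).ne'
  rw [hasGradientAt_iff_hasFDerivAt]
  have h1 : HasFDerivAt (fun y : E n => p - inner ℝ y (Θ : E n)) (-(innerSL ℝ (Θ : E n))) y := by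
    have : HasFDerivAt (fun y : E n => inner ℝ y (Θ : E n)) (innerSL ℝ (Θ : E n)) y := by
      have h := (innerSL ℝ (Θ : E n)).hasFDerivAt (x := y)
      refine h.congr_of_eventuallyEq (Eventually.of_forall fun z => ?_)
      simp [real_inner_comm]
    exact this.const_sub p
  have h2 : HasFDerivAt (fun y : E n => 1 - ‖y‖ ^ 2) (-(2 • (innerSL ℝ y))) y :=
    (HasStrictFDerivAt.hasFDerivAt (hasStrictFDerivAt_norm_sq y)).const_sub 1
  have h3 := h1.mul ((hasDerivAt_inv h0).comp_hasFDerivAt y h2)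
  refine (h3.congr_of_eventuallyEq (Eventually.of_forall fun z => ?_)).congr_fderiv ?_
  · simp [phase, div_eq_mul_inv]
  · ext v
    simp only [phase, InnerProductSpace.toDual_apply_apply, inner_smul_left, inner_sub_left]
    simp
    field_simp
    ring

theorem gradient_phase (hy : ‖y‖ < 1) :
    gradient (phase p Θ) y = (1 - ‖y‖ ^ 2)⁻¹ • ((2 * phase p Θ y) • y - (Θ : E n)) :=
  (hasGradientAt_phase hy).gradient

theorem inner_eq_of_phase (hy : ‖y‖ < 1) :
    inner ℝ y (Θ : E n) = p - phase p Θ y * (1 - ‖y‖ ^ 2) := by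
  have h0 := (one_sub_norm_sq_pos hy).ne'
  unfold phase
  field_simp
  ring

/-- Expanding the square and eliminating `⟨y, Θ⟩` by `inner_eq_of_phase` cancels `‖y‖²`. This is why
the gradient norm is a function of the phase alone, up to the factor `1 / (1 - ‖y‖²)`. -/
theorem norm_sub_eq_weight (hp0 : 0 < p) (hp1 : p < 1) (hy : ‖y‖ < 1) :
    ‖(2 * phase p Θ y) • y - (Θ : E n)‖ = weight p (phase p Θ y) := by
  rw [← sq_eq_sq₀ (norm_nonneg _) (weight_pos hp0 hp1 _).le, weight_sq hp0 hp1,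
    norm_sub_sq_real, norm_smul, inner_smul_left, inner_eq_of_phase (p := p) hy, norm_sphere,
    mul_pow, Real.norm_eq_abs, sq_abs]
  simp
  ring

theorem norm_gradient_phase (hp0 : 0 < p) (hp1 : p < 1) (hy : ‖y‖ < 1) :
    ‖gradient (phase p Θ) y‖ = weight p (phase p Θ y) / (1 - ‖y‖ ^ 2) := by
  rw [gradient_phase hy, norm_smul, norm_sub_eq_weight hp0 hp1 hy, norm_inv,
    Real.norm_of_nonneg (one_sub_norm_sq_pos hy).le]
  ring

/-- The rescaled function lives in the ball of radius `p`, so only positive level values matter for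
it. -/
theorem phase_pos (hp1 : p < 1) (hy : ‖y‖ < p) : 0 < phase p Θ y := by
  have h1 : inner ℝ y (Θ : E n) ≤ ‖y‖ := by
    simpa [norm_sphere] using real_inner_le_norm y (Θ : E n)
  exact div_pos (by linarith) (one_sub_norm_sq_pos (hy.trans hp1))

theorem abs_phase_le {k : ℝ} (hp0 : 0 < p) (hp1 : p < 1) (hk : k < 1) (hy : ‖y‖ ≤ k) :
    |phase p Θ y| ≤ 2 / (1 - k ^ 2) := by
  have hk0 : 0 ≤ k := (norm_nonneg y).trans hy
  have h1 : |inner ℝ y (Θ : E n)| ≤ ‖y‖ := by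
    simpa [norm_sphere] using abs_real_inner_le_norm y (Θ : E n)
  have h2 := one_sub_norm_sq_pos (hy.trans_lt hk)
  have h3 : 0 < 1 - k ^ 2 := by nlinarith
  rw [phase, abs_div, abs_of_pos h2]
  gcongr
  refine (abs_sub _ _).trans ?_
  rw [abs_of_pos hp0]
  linarith

theorem exists_norm_gradient_phase_le {k : ℝ} (hp0 : 0 < p) (hp1 : p < 1) (hk : k < 1) :
    ∃ C : ℝ, 0 ≤ C ∧ ∀ (Θ : S n) (y : E n), ‖y‖ ≤ k → ‖gradient (phase p Θ) y‖ ≤ C := by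
  by_cases hk0 : 0 ≤ k
  · have h3 : 0 < 1 - k ^ 2 := by nlinarith
    set M := 2 / (1 - k ^ 2) with hM
    have hM0 : 0 ≤ M := by positivity
    refine ⟨√(1 + 4 * M + 4 * M ^ 2) / (1 - k ^ 2), by positivity, fun Θ y hy => ?_⟩
    rw [norm_gradient_phase hp0 hp1 (hy.trans_lt hk)]
    have h1 := abs_phase_le (Θ := Θ) hp0 hp1 hk hy
    gcongr
    apply Real.sqrt_le_sqrt
    have h4 : phase p Θ y ^ 2 ≤ M ^ 2 := by
      rw [← sq_abs]
      exact pow_le_pow_left₀ (abs_nonneg _) h1 2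
    nlinarith [neg_abs_le (phase p Θ y)]
  · exact ⟨0, le_rfl, fun Θ y hy => absurd ((norm_nonneg y).trans hy) hk0⟩

theorem le_norm_gradient_phase (hp0 : 0 < p) (hp1 : p < 1) (hy : ‖y‖ < 1) :
    √(1 - p ^ 2) ≤ ‖gradient (phase p Θ) y‖ := by
  rw [norm_gradient_phase hp0 hp1 hy, le_div_iff₀ (one_sub_norm_sq_pos hy)]
  refine (mul_le_of_le_one_right (Real.sqrt_nonneg _) ?_).trans (sqrt_le_weight hp0 hp1 _)
  nlinarith [sq_nonneg ‖y‖]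

theorem norm_gradient_phase_pos (hp0 : 0 < p) (hp1 : p < 1) (hy : ‖y‖ < 1) :
    0 < ‖gradient (phase p Θ) y‖ := by
  rw [norm_gradient_phase hp0 hp1 hy]
  exact div_pos (weight_pos hp0 hp1 _) (one_sub_norm_sq_pos hy)

end Phase

/-! ### A chart turning level sets into concentric spheres -/

section Chart

variable {n : ℕ} {p : ℝ} {Θ : S n} {y : E n}

/-- The point in the direction `ω` from the center of the sphere `phase p Θ = lam`. -/
def levelPoint (p : ℝ) (Θ : S n) (lam : ℝ) (ω : E n) : E n :=
  (1 / (2 * lam)) • (Θ : E n) + (weight p lam / (2 * lam)) • ω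

/-- The chart that maps the level set `phase p Θ = lam` into the sphere of radius `lam`. -/
def levelChart (p : ℝ) (Θ : S n) (y : E n) : E n :=
  (2 * phase p Θ y ^ 2 / weight p (phase p Θ y)) • y -
    (phase p Θ y / weight p (phase p Θ y)) • (Θ : E n)

theorem levelChart_eq (y : E n) : levelChart p Θ y =
    (phase p Θ y / weight p (phase p Θ y)) • ((2 * phase p Θ y) • y - (Θ : E n)) := by
  rw [levelChart, smul_sub, smul_smul]
  congr 2
  ring

theorem norm_levelChart_sq (hp0 : 0 < p) (hp1 : p < 1) (hy : ‖y‖ < 1) :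
    ‖levelChart p Θ y‖ ^ 2 = phase p Θ y ^ 2 := by
  rw [levelChart_eq, norm_smul, norm_sub_eq_weight hp0 hp1 hy, mul_pow, Real.norm_eq_abs, sq_abs,
    ← mul_pow, div_mul_cancel₀ _ (weight_pos hp0 hp1 _).ne']

theorem norm_levelChart (hp0 : 0 < p) (hp1 : p < 1) (hy : ‖y‖ < p) :
    ‖levelChart p Θ y‖ = phase p Θ y := by
  rw [← sq_eq_sq₀ (norm_nonneg _) (phase_pos hp1 hy).le]
  exact norm_levelChart_sq hp0 hp1 (hy.trans hp1)

theorem levelChart_eq_gradient (hp0 : 0 < p) (hp1 : p < 1) (hy : ‖y‖ < 1) : levelChart p Θ y =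
    (phase p Θ y / ‖gradient (phase p Θ) y‖) • gradient (phase p Θ) y := by
  have h0 := (one_sub_norm_sq_pos hy).ne'
  have h1 := (weight_pos hp0 hp1 (phase p Θ y)).ne'
  rw [levelChart_eq, norm_gradient_phase hp0 hp1 hy, gradient_phase hy, smul_smul]
  congr 1
  field_simp

theorem levelPoint_levelChart (hp0 : 0 < p) (hp1 : p < 1) (hy : ‖y‖ < p) :
    levelPoint p Θ ‖levelChart p Θ y‖ (‖levelChart p Θ y‖⁻¹ • levelChart p Θ y) = y := by
  have h0 := (phase_pos (Θ := Θ) hp1 hy).ne'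
  have h1 := (weight_pos hp0 hp1 (phase p Θ y)).ne'
  rw [norm_levelChart hp0 hp1 hy, levelPoint, levelChart_eq, smul_smul, smul_smul,
    show weight p (phase p Θ y) / (2 * phase p Θ y) * (phase p Θ y)⁻¹ *
      (phase p Θ y / weight p (phase p Θ y)) = 1 / (2 * phase p Θ y) by field_simp,
    ← smul_add, add_sub_cancel, smul_smul,
    show 1 / (2 * phase p Θ y) * (2 * phase p Θ y) = 1 by field_simp, one_smul]

theorem phase_levelPoint (hp0 : 0 < p) (hp1 : p < 1) {lam : ℝ} (hl : 0 < lam) {ω : E n}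
    (hω : ‖ω‖ = 1) (h : ‖levelPoint p Θ lam ω‖ < 1) : phase p Θ (levelPoint p Θ lam ω) = lam := by
  have h0 := one_sub_norm_sq_pos h
  have hw := weight_sq hp0 hp1 lam
  rw [phase, div_eq_iff h0.ne']
  have e1 : inner ℝ (levelPoint p Θ lam ω) (Θ : E n) =
      1 / (2 * lam) + weight p lam / (2 * lam) * inner ℝ ω (Θ : E n) := by
    rw [levelPoint, inner_add_left, inner_smul_left, inner_smul_left, real_inner_self_eq_norm_sq,
      norm_sphere]
    simp
  have e2 : ‖levelPoint p Θ lam ω‖ ^ 2 = (1 / (2 * lam)) ^ 2 +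
      2 * (1 / (2 * lam) * (weight p lam / (2 * lam)) * inner ℝ ω (Θ : E n)) +
      (weight p lam / (2 * lam)) ^ 2 := by
    rw [levelPoint, norm_add_sq_real, norm_smul, norm_smul, inner_smul_left, inner_smul_right,
      norm_sphere, hω, real_inner_comm, mul_one, mul_one, Real.norm_eq_abs, sq_abs,
      Real.norm_eq_abs, sq_abs]
    simp
    ring
  rw [e1, e2]
  field_simp
  rw [hw]
  ring

theorem levelChart_levelPoint (hp0 : 0 < p) (hp1 : p < 1) {lam : ℝ} (hl : 0 < lam) {ω : E n}
    (hω : ‖ω‖ = 1) (h : ‖levelPoint p Θ lam ω‖ < 1) :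
    levelChart p Θ (levelPoint p Θ lam ω) = lam • ω := by
  have h1 := (weight_pos hp0 hp1 lam).ne'
  rw [levelChart_eq, phase_levelPoint hp0 hp1 hl hω h, levelPoint, smul_add, smul_smul, smul_smul,
    show 2 * lam * (1 / (2 * lam)) = 1 by field_simp, one_smul, add_sub_cancel_left, smul_smul]
  congr 1
  field_simp

/-- The chart is `A(Ψ) y - B(Ψ) Θ` with scalar functions `A`, `B`, so its derivative is a multiple
of the identity plus a rank one map. The vector `V` can stay unspecified: the determinant uses only
its component along the gradient, which is found indirectly. -/
theorem exists_hasFDerivAt_levelChart (hp0 : 0 < p) (hp1 : p < 1) (hy : ‖y‖ < 1) :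
    ∃ V : E n, HasFDerivAt (levelChart p Θ)
      ((2 * phase p Θ y ^ 2 / weight p (phase p Θ y)) • ContinuousLinearMap.id ℝ (E n) +
        (innerSL ℝ (gradient (phase p Θ) y)).smulRight V) y := by
  have hg : HasFDerivAt (phase p Θ) (innerSL ℝ (gradient (phase p Θ) y)) y := by
    have := (hasGradientAt_phase (p := p) (Θ := Θ) hy)
    rw [gradient_phase hy]
    exact (hasGradientAt_iff_hasFDerivAt.mp this)
  have hw : DifferentiableAt ℝ (weight p) (phase p Θ y) := by
    unfold weight
    exact DifferentiableAt.sqrt (by fun_prop) (weight_sq_pos hp0 hp1 _).2.ne'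
  have hw0 := (weight_pos hp0 hp1 (phase p Θ y)).ne'
  have hA : DifferentiableAt ℝ (fun l => 2 * l ^ 2 / weight p l) (phase p Θ y) :=
    DifferentiableAt.div (by fun_prop) hw hw0
  have hB : DifferentiableAt ℝ (fun l => l / weight p l) (phase p Θ y) :=
    DifferentiableAt.div (by fun_prop) hw hw0
  have h1 := (hA.hasDerivAt.comp_hasFDerivAt y hg).smul (hasFDerivAt_id y)
  have h2 := (hB.hasDerivAt.comp_hasFDerivAt y hg).smul (hasFDerivAt_const (Θ : E n) y)
  refine ⟨deriv (fun l => 2 * l ^ 2 / weight p l) (phase p Θ y) • y -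
    deriv (fun l => l / weight p l) (phase p Θ y) • (Θ : E n), (h1.sub h2).congr_fderiv ?_⟩
  ext1 v
  simp only [Function.comp_apply, id_eq, smul_zero, zero_add, _root_.sub_apply,
    _root_.add_apply, _root_.smul_apply,
    ContinuousLinearMap.smulRight_apply, smul_eq_mul, smul_sub, smul_smul, mul_comm]
  abel

theorem det_smul_id_add_smulRight (hn : 1 ≤ n) {A : ℝ} (hA : A ≠ 0) (g V : E n) :
    (A • ContinuousLinearMap.id ℝ (E n) + (innerSL ℝ g).smulRight V).det =
      A ^ (n - 1) * (A + inner ℝ g V) := by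
  have h : ((A • ContinuousLinearMap.id ℝ (E n) + (innerSL ℝ g).smulRight V : E n →L[ℝ] E n) :
      E n →ₗ[ℝ] E n) = A • LinearMap.transvection (innerSL ℝ g : E n →ₗ[ℝ] ℝ) (A⁻¹ • V) := by
    ext1 v
    simp [LinearMap.transvection, smul_smul]
    congr 1
    field_simp
  rw [ContinuousLinearMap.det, h, LinearMap.det_smul, LinearMap.transvection.det]
  obtain ⟨m, rfl⟩ : ∃ m, n = m + 1 := ⟨n - 1, by omega⟩
  simp [pow_succ]
  field_simp

theorem exists_hasFDerivAt_levelChart_det (hn : 1 ≤ n) (hp0 : 0 < p) (hp1 : p < 1) (hy : ‖y‖ < p) :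
    ∃ D : E n →L[ℝ] E n, HasFDerivAt (levelChart p Θ) D y ∧
      D.det = (2 * phase p Θ y ^ 2 / weight p (phase p Θ y)) ^ (n - 1) *
        ‖gradient (phase p Θ) y‖ := by
  have hy1 := hy.trans hp1
  obtain ⟨V, hV⟩ := exists_hasFDerivAt_levelChart (Θ := Θ) hp0 hp1 hy1
  refine ⟨_, hV, ?_⟩
  have hψ := phase_pos (Θ := Θ) hp1 hy
  have hw := weight_pos hp0 hp1 (phase p Θ y)
  rw [det_smul_id_add_smulRight hn (by positivity)]
  congr 1
  set A := 2 * phase p Θ y ^ 2 / weight p (phase p Θ y)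
  set g := gradient (phase p Θ) y with hg
  have hg0 : 0 < ‖g‖ := norm_gradient_phase_pos hp0 hp1 hy1
  have hgd : HasFDerivAt (phase p Θ) (innerSL ℝ g) y := by
    have := (hasGradientAt_phase (p := p) (Θ := Θ) hy1)
    rw [hg, gradient_phase hy1]
    exact (hasGradientAt_iff_hasFDerivAt.mp this)
  -- Differentiating `‖levelChart‖² = Ψ²` along `g`, and using that the chart value is `Ψ/‖g‖` times
  -- `g`, gives `A + ⟨g, V⟩ = ‖g‖` without computing `V`.
  have h1 := hV.norm_sq
  have h2 := hgd.pow 2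
  have h3 : (fun y => phase p Θ y ^ 2) =ᶠ[𝓝 y] fun y => ‖levelChart p Θ y‖ ^ 2 := by
    have : ∀ᶠ z : E n in 𝓝 y, ‖z‖ < 1 := continuous_norm.continuousAt.eventually_lt_const hy1
    filter_upwards [this] with z hz using (norm_levelChart_sq hp0 hp1 hz).symm
  have h4 := (h1.congr_of_eventuallyEq h3).unique h2
  have h5 := congrArg (fun L : E n →L[ℝ] ℝ => L g) h4
  rw [levelChart_eq_gradient hp0 hp1 hy1, ← hg] at h5
  clear_value g
  simp at h5
  field_simp at h5
  exact h5

end Chart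

/-! ### The coarea formula for the level spheres -/

section Coarea

variable {n : ℕ} {p : ℝ}

theorem measurable_norm_gradient_mul {Θ : S n} (hp0 : 0 < p) (hp1 : p < 1) {F : Type*}
    [NormedAddCommGroup F] [NormedSpace ℝ F] {u : E n → F}
    (hu0 : ∀ y, y ∉ ball (0 : E n) p → u y = 0) :
    (fun y => ‖gradient (phase p Θ) y‖ • u y) =
      fun y => (weight p (phase p Θ y) / (1 - ‖y‖ ^ 2)) • u y := by
  ext1 y
  by_cases hy : y ∈ ball (0 : E n) p
  · rw [norm_gradient_phase hp0 hp1 ((mem_ball_zero_iff.mp hy).trans hp1)]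
  · simp [hu0 y hy]

theorem integrable_norm_gradient_smul {Θ : S n} (hp0 : 0 < p) (hp1 : p < 1) {u : E n → ℂ}
    (hu : Integrable u) (hu0 : ∀ y, y ∉ ball (0 : E n) p → u y = 0) :
    Integrable (fun y => ‖gradient (phase p Θ) y‖ • u y) := by
  obtain ⟨C, hC0, hC⟩ := exists_norm_gradient_phase_le (n := n) hp0 hp1 hp1
  refine (hu.norm.const_mul C).mono' ?_ (Eventually.of_forall fun y => ?_)
  · rw [measurable_norm_gradient_mul hp0 hp1 hu0]
    have h1 := measurable_phase p Θ
    have h2 := (continuous_weight p).measurable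
    have h3 : Measurable fun y : E n => weight p (phase p Θ y) / (1 - ‖y‖ ^ 2) :=
      (h2.comp h1).div (by fun_prop)
    exact h3.aestronglyMeasurable.smul hu.aestronglyMeasurable
  · rw [norm_smul, norm_norm]
    by_cases hy : y ∈ ball (0 : E n) p
    · gcongr
      exact hC Θ y (mem_ball_zero_iff.mp hy).le
    · simp [hu0 y hy]

/-- Change of variables by the chart on the ball of radius `p`, then polar coordinates in the image,
where the radial variable is `lam` itself. The chart's Jacobian and the polar factor `lam ^ (n - 1)`
combine to the `(n-1)`-st power of the sphere radius. -/
theorem coarea_prod (hn : 1 ≤ n) (hp0 : 0 < p) (hp1 : p < 1) (Θ : S n) {u : E n → ℂ}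
    (hu : Integrable u) (hu0 : ∀ y, y ∉ ball (0 : E n) p → u y = 0) :
    Integrable (fun q : S n × ℝ => (weight p q.2 / (2 * q.2)) ^ (n - 1) •
      u (levelPoint p Θ q.2 q.1)) ((surf n).prod (volume.restrict (Ioi (0 : ℝ)))) ∧
    ∫ q : S n × ℝ, (weight p q.2 / (2 * q.2)) ^ (n - 1) • u (levelPoint p Θ q.2 q.1)
      ∂((surf n).prod (volume.restrict (Ioi (0 : ℝ)))) =
      ∫ y, ‖gradient (phase p Θ) y‖ • u y := by
  classical
  -- The factor cancels the `(n-1)`-st power in the Jacobian, leaving the gradient norm. The value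
  -- at 0 is set by hand so that the support lies in the image of the chart: under division by zero
  -- `levelPoint` would return the origin, and for `n = 1` the factor would be 1.
  set F : E n → ℂ := fun z => if z = 0 then 0 else
    (weight p ‖z‖ / (2 * ‖z‖ ^ 2)) ^ (n - 1) • u (levelPoint p Θ ‖z‖ (‖z‖⁻¹ • z)) with hF
  choose! D hD hdet using fun (y : E n) (hy : ‖y‖ < p) =>
    exists_hasFDerivAt_levelChart_det (Θ := Θ) hn hp0 hp1 hy
  have hD' : ∀ y ∈ ball (0 : E n) p,
      HasFDerivWithinAt (levelChart p Θ) (D y) (ball (0 : E n) p) y :=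
    fun y hy => (hD y (mem_ball_zero_iff.mp hy)).hasFDerivWithinAt
  have hinj : InjOn (levelChart p Θ) (ball (0 : E n) p) := by
    intro x hx y hy hxy
    rw [← levelPoint_levelChart (Θ := Θ) hp0 hp1 (mem_ball_zero_iff.mp hx), hxy,
      levelPoint_levelChart hp0 hp1 (mem_ball_zero_iff.mp hy)]
  have hsupp : Function.support F ⊆ levelChart p Θ '' ball (0 : E n) p := by
    intro z hz
    rw [Function.mem_support] at hz
    simp only [hF] at hz
    split_ifs at hz with h0
    · exact absurd rfl hz
    · have hz0 : 0 < ‖z‖ := norm_pos_iff.mpr h0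
      have hmem : levelPoint p Θ ‖z‖ (‖z‖⁻¹ • z) ∈ ball (0 : E n) p := by
        by_contra h
        exact hz (by rw [hu0 _ h, smul_zero])
      have hun : ‖‖z‖⁻¹ • z‖ = 1 := by
        rw [norm_smul, norm_inv, norm_norm, inv_mul_cancel₀ hz0.ne']
      refine ⟨_, hmem, ?_⟩
      rw [levelChart_levelPoint hp0 hp1 hz0 hun ((mem_ball_zero_iff.mp hmem).trans hp1), smul_smul,
        mul_inv_cancel₀ hz0.ne', one_smul]
  have hpt : ∀ y ∈ ball (0 : E n) p, |(D y).det| • F (levelChart p Θ y) =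
      ‖gradient (phase p Θ) y‖ • u y := by
    intro y hy
    have hy' := mem_ball_zero_iff.mp hy
    have hψ := phase_pos (Θ := Θ) hp1 hy'
    have hw := weight_pos hp0 hp1 (phase p Θ y)
    have hne : levelChart p Θ y ≠ 0 := by
      rw [← norm_pos_iff, norm_levelChart hp0 hp1 hy']
      exact hψ
    simp only [hF, if_neg hne]
    rw [levelPoint_levelChart hp0 hp1 hy', norm_levelChart hp0 hp1 hy', hdet y hy', abs_mul,
      abs_norm, abs_of_nonneg (by positivity), smul_smul, mul_right_comm, ← mul_pow,
      show 2 * phase p Θ y ^ 2 / weight p (phase p Θ y) *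
        (weight p (phase p Θ y) / (2 * phase p Θ y ^ 2)) = 1 by field_simp, one_pow, one_mul]
  have hg := integrable_norm_gradient_smul (Θ := Θ) hp0 hp1 hu hu0
  have hgs : Function.support (fun y => ‖gradient (phase p Θ) y‖ • u y) ⊆ ball (0 : E n) p := by
    intro y hy
    by_contra h
    exact hy (by simp [hu0 y h])
  have hFi : Integrable F := by
    rw [← integrableOn_iff_integrable_of_support_subset hsupp,
      integrableOn_image_iff_integrableOn_abs_det_fderiv_smul volume measurableSet_ball hD' hinj,
      integrableOn_congr_fun hpt measurableSet_ball]
    exact hg.integrableOn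
  have hFe : ∫ z, F z = ∫ y, ‖gradient (phase p Θ) y‖ • u y := by
    rw [← setIntegral_eq_integral_of_forall_compl_eq_zero
        (s := levelChart p Θ '' ball (0 : E n) p)
        (fun z hz => by_contra fun h => hz (hsupp h)),
      integral_image_eq_integral_abs_det_fderiv_smul volume measurableSet_ball hD' hinj,
      setIntegral_congr_fun measurableSet_ball hpt,
      setIntegral_eq_integral_of_forall_compl_eq_zero
        (fun z hz => by_contra fun h => hz (hgs h))]
  have hpol := integrable_polar hn (F := F)
  have hcong : (fun q : S n × ℝ => q.2 ^ (n - 1) • F (q.2 • (q.1 : E n)))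
      =ᵐ[(surf n).prod (volume.restrict (Ioi (0 : ℝ)))]
      fun q : S n × ℝ => (weight p q.2 / (2 * q.2)) ^ (n - 1) • u (levelPoint p Θ q.2 q.1) := by
    have hpos : ∀ᵐ q : S n × ℝ ∂((surf n).prod (volume.restrict (Ioi (0 : ℝ)))), 0 < q.2 :=
      Measure.quasiMeasurePreserving_snd.ae (ae_restrict_mem measurableSet_Ioi)
    filter_upwards [hpos] with q hq
    have hnq : ‖q.2 • (q.1 : E n)‖ = q.2 := by
      rw [norm_smul, norm_sphere, mul_one, Real.norm_of_nonneg hq.le]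
    have hne : q.2 • (q.1 : E n) ≠ 0 := by
      rw [← norm_pos_iff, hnq]; exact hq
    simp only [hF, if_neg hne]
    rw [hnq, smul_smul, smul_smul, inv_mul_cancel₀ hq.ne', one_smul, ← mul_pow]
    congr 2
    field_simp
  exact ⟨(hpol.1.mp hFi).congr hcong, by rw [← integral_congr_ae hcong, ← hpol.2, hFe]⟩

/-- The integral of `u` over the sphere `phase p Θ = lam`, for `lam > 0`. -/
def levelIntegral (p : ℝ) (Θ : S n) (u : E n → ℂ) (lam : ℝ) : ℂ :=
  if 0 < lam then (weight p lam / (2 * lam)) ^ (n - 1) •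
    ∫ ω : S n, u (levelPoint p Θ lam ω) ∂(surf n) else 0

/-- Fubini for the integrable function on the product; the factor multiplying it is nonzero for
positive `lam`. -/
theorem ae_integrable_levelPoint (hn : 1 ≤ n) (hp0 : 0 < p) (hp1 : p < 1) (Θ : S n) {u : E n → ℂ}
    (hu : Integrable u) (hu0 : ∀ y, y ∉ ball (0 : E n) p → u y = 0) :
    ∀ᵐ lam : ℝ, 0 < lam → Integrable (fun ω : S n => u (levelPoint p Θ lam ω)) (surf n) := by
  have h := (coarea_prod hn hp0 hp1 Θ hu hu0).1.prod_left_ae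
  rw [ae_restrict_iff' measurableSet_Ioi] at h
  filter_upwards [h] with lam hlam hpos
  have hc : (weight p lam / (2 * lam)) ^ (n - 1) ≠ 0 :=
    pow_ne_zero _ (div_pos (weight_pos hp0 hp1 lam) (by linarith)).ne'
  exact (integrable_smul_iff hc _).mp (hlam hpos)

theorem levelIntegral_eq_indicator (Θ : S n) (u : E n → ℂ) :
    levelIntegral p Θ u = (Ioi (0 : ℝ)).indicator fun lam => ∫ ω : S n,
      (weight p lam / (2 * lam)) ^ (n - 1) • u (levelPoint p Θ lam ω) ∂(surf n) := by
  ext1 lam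
  simp only [levelIntegral, indicator, mem_Ioi, integral_smul]

theorem integrable_levelIntegral (hn : 1 ≤ n) (hp0 : 0 < p) (hp1 : p < 1) (Θ : S n) {u : E n → ℂ}
    (hu : Integrable u) (hu0 : ∀ y, y ∉ ball (0 : E n) p → u y = 0) :
    Integrable (levelIntegral p Θ u) := by
  rw [levelIntegral_eq_indicator, integrable_indicator_iff measurableSet_Ioi]
  exact (coarea_prod hn hp0 hp1 Θ hu hu0).1.integral_prod_right

theorem integral_levelIntegral (hn : 1 ≤ n) (hp0 : 0 < p) (hp1 : p < 1) (Θ : S n) {u : E n → ℂ}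
    (hu : Integrable u) (hu0 : ∀ y, y ∉ ball (0 : E n) p → u y = 0) :
    ∫ lam, levelIntegral p Θ u lam = ∫ y, ‖gradient (phase p Θ) y‖ • u y := by
  obtain ⟨h1, h2⟩ := coarea_prod hn hp0 hp1 Θ hu hu0
  rw [← h2, integral_prod_symm _ h1, levelIntegral_eq_indicator,
    integral_indicator measurableSet_Ioi]

/-- The phase is constant on the part of the sphere where `u` can be nonzero. This turns the total
coarea identity into one with an arbitrary bounded test function of the phase. -/
theorem levelIntegral_smul (hp0 : 0 < p) (hp1 : p < 1) (Θ : S n) {u : E n → ℂ}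
    (hu0 : ∀ y, y ∉ ball (0 : E n) p → u y = 0) (h : ℝ → ℝ) (lam : ℝ) :
    levelIntegral p Θ (fun y => h (phase p Θ y) • u y) lam = h lam • levelIntegral p Θ u lam := by
  unfold levelIntegral
  split_ifs with hl
  · rw [smul_comm (h lam), ← integral_smul (h lam)]
    congr 1
    refine integral_congr_ae (Eventually.of_forall fun ω => ?_)
    simp only
    by_cases hm : levelPoint p Θ lam ω ∈ ball (0 : E n) p
    · rw [phase_levelPoint hp0 hp1 hl (norm_sphere ω) ((mem_ball_zero_iff.mp hm).trans hp1)]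
    · simp [hu0 _ hm]
  · simp

theorem integrable_comp_phase_smul (Θ : S n) {u : E n → ℂ} (hu : Integrable u) {h : ℝ → ℝ}
    (hm : Measurable h) {C : ℝ} (hC : ∀ lam, |h lam| ≤ C) :
    Integrable (fun y => h (phase p Θ y) • u y) :=
  hu.bdd_smul C (hm.comp (measurable_phase p Θ)).aestronglyMeasurable
    (Eventually.of_forall fun _ => hC _)

/-- The coarea formula for the level sets of `phase p Θ`. -/
theorem integral_smul_levelIntegral (hn : 1 ≤ n) (hp0 : 0 < p) (hp1 : p < 1) (Θ : S n)
    {u : E n → ℂ} (hu : Integrable u) (hu0 : ∀ y, y ∉ ball (0 : E n) p → u y = 0) {h : ℝ → ℝ}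
    (hm : Measurable h) {C : ℝ} (hC : ∀ lam, |h lam| ≤ C) :
    ∫ lam, h lam • levelIntegral p Θ u lam =
      ∫ y, h (phase p Θ y) • ‖gradient (phase p Θ) y‖ • u y := by
  have hi := integrable_comp_phase_smul (p := p) Θ hu hm hC
  have h1 := integral_levelIntegral hn hp0 hp1 Θ hi (fun y hy => by simp [hu0 y hy])
  simp only [levelIntegral_smul hp0 hp1 Θ hu0] at h1
  rw [h1]
  refine integral_congr_ae (Eventually.of_forall fun y => ?_)
  exact smul_comm _ _ _

theorem setIntegral_levelIntegral (hn : 1 ≤ n) (hp0 : 0 < p) (hp1 : p < 1) (Θ : S n)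
    {u : E n → ℂ} (hu : Integrable u) (hu0 : ∀ y, y ∉ ball (0 : E n) p → u y = 0) {s : Set ℝ}
    (hs : MeasurableSet s) :
    ∫ lam in s, levelIntegral p Θ u lam =
      ∫ y in {y : E n | phase p Θ y ∈ s}, ‖gradient (phase p Θ) y‖ • u y := by
  have hsm : MeasurableSet {y : E n | phase p Θ y ∈ s} := measurable_phase p Θ hs
  have h1 := integral_smul_levelIntegral hn hp0 hp1 Θ hu hu0
    (h := s.indicator fun _ => 1) (measurable_const.indicator hs) (C := 1) (fun lam => by
      by_cases h : lam ∈ s <;> simp [h])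
  rw [← integral_indicator hs, ← integral_indicator hsm]
  refine Eq.trans ?_ (h1.trans ?_)
  · refine integral_congr_ae (Eventually.of_forall fun lam => ?_)
    by_cases h : lam ∈ s <;> simp [h]
  · refine integral_congr_ae (Eventually.of_forall fun y => ?_)
    by_cases h : phase p Θ y ∈ s <;> simp [indicator, h]

end Coarea

/-! ### The spherical transform as an equidistant transform -/

section Transform

variable {n : ℕ} {p : ℝ}

/-- With `α² = p⁻² - 1` and center at distance `1/(2p lam)`, completing the expansion of the
radicand produces `weight p lam ^ 2 / (2p lam)²`. This is what identifies the two families of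
spheres. -/
theorem radius_center {α lam : ℝ} (hp : p = 1 / √(1 + α ^ 2)) (hp0 : 0 < p) (hp1 : p < 1)
    (hl : 0 < lam) (Θ : S n) :
    radius α (center α lam Θ) = p⁻¹ * (weight p lam / (2 * lam)) := by
  have hs : √(1 + α ^ 2) = p⁻¹ := by rw [hp, one_div, inv_inv]
  have hα : α ^ 2 = (p⁻¹) ^ 2 - 1 := by
    rw [← hs, Real.sq_sqrt (by positivity)]; ring
  have hw := weight_sq hp0 hp1 lam
  have hw0 := weight_pos hp0 hp1 lam
  have hn : ‖center α lam Θ‖ = p⁻¹ / (2 * lam) := by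
    rw [center, norm_smul, norm_sphere, hs, Real.norm_of_nonneg (by positivity), mul_one]
  rw [radius, hn, hα, ← Real.sqrt_sq (show 0 ≤ p⁻¹ * (weight p lam / (2 * lam)) by positivity)]
  congr 1
  rw [mul_pow, div_pow, hw]
  field_simp
  ring

theorem center_add_radius_smul {α lam : ℝ} (hp : p = 1 / √(1 + α ^ 2)) (hp0 : 0 < p) (hp1 : p < 1)
    (hl : 0 < lam) (Θ : S n) (ω : E n) :
    center α lam Θ + radius α (center α lam Θ) • ω = p⁻¹ • levelPoint p Θ lam ω := by
  have hs : √(1 + α ^ 2) = p⁻¹ := by rw [hp, one_div, inv_inv]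
  rw [radius_center hp hp0 hp1 hl, center, hs, levelPoint, smul_add, smul_smul, smul_smul,
    mul_one_div]

theorem radonPolar_eq {α : ℝ} (hp : p = 1 / √(1 + α ^ 2)) (hp0 : 0 < p) (hp1 : p < 1)
    (f : E n → ℂ) (lam : ℝ) (Θ : S n) :
    radonPolar α f lam Θ =
      (1 / p ^ (n - 1)) • levelIntegral p Θ (fun y => f (p⁻¹ • y)) lam := by
  unfold radonPolar levelIntegral
  split_ifs with hl
  · simp only [radon, sphereIntegral, center_add_radius_smul hp hp0 hp1 hl]
    rw [radius_center hp hp0 hp1 hl, smul_smul, mul_pow, inv_pow, one_div]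
  · simp

theorem pow_smul_radonPolar {α : ℝ} (hp : p = 1 / √(1 + α ^ 2)) (hp0 : 0 < p) (hp1 : p < 1)
    (f : E n → ℂ) (lam : ℝ) (Θ : S n) :
    p ^ (n - 1) • radonPolar α f lam Θ = levelIntegral p Θ (fun y => f (p⁻¹ • y)) lam := by
  rw [radonPolar_eq hp hp0 hp1, smul_smul, mul_one_div_cancel (pow_ne_zero _ hp0.ne'), one_smul]

theorem comp_inv_smul_eq_zero (hp0 : 0 < p) {f : E n → ℂ}
    (hf : ∀ x, x ∉ ball (0 : E n) 1 → f x = 0) :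
    ∀ y, y ∉ ball (0 : E n) p → f (p⁻¹ • y) = 0 := by
  intro y hy
  apply hf
  rw [mem_ball_zero_iff, not_lt] at hy ⊢
  rw [norm_smul, norm_inv, Real.norm_of_nonneg hp0.le]
  rwa [inv_mul_eq_div, le_div_iff₀ hp0, one_mul]

/-- The averages are symmetric difference quotients of the primitive, so differentiability of the
primitive suffices. This covers both Lebesgue points and points of continuity. -/
theorem tendsto_symmetric_average {G : ℝ → ℂ} (hG : Integrable G) {lam : ℝ} {v : ℂ}
    (h : HasDerivAt (fun x => ∫ t in (0 : ℝ)..x, G t) v lam) :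
    Tendsto (fun ε : ℝ => (1 / (2 * ε)) • ∫ t in Ioo (lam - ε) (lam + ε), G t) (𝓝[>] 0) (𝓝 v) := by
  have h1 : HasDerivAt (fun ε : ℝ => (∫ t in (0 : ℝ)..(lam + ε), G t) -
      ∫ t in (0 : ℝ)..(lam - ε), G t) ((2 : ℝ) • v) 0 := by
    have ha : HasDerivAt (fun ε : ℝ => lam + ε) 1 0 := (hasDerivAt_id (0 : ℝ)).const_add lam
    have hb : HasDerivAt (fun ε : ℝ => lam - ε) (-1) 0 := (hasDerivAt_id (0 : ℝ)).const_sub lam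
    have h2 := HasDerivAt.scomp (0 : ℝ) (h := fun ε : ℝ => lam + ε) (by simpa using h) ha
    have h3 := HasDerivAt.scomp (0 : ℝ) (h := fun ε : ℝ => lam - ε) (by simpa using h) hb
    refine (h2.sub h3).congr_deriv ?_
    simp [two_smul]
  have h2 := (h1.tendsto_slope_zero_right).const_smul (1 / 2 : ℝ)
  rw [smul_smul, show (1 / 2 : ℝ) * 2 = 1 by norm_num, one_smul] at h2
  refine h2.congr' ?_
  filter_upwards [self_mem_nhdsWithin] with ε hε
  have hε' : (0 : ℝ) < ε := hε
  simp only [zero_add, add_zero, sub_zero, sub_self]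
  rw [intervalIntegral.integral_interval_sub_left hG.intervalIntegrable hG.intervalIntegrable,
    intervalIntegral.integral_of_le (by linarith), integral_Ioc_eq_integral_Ioo, smul_smul]
  congr 1
  field_simp

theorem hasEquidistantTransform_of_hasDerivAt (hn : 1 ≤ n) (hp0 : 0 < p) (hp1 : p < 1) (Θ : S n)
    {u : E n → ℂ} (hu : Integrable u) (hu0 : ∀ y, y ∉ ball (0 : E n) p → u y = 0) {lam : ℝ} {v : ℂ}
    (h : HasDerivAt (fun x => ∫ t in (0 : ℝ)..x, levelIntegral p Θ u t) v lam) :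
    HasEquidistantTransform p u lam Θ v := by
  have h1 := tendsto_symmetric_average (integrable_levelIntegral hn hp0 hp1 Θ hu hu0) h
  refine h1.congr fun ε => ?_
  rw [setIntegral_levelIntegral hn hp0 hp1 Θ hu hu0 measurableSet_Ioo]
  congr 3
  ext y
  simp only [mem_ofPred_eq, mem_Ioo, abs_lt]
  constructor <;> rintro ⟨h1, h2⟩ <;> constructor <;> linarith

theorem ae_hasEquidistantTransform (hn : 1 ≤ n) (hp0 : 0 < p) (hp1 : p < 1) (Θ : S n)
    {u : E n → ℂ} (hu : Integrable u) (hu0 : ∀ y, y ∉ ball (0 : E n) p → u y = 0) :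
    ∀ᵐ lam : ℝ, HasEquidistantTransform p u lam Θ (levelIntegral p Θ u lam) := by
  have h := LocallyIntegrable.ae_hasDerivAt_integral
    (integrable_levelIntegral hn hp0 hp1 Θ hu hu0).locallyIntegrable
  filter_upwards [h] with lam hlam
  exact hasEquidistantTransform_of_hasDerivAt hn hp0 hp1 Θ hu hu0 (hlam 0)

theorem hasCompactSupport_of_eq_zero {u : E n → ℂ} (hu0 : ∀ y, y ∉ ball (0 : E n) p → u y = 0) :
    HasCompactSupport u := by
  refine HasCompactSupport.intro (isCompact_closedBall (0 : E n) p) fun y hy => hu0 y fun h => ?_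
  exact hy (ball_subset_closedBall h)

/-- For negative `lam` the function vanishes nearby; for positive `lam` the spheres move
continuously and dominated convergence applies. At 0 center and radius blow up, so that point is
excluded. -/
theorem continuousAt_levelIntegral (Θ : S n)
    {u : E n → ℂ} (hu : Continuous u) (hu0 : ∀ y, y ∉ ball (0 : E n) p → u y = 0) {lam : ℝ}
    (hl : lam ≠ 0) : ContinuousAt (levelIntegral p Θ u) lam := by
  rcases lt_or_gt_of_ne hl with hl | hl
  · have : levelIntegral p Θ u =ᶠ[𝓝 lam] fun _ => 0 := by
      filter_upwards [eventually_lt_nhds hl] with t ht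
      rw [levelIntegral, if_neg (not_lt.mpr ht.le)]
    exact continuousAt_const.congr this.symm
  · obtain ⟨C, hC⟩ := hu.bounded_above_of_compact_support (hasCompactSupport_of_eq_zero hu0)
    have hev : (fun t => (weight p t / (2 * t)) ^ (n - 1) •
        ∫ ω : S n, u (levelPoint p Θ t ω) ∂(surf n)) =ᶠ[𝓝 lam] levelIntegral p Θ u := by
      filter_upwards [eventually_gt_nhds hl] with t ht
      rw [levelIntegral, if_pos ht]
    refine ContinuousAt.congr ?_ hev
    have hw := (continuous_weight p).continuousAt (x := lam)
    have h2 : (2 * lam) ≠ 0 := by positivity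
    refine ContinuousAt.smul (ContinuousAt.pow (hw.div (by fun_prop) h2) _) ?_
    refine continuousAt_of_dominated (bound := fun _ => C) ?_ ?_ (integrable_const _) ?_
    · refine Eventually.of_forall fun t => Continuous.aestronglyMeasurable ?_
      unfold levelPoint
      fun_prop
    · exact Eventually.of_forall fun t => Eventually.of_forall fun ω => hC _
    · refine Eventually.of_forall fun ω => ?_
      refine hu.continuousAt.comp ?_
      unfold levelPoint
      have h3 : ContinuousAt (fun t : ℝ => 1 / (2 * t)) lam :=
        continuousAt_const.div (by fun_prop) h2
      have h4 : ContinuousAt (fun t : ℝ => weight p t / (2 * t)) lam := hw.div (by fun_prop) h2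
      fun_prop

theorem pow_sub_pow_le_mul {a b : ℝ} (hb : 0 ≤ b) (hab : b ≤ a) (ha : a ≤ 1) (k : ℕ) :
    a ^ k - b ^ k ≤ k * (a - b) := by
  induction k with
  | zero => simp
  | succ k ih =>
    have h1 : a ^ k ≤ 1 := pow_le_one₀ (hb.trans hab) ha
    push_cast
    calc a ^ (k + 1) - b ^ (k + 1) = a ^ k * (a - b) + b * (a ^ k - b ^ k) := by ring
      _ ≤ 1 * (a - b) + 1 * (k * (a - b)) := by
        have h2 : 0 ≤ a ^ k - b ^ k := sub_nonneg.mpr (pow_le_pow_left₀ hb hab k)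
        gcongr
        exact hab.trans ha
      _ = _ := by ring

theorem volume_shell_le (hn : 1 ≤ n) {ε : ℝ} (hp1 : p ≤ 1) (hε : 0 ≤ ε) (hεp : ε ≤ p) :
    (volume : Measure (E n)).real (ball 0 p \ ball 0 (p - ε)) ≤
      n * ε * (volume : Measure (E n)).real (ball 0 1) := by
  have : Nontrivial (E n) := by
    have : Nonempty (Fin n) := ⟨⟨0, hn⟩⟩
    exact inferInstance
  have hv : ∀ r : ℝ, 0 ≤ r → (volume : Measure (E n)).real (ball 0 r) =
      r ^ n * (volume : Measure (E n)).real (ball 0 1) := by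
    intro r hr
    rw [measureReal_def, Measure.addHaar_ball _ _ hr, ENNReal.toReal_mul,
      ENNReal.toReal_ofReal (by positivity)]
    simp [measureReal_def]
  rw [measureReal_sdiff (ball_subset_ball (by linarith)) measurableSet_ball
    measure_ball_lt_top.ne, hv p (by linarith),
    hv (p - ε) (by linarith), ← sub_mul]
  gcongr
  have := pow_sub_pow_le_mul (a := p) (b := p - ε) (by linarith) (by linarith) hp1 n
  simpa using this

/-- Within the ball of radius `p`, the set `|Ψ| < ε` lies in a boundary shell of volume `O(ε)`,
which compensates the factor `1/(2ε)`. It also shrinks to the boundary point `pΘ`, where `u`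
vanishes, so continuity makes the integrand small. -/
theorem hasEquidistantTransform_zero (hn : 1 ≤ n) (hp0 : 0 < p) (hp1 : p < 1) (Θ : S n)
    {u : E n → ℂ} (hu : Continuous u) (hu0 : ∀ y, y ∉ ball (0 : E n) p → u y = 0) :
    HasEquidistantTransform p u 0 Θ 0 := by
  obtain ⟨C, hC0, hC⟩ := exists_norm_gradient_phase_le (n := n) hp0 hp1 hp1
  set M := C * (n * (volume : Measure (E n)).real (ball 0 1)) with hM
  have hM0 : 0 ≤ M := by positivity
  have huΘ : u (p • (Θ : E n)) = 0 := by
    apply hu0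
    rw [mem_ball_zero_iff, norm_smul, norm_sphere, Real.norm_of_nonneg hp0.le]
    simp
  unfold HasEquidistantTransform HasDeltaIntegral
  rw [Metric.tendsto_nhds]
  intro δ hδ
  have hη : 0 < δ / (M + 1) := by positivity
  obtain ⟨r, hr0, hr⟩ := Metric.continuous_iff.mp hu (p • (Θ : E n)) _ hη
  -- From `⟨y, Θ⟩ > p - ε` and `‖y‖ < p` one gets `‖y - pΘ‖² < 2pε ≤ 2ε`, whence the bound `r² / 2`;
  -- the bound `p` keeps the inner radius `p - ε` positive.
  have hsmall : ∀ᶠ ε : ℝ in 𝓝[>] 0, ε < min p (r ^ 2 / 2) :=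
    eventually_nhdsWithin_of_eventually_nhds (eventually_lt_nhds (by positivity))
  filter_upwards [self_mem_nhdsWithin, hsmall] with ε hε hε2
  have hε0 : (0 : ℝ) < ε := hε
  have hεp : ε < p := hε2.trans_le (min_le_left _ _)
  have hεr : ε < r ^ 2 / 2 := hε2.trans_le (min_le_right _ _)
  have hkey : ∀ y ∈ ball (0 : E n) p, |0 - phase p Θ y| < ε →
      y ∉ ball (0 : E n) (p - ε) ∧ ‖u y‖ < δ / (M + 1) := by
    intro y hy hψ
    have hy' := mem_ball_zero_iff.mp hy
    have h1 : p - inner ℝ y (Θ : E n) < ε := by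
      have e := inner_eq_of_phase (p := p) (Θ := Θ) (hy'.trans hp1)
      have h2 := phase_pos (Θ := Θ) hp1 hy'
      rw [zero_sub, abs_neg, abs_of_pos h2] at hψ
      nlinarith [sq_nonneg ‖y‖]
    have h3 : inner ℝ y (Θ : E n) ≤ ‖y‖ := by
      simpa [norm_sphere] using real_inner_le_norm y (Θ : E n)
    constructor
    · rw [mem_ball_zero_iff]; linarith
    · have h4 : dist y (p • (Θ : E n)) < r := by
        rw [dist_eq_norm, ← sq_lt_sq₀ (norm_nonneg _) hr0.le, norm_sub_sq_real, inner_smul_right,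
          norm_smul, norm_sphere, Real.norm_of_nonneg hp0.le]
        nlinarith [norm_nonneg y]
      have := hr y h4
      rwa [huΘ, dist_zero_right] at this
  set T := {y : E n | |0 - phase p Θ y| < ε} with hT
  set T' := T ∩ (ball (0 : E n) p \ ball 0 (p - ε)) with hT'
  have hTm : MeasurableSet T := by
    have := measurable_phase p Θ
    exact measurableSet_lt (by fun_prop) measurable_const
  have hT'm : MeasurableSet T' := hTm.inter (measurableSet_ball.diff measurableSet_ball)
  have hvol : (volume : Measure (E n)).real T' ≤
      n * ε * (volume : Measure (E n)).real (ball 0 1) := by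
    refine le_trans (measureReal_mono inter_subset_right ?_)
      (volume_shell_le hn hp1.le hε0.le hεp.le)
    exact ((measure_mono sdiff_subset).trans_lt measure_ball_lt_top).ne
  have hint : ∫ y in T, ‖gradient (phase p Θ) y‖ • u y =
      ∫ y in T', ‖gradient (phase p Θ) y‖ • u y := by
    refine setIntegral_eq_of_subset_of_forall_sdiff_eq_zero hTm inter_subset_left fun y hy => ?_
    by_cases hyp : y ∈ ball (0 : E n) p
    · exact absurd ⟨hy.1, hyp, (hkey y hyp hy.1).1⟩ hy.2
    · simp [hu0 y hyp]
  have hbd : ‖∫ y in T', ‖gradient (phase p Θ) y‖ • u y‖ ≤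
      (C * (δ / (M + 1))) * (volume : Measure (E n)).real T' := by
    refine norm_setIntegral_le_of_norm_le_const ?_ fun y hy => ?_
    · exact (measure_mono (inter_subset_right.trans sdiff_subset)).trans_lt measure_ball_lt_top
    · rw [norm_smul, norm_norm]
      gcongr
      · exact hC Θ y (mem_ball_zero_iff.mp hy.2.1).le
      · exact (hkey y hy.2.1 hy.1).2.le
  rw [dist_zero_right, norm_smul, hint, Real.norm_of_nonneg (by positivity)]
  calc 1 / (2 * ε) * ‖∫ y in T', ‖gradient (phase p Θ) y‖ • u y‖
      ≤ 1 / (2 * ε) * ((C * (δ / (M + 1))) *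
          (n * ε * (volume : Measure (E n)).real (ball 0 1))) := by
        gcongr
        exact hbd.trans (by gcongr)
    _ = (M / (M + 1)) * (δ / 2) := by rw [hM]; field_simp
    _ ≤ 1 * (δ / 2) := by
        gcongr
        rw [div_le_one (by positivity)]; linarith
    _ < δ := by linarith

theorem hasEquidistantTransform_of_continuous (hn : 1 ≤ n) (hp0 : 0 < p) (hp1 : p < 1) (Θ : S n)
    {u : E n → ℂ} (hu : Continuous u) (hu0 : ∀ y, y ∉ ball (0 : E n) p → u y = 0) (lam : ℝ) :
    HasEquidistantTransform p u lam Θ (levelIntegral p Θ u lam) := by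
  have hui : Integrable u := hu.integrable_of_hasCompactSupport (hasCompactSupport_of_eq_zero hu0)
  rcases eq_or_ne lam 0 with rfl | hl
  · rw [levelIntegral, if_neg (lt_irrefl _)]
    exact hasEquidistantTransform_zero hn hp0 hp1 Θ hu hu0
  · have hi := integrable_levelIntegral hn hp0 hp1 Θ hui hu0
    refine hasEquidistantTransform_of_hasDerivAt hn hp0 hp1 Θ hui hu0 ?_
    exact intervalIntegral.integral_hasDerivAt_right hi.intervalIntegrable
      ⟨univ, univ_mem, hi.aestronglyMeasurable.restrict⟩
      (continuousAt_levelIntegral Θ hu hu0 hl)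

end Transform

/-! ### The total mass of the averaged filter -/

section FilterMass

variable {n : ℕ}

theorem filterKernel_eq_re (n : ℕ) (ε s : ℝ) :
    filterKernel n ε s = ((((ε : ℂ) - ((-s : ℝ) : ℂ) * Complex.I) ^ n)⁻¹).re := by
  simp [filterKernel]

theorem abs_filterKernel_le (n : ℕ) {ε : ℝ} (hε : 0 < ε) (s : ℝ) :
    |filterKernel n ε s| ≤ (ε ^ n)⁻¹ := by
  rw [filterKernel_eq_re]
  refine (Complex.abs_re_le_norm _).trans ?_
  have := norm_inv_pow_le (z := (ε : ℂ)) (by simpa using hε) (-s) n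
  simpa using this

theorem continuous_filterKernel (n : ℕ) {ε : ℝ} (hε : 0 < ε) : Continuous (filterKernel n ε) := by
  have : filterKernel n ε = fun s => ((((ε : ℂ) - ((-s : ℝ) : ℂ) * Complex.I) ^ n)⁻¹).re := by
    ext s; exact filterKernel_eq_re n ε s
  rw [this]
  refine Complex.continuous_re.comp (Continuous.inv₀ (by fun_prop) fun s => ?_)
  exact pow_ne_zero _ (sub_mul_I_ne_zero (by simpa using hε) _)

theorem filterKernel_scale (n : ℕ) {ε : ℝ} (hε : 0 < ε) (s : ℝ) :
    ε ^ n * filterKernel n ε s = filterKernel n 1 (s / ε) := by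
  have hε' : (ε : ℂ) ≠ 0 := by exact_mod_cast hε.ne'
  rw [filterKernel, filterKernel, ← Complex.re_ofReal_mul]
  congr 1
  have : (ε : ℂ) + s * Complex.I = ε * (((1 : ℝ) : ℂ) + ((s / ε : ℝ) : ℂ) * Complex.I) := by
    push_cast
    field_simp
  rw [this, mul_pow, mul_inv]
  push_cast
  field_simp

theorem integrable_exp_neg_mul_norm_sq {B : ℝ} (hB : 0 < B) :
    Integrable (fun z : E n => Real.exp (-(B * ‖z‖ ^ 2))) := by
  have := (GaussianFourier.integrable_cexp_neg_mul_sq_norm_add (b := (B : ℂ))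
    (V := E n) (by rwa [Complex.ofReal_re]) 0 0).norm
  refine this.congr (Eventually.of_forall fun z => ?_)
  simp only [Complex.norm_exp]
  congr 1
  rw [← Complex.ofReal_pow, ← Complex.ofReal_neg, ← Complex.ofReal_mul]
  simp [-Complex.ofReal_mul, -Complex.ofReal_neg, -Complex.ofReal_pow]

/-- A single plane-wave filter is not integrable over the whole space when `n ≥ 2` and `g ≠ 0`,
hence the Gaussian cutoff. The filter is written as a Laplace integral in `σ`, the `z`-integral
becomes a Gaussian Fourier transform, and `σ = δτ` cancels the powers of `δ`, so that `δ → 0` can be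
taken. -/
theorem integral_gaussian_filterKernel (hn : 1 ≤ n) {δ : ℝ} (hδ : 0 < δ) (g : E n) :
    ∫ z : E n, Real.exp (-(δ ^ 2 / 2 * ‖z‖ ^ 2)) * filterKernel n 1 (inner ℝ g z) =
      (2 * Real.pi) ^ ((n : ℝ) / 2) / ((n - 1).factorial : ℝ) *
        ∫ τ in Ioi (0 : ℝ), τ ^ (n - 1) * (Real.exp (-(δ * τ)) *
          Real.exp (-(‖g‖ ^ 2 / 2 * τ ^ 2))) := by
  have hB : 0 < δ ^ 2 / 2 := by positivity
  have hgi : Integrable (fun z : E n => Real.exp (-(δ ^ 2 / 2 * ‖z‖ ^ 2))) :=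
    integrable_exp_neg_mul_norm_sq hB
  set F : E n → ℝ → ℂ := fun z σ => ((Real.exp (-(δ ^ 2 / 2 * ‖z‖ ^ 2)) : ℝ) : ℂ) *
    ((σ : ℂ) ^ (n - 1) * Complex.exp (-(σ * (1 + (inner ℝ g z : ℝ) * Complex.I)))) with hF
  have hFi : Integrable (Function.uncurry F)
      ((volume : Measure (E n)).prod (volume.restrict (Ioi (0 : ℝ)))) := by
    have h1 := hgi.mul_prod (integrableOn_pow_mul_exp_neg_mul (n - 1) one_pos)
    refine h1.mono' ?_ ?_
    · apply Continuous.aestronglyMeasurable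
      simp only [hF, Function.uncurry_def]
      fun_prop
    · have hpos : ∀ᵐ q : E n × ℝ ∂((volume : Measure (E n)).prod (volume.restrict (Ioi (0 : ℝ)))),
          0 < q.2 := Measure.quasiMeasurePreserving_snd.ae (ae_restrict_mem measurableSet_Ioi)
      filter_upwards [hpos] with q hq
      simp only [hF, Function.uncurry_def]
      rw [norm_mul, norm_mul, norm_pow, Complex.norm_real, Complex.norm_real, Complex.norm_exp,
        Real.norm_of_nonneg hq.le, Real.norm_of_nonneg (Real.exp_nonneg _)]
      simp
  have hin : ∀ z, ∫ σ in Ioi (0 : ℝ), F z σ = ((n - 1).factorial : ℂ) *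
      (((Real.exp (-(δ ^ 2 / 2 * ‖z‖ ^ 2)) : ℝ) : ℂ) *
        ((((1 : ℝ) : ℂ) + (inner ℝ g z : ℝ) * Complex.I) ^ n)⁻¹) := by
    intro z
    simp only [hF]
    rw [integral_const_mul, integral_pow_mul_cexp_neg_mul (n - 1) (by simp),
      Nat.sub_add_cancel hn]
    push_cast
    ring
  have hout : ∀ σ ∈ Ioi (0 : ℝ), ∫ z, F z σ = ((((2 * Real.pi / δ ^ 2) ^ ((n : ℝ) / 2)) *
      (σ ^ (n - 1) * (Real.exp (-σ) * Real.exp (-(‖g‖ ^ 2 * σ ^ 2 / (2 * δ ^ 2))))) : ℝ) : ℂ) := by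
    intro σ hσ
    have h := integral_gaussian_character hB (-σ • g)
    have h1 : ∀ z : E n, F z σ = ((σ ^ (n - 1) * Real.exp (-σ) : ℝ) : ℂ) *
        Complex.exp (-((δ ^ 2 / 2 * ‖z‖ ^ 2 : ℝ) : ℂ) + (inner ℝ (-σ • g) z : ℝ) * Complex.I) := by
      intro z
      simp only [hF]
      rw [Complex.ofReal_mul, Complex.ofReal_exp, Complex.ofReal_exp, mul_left_comm, mul_assoc,
        ← Complex.exp_add, ← Complex.exp_add, inner_smul_left]
      push_cast
      congr 2
      simp
      ring
    simp only [h1]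
    rw [integral_const_mul, h, ← Complex.ofReal_mul]
    congr 1
    have e1 : Real.pi / (δ ^ 2 / 2) = 2 * Real.pi / δ ^ 2 := by field_simp
    have e2 : ‖-σ • g‖ ^ 2 / (4 * (δ ^ 2 / 2)) = ‖g‖ ^ 2 * σ ^ 2 / (2 * δ ^ 2) := by
      rw [norm_smul, norm_neg, mul_pow, Real.norm_eq_abs, sq_abs]
      field_simp
      ring
    rw [e1, e2]
    ring
  have hswap := integral_integral_swap hFi
  rw [setIntegral_congr_fun measurableSet_Ioi hout, integral_complex_ofReal,
    integral_const_mul] at hswap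
  simp only [hin] at hswap
  rw [integral_const_mul] at hswap
  have hf0 : ((n - 1).factorial : ℝ) ≠ 0 := by exact_mod_cast Nat.factorial_ne_zero _
  have hci : Integrable (fun z : E n => (((Real.exp (-(δ ^ 2 / 2 * ‖z‖ ^ 2)) : ℝ) : ℂ) *
        ((((1 : ℝ) : ℂ) + (inner ℝ g z : ℝ) * Complex.I) ^ n)⁻¹)) := by
    have h2 := hFi.integral_prod_left
    simp only [Function.uncurry_apply_pair, hin] at h2
    have h3 := h2.const_mul (((n - 1).factorial : ℂ)⁻¹)
    refine h3.congr (Eventually.of_forall fun z => ?_)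
    have : ((n - 1).factorial : ℂ) ≠ 0 := by exact_mod_cast Nat.factorial_ne_zero _
    simp only
    rw [← mul_assoc, inv_mul_cancel₀ this, one_mul]
  have hre : ∫ z : E n, Real.exp (-(δ ^ 2 / 2 * ‖z‖ ^ 2)) * filterKernel n 1 (inner ℝ g z) =
      (∫ z : E n, (((Real.exp (-(δ ^ 2 / 2 * ‖z‖ ^ 2)) : ℝ) : ℂ) *
        ((((1 : ℝ) : ℂ) + (inner ℝ g z : ℝ) * Complex.I) ^ n)⁻¹)).re := by
    have := integral_re hci
    simp only [RCLike.re_eq_complex_re] at this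
    rw [← this]
    refine integral_congr_ae (Eventually.of_forall fun z => ?_)
    simp only [Complex.re_ofReal_mul, filterKernel]
  have hsub : ∫ σ in Ioi (0 : ℝ), σ ^ (n - 1) * (Real.exp (-σ) *
      Real.exp (-(‖g‖ ^ 2 * σ ^ 2 / (2 * δ ^ 2)))) =
      δ ^ n * ∫ τ in Ioi (0 : ℝ), τ ^ (n - 1) * (Real.exp (-(δ * τ)) *
          Real.exp (-(‖g‖ ^ 2 / 2 * τ ^ 2))) := by
    have h := integral_comp_mul_left_Ioi (fun σ : ℝ => σ ^ (n - 1) * (Real.exp (-σ) *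
      Real.exp (-(‖g‖ ^ 2 * σ ^ 2 / (2 * δ ^ 2))))) 0 hδ
    rw [mul_zero, smul_eq_mul] at h
    rw [eq_comm, inv_mul_eq_iff_eq_mul₀ hδ.ne'] at h
    rw [h]
    obtain ⟨m, rfl⟩ : ∃ m, n = m + 1 := ⟨n - 1, by omega⟩
    simp only [Nat.add_sub_cancel]
    rw [pow_succ' δ m, mul_assoc, ← integral_const_mul (δ ^ m)]
    congr 1
    refine integral_congr_ae (Eventually.of_forall fun τ => ?_)
    have : ‖g‖ ^ 2 * (δ * τ) ^ 2 / (2 * δ ^ 2) = ‖g‖ ^ 2 / 2 * τ ^ 2 := by field_simp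
    simp only [this]
    rw [mul_pow]
    ring
  rw [hre, eq_comm, div_mul_eq_mul_div, div_eq_iff hf0]
  have hswap' := congrArg Complex.re hswap
  rw [Complex.ofReal_re, ← Complex.ofReal_natCast, Complex.re_ofReal_mul, hsub] at hswap'
  rw [mul_comm _ ((n - 1).factorial : ℝ), hswap', ← mul_assoc]
  congr 1
  rw [Real.div_rpow (by positivity) (by positivity), ← Real.rpow_two, ← Real.rpow_mul hδ.le,
    show (2 : ℝ) * (n / 2) = n by ring, Real.rpow_natCast]
  field_simp

theorem integral_pow_mul_exp_neg_half_sq (hn : 1 ≤ n) {G : ℝ} (hG : 0 < G) :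
    IntegrableOn (fun τ : ℝ => τ ^ (n - 1) * Real.exp (-(G ^ 2 / 2 * τ ^ 2))) (Ioi 0) ∧
    ∫ τ in Ioi (0 : ℝ), τ ^ (n - 1) * Real.exp (-(G ^ 2 / 2 * τ ^ 2)) =
      (G ^ n)⁻¹ * (2 ^ ((n : ℝ) / 2) * (1 / 2) * Real.Gamma ((n : ℝ) / 2)) := by
  have hc : ((n - 1 : ℕ) : ℝ) = (n : ℝ) - 1 := by rw [Nat.cast_sub hn, Nat.cast_one]
  have hn0 : (1 : ℝ) ≤ n := by exact_mod_cast hn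
  have e : ∀ τ ∈ Ioi (0 : ℝ), τ ^ ((n : ℝ) - 1) * Real.exp (-(G ^ 2 / 2) * τ ^ (2 : ℝ)) =
      τ ^ (n - 1) * Real.exp (-(G ^ 2 / 2 * τ ^ 2)) := by
    intro τ _
    rw [← hc, Real.rpow_natCast, Real.rpow_two, neg_mul]
  constructor
  · refine (integrableOn_congr_fun e measurableSet_Ioi).mp ?_
    exact integrableOn_rpow_mul_exp_neg_mul_rpow (by linarith) two_pos (by positivity)
  · rw [← setIntegral_congr_fun measurableSet_Ioi e,
      integral_rpow_mul_exp_neg_mul_rpow two_pos (by linarith) (by positivity), sub_add_cancel,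
      neg_div, Real.rpow_neg (by positivity), Real.div_rpow (by positivity) (by positivity),
      ← Real.rpow_two, ← Real.rpow_mul hG.le, show (2 : ℝ) * (n / 2) = n by ring,
      Real.rpow_natCast]
    field_simp

theorem surf_real_univ (hn : 1 ≤ n) :
    (surf n).real univ = 2 * Real.pi ^ ((n : ℝ) / 2) / Real.Gamma ((n : ℝ) / 2) := by
  have : Nonempty (Fin n) := ⟨⟨0, hn⟩⟩
  have hn0 : (0 : ℝ) < n := by exact_mod_cast hn
  rw [surf, Measure.toSphere_real_apply_univ, measureReal_def, EuclideanSpace.volume_ball]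
  simp only [ENNReal.ofReal_one, one_pow, one_mul, Fintype.card_fin, finrank_euclideanSpace]
  rw [ENNReal.toReal_ofReal (by positivity), Real.Gamma_add_one (by positivity),
    Real.sqrt_eq_rpow, ← Real.rpow_natCast, ← Real.rpow_mul Real.pi_pos.le,
    show (1 / 2 : ℝ) * n = n / 2 by ring]
  have := (Real.Gamma_pos_of_pos (show (0 : ℝ) < n / 2 by positivity)).ne'
  field_simp

/-- The total mass of the mean over `Θ` of the filters `Re (1 + i ⟨g Θ, z⟩)⁻ⁿ`. -/
theorem integral_integral_filterKernel (hn : 1 ≤ n) {g : S n → E n} (hg : Continuous g) {g₀ : ℝ}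
    (hg₀ : 0 < g₀) (hgg : ∀ Θ, g₀ ≤ ‖g Θ‖)
    (hi : Integrable fun z : E n => ∫ Θ, filterKernel n 1 (inner ℝ (g Θ) z) ∂(surf n)) :
    ∫ z : E n, ∫ Θ, filterKernel n 1 (inner ℝ (g Θ) z) ∂(surf n) =
      (2 * Real.pi) ^ n / ((n - 1).factorial : ℝ) * ⨍ Θ, (‖g Θ‖ ^ n)⁻¹ ∂(surf n) := by
  set c := (2 * Real.pi) ^ ((n : ℝ) / 2) / ((n - 1).factorial : ℝ) with hc
  set k : E n → ℝ := fun z => ∫ Θ, filterKernel n 1 (inner ℝ (g Θ) z) ∂(surf n) with hk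
  have hcont := continuous_filterKernel n one_pos
  -- The cutoff is removed in two ways: directly, by the integrability of the averaged filter, and,
  -- after exchanging the integrals over `z` and `Θ`, through the explicit `τ`-integrals. The lower
  -- bound `g₀` gives a dominating function uniform in `Θ`.
  have t1 : Tendsto (fun δ : ℝ => ∫ z : E n, Real.exp (-(δ ^ 2 / 2 * ‖z‖ ^ 2)) * k z) (𝓝[>] 0)
      (𝓝 (∫ z, k z)) := by
    refine tendsto_integral_filter_of_dominated_convergence (fun z => |k z|) ?_ ?_ hi.norm ?_
    · refine Eventually.of_forall fun δ => AEStronglyMeasurable.mul ?_ hi.aestronglyMeasurable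
      exact Continuous.aestronglyMeasurable (by fun_prop)
    · refine Eventually.of_forall fun δ => Eventually.of_forall fun z => ?_
      rw [norm_mul, Real.norm_of_nonneg (Real.exp_nonneg _), Real.norm_eq_abs]
      refine mul_le_of_le_one_left (abs_nonneg _) ?_
      rw [Real.exp_le_one_iff]
      have : 0 ≤ δ ^ 2 / 2 * ‖z‖ ^ 2 := by positivity
      linarith
    · refine Eventually.of_forall fun z => tendsto_nhdsWithin_of_tendsto_nhds ?_
      have : Continuous fun δ : ℝ => Real.exp (-(δ ^ 2 / 2 * ‖z‖ ^ 2)) * k z := by fun_prop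
      simpa using this.tendsto 0
  set J : ℝ → S n → ℝ := fun δ Θ => ∫ τ in Ioi (0 : ℝ), τ ^ (n - 1) * (Real.exp (-(δ * τ)) *
          Real.exp (-(‖g Θ‖ ^ 2 / 2 * τ ^ 2))) with hJ
  have hbound : ∀ (δ : ℝ), 0 ≤ δ → ∀ Θ, ∀ τ ∈ Ioi (0 : ℝ),
      ‖τ ^ (n - 1) * (Real.exp (-(δ * τ)) * Real.exp (-(‖g Θ‖ ^ 2 / 2 * τ ^ 2)))‖ ≤
        τ ^ (n - 1) * Real.exp (-(g₀ ^ 2 / 2 * τ ^ 2)) := by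
    intro δ hδ Θ τ hτ
    have hτ' : (0 : ℝ) < τ := hτ
    rw [Real.norm_of_nonneg (by positivity)]
    gcongr
    have h1 : Real.exp (-(δ * τ)) ≤ 1 := by
      rw [Real.exp_le_one_iff]
      have : 0 ≤ δ * τ := by positivity
      linarith
    refine (mul_le_of_le_one_left (Real.exp_nonneg _) h1).trans ?_
    gcongr
    exact hgg Θ
  obtain ⟨hb1, -⟩ := integral_pow_mul_exp_neg_half_sq hn hg₀
  have t2 : ∀ Θ, Tendsto (fun δ => J δ Θ) (𝓝[>] 0)
      (𝓝 ((‖g Θ‖ ^ n)⁻¹ * (2 ^ ((n : ℝ) / 2) * (1 / 2) * Real.Gamma ((n : ℝ) / 2)))) := by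
    intro Θ
    rw [← (integral_pow_mul_exp_neg_half_sq hn (hg₀.trans_le (hgg Θ))).2]
    refine tendsto_integral_filter_of_dominated_convergence _ ?_ ?_ hb1 ?_
    · exact Eventually.of_forall fun δ => Continuous.aestronglyMeasurable (by fun_prop)
    · filter_upwards [self_mem_nhdsWithin] with δ hδ
      filter_upwards [ae_restrict_mem measurableSet_Ioi] with τ hτ
      exact hbound δ (le_of_lt hδ) Θ τ hτ
    · refine Eventually.of_forall fun τ => tendsto_nhdsWithin_of_tendsto_nhds ?_
      have : Continuous fun δ : ℝ => τ ^ (n - 1) * (Real.exp (-(δ * τ)) *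
          Real.exp (-(‖g Θ‖ ^ 2 / 2 * τ ^ 2))) := by fun_prop
      simpa using this.tendsto 0
  have hgm : ∀ δ : ℝ, AEStronglyMeasurable (J δ) (surf n) := by
    intro δ
    have : StronglyMeasurable (Function.uncurry fun (Θ : S n) (τ : ℝ) => τ ^ (n - 1) *
        (Real.exp (-(δ * τ)) * Real.exp (-(‖g Θ‖ ^ 2 / 2 * τ ^ 2)))) := by
      apply Continuous.stronglyMeasurable
      simp only [Function.uncurry_def]
      fun_prop
    exact (this.integral_prod_right (ν := volume.restrict (Ioi 0))).aestronglyMeasurable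
  have t3 : Tendsto (fun δ => ∫ Θ, J δ Θ ∂(surf n)) (𝓝[>] 0)
      (𝓝 (∫ Θ, (‖g Θ‖ ^ n)⁻¹ * (2 ^ ((n : ℝ) / 2) * (1 / 2) * Real.Gamma ((n : ℝ) / 2))
        ∂(surf n))) := by
    refine tendsto_integral_filter_of_dominated_convergence
      (fun _ => ∫ τ in Ioi (0 : ℝ), τ ^ (n - 1) * Real.exp (-(g₀ ^ 2 / 2 * τ ^ 2)))
      (Eventually.of_forall hgm) ?_ (integrable_const _) (Eventually.of_forall t2)
    filter_upwards [self_mem_nhdsWithin] with δ hδ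
    refine Eventually.of_forall fun Θ => ?_
    refine norm_integral_le_of_norm_le hb1 ?_
    filter_upwards [ae_restrict_mem measurableSet_Ioi] with τ hτ
    exact hbound δ (le_of_lt hδ) Θ τ hτ
  have heq : ∀ᶠ δ : ℝ in 𝓝[>] 0, c * ∫ Θ, J δ Θ ∂(surf n) =
      ∫ z : E n, Real.exp (-(δ ^ 2 / 2 * ‖z‖ ^ 2)) * k z := by
    filter_upwards [self_mem_nhdsWithin] with δ hδ
    have hδ' : (0 : ℝ) < δ := hδ
    have hgi : Integrable (fun z : E n => Real.exp (-(δ ^ 2 / 2 * ‖z‖ ^ 2))) :=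
      integrable_exp_neg_mul_norm_sq (by positivity)
    have hsw : Integrable (Function.uncurry fun (z : E n) (Θ : S n) =>
        Real.exp (-(δ ^ 2 / 2 * ‖z‖ ^ 2)) * filterKernel n 1 (inner ℝ (g Θ) z))
        ((volume : Measure (E n)).prod (surf n)) := by
      refine (hgi.mul_prod (integrable_const (1 : ℝ))).mono' ?_ ?_
      · apply Continuous.aestronglyMeasurable
        simp only [Function.uncurry_def]
        fun_prop
      · refine Eventually.of_forall fun q => ?_
        simp only [Function.uncurry_def]
        rw [norm_mul, Real.norm_of_nonneg (Real.exp_nonneg _)]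
        gcongr
        simpa using abs_filterKernel_le n one_pos (inner ℝ (g q.2) q.1)
    have h1 := integral_integral_swap hsw
    simp only [integral_const_mul, integral_gaussian_filterKernel hn hδ'] at h1
    exact h1.symm
  -- The Gamma factor from the radial integral cancels against the one in the area of the sphere
  -- when the integral over `Θ` is turned into a mean.
  have h4 := tendsto_nhds_unique t1 ((t3.const_mul c).congr' heq)
  rw [h4, integral_mul_const, average_eq, surf_real_univ hn, smul_eq_mul, hc]
  have hΓ := (Real.Gamma_pos_of_pos (show (0 : ℝ) < n / 2 by positivity)).ne'
  have e1 : (2 * Real.pi) ^ n = (2 * Real.pi) ^ ((n : ℝ) / 2) *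
      (2 ^ ((n : ℝ) / 2) * Real.pi ^ ((n : ℝ) / 2)) := by
    rw [← Real.mul_rpow (by positivity) (by positivity), ← Real.rpow_add (by positivity),
      add_halves, Real.rpow_natCast]
  rw [e1]
  have hpi : Real.pi ^ ((n : ℝ) / 2) ≠ 0 := (Real.rpow_pos_of_pos Real.pi_pos _).ne'
  field_simp

end FilterMass

/-! ### The integral kernel of filtered backprojection -/

section Kernel

variable {n : ℕ} {p : ℝ}

theorem phase_sub_phase (Θ : S n) (x y : E n) :
    phase p Θ x - phase p Θ y = p * ((1 - ‖x‖ ^ 2)⁻¹ - (1 - ‖y‖ ^ 2)⁻¹) -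
      inner ℝ ((1 - ‖x‖ ^ 2)⁻¹ • x - (1 - ‖y‖ ^ 2)⁻¹ • y) (Θ : E n) := by
  rw [inner_sub_left, inner_smul_left, inner_smul_left, phase, phase]
  simp
  ring

/-- The vectors `(1, x) / (1 - ‖x‖²)` have spacelike differences. Both inequalities needed for the
kernel, `|a| ≤ p |b|` and `‖x - y‖ ≤ |b|`, are read off from this identity. -/
theorem norm_smul_sub_smul_sq {x y : E n} (hx : ‖x‖ < 1) (hy : ‖y‖ < 1) :
    ‖(1 - ‖x‖ ^ 2)⁻¹ • x - (1 - ‖y‖ ^ 2)⁻¹ • y‖ ^ 2 =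
      ((1 - ‖x‖ ^ 2)⁻¹ - (1 - ‖y‖ ^ 2)⁻¹) ^ 2 +
        (1 - ‖x‖ ^ 2)⁻¹ * (1 - ‖y‖ ^ 2)⁻¹ * ‖x - y‖ ^ 2 := by
  have hx0 := (one_sub_norm_sq_pos hx).ne'
  have hy0 := (one_sub_norm_sq_pos hy).ne'
  rw [norm_sub_sq_real, norm_sub_sq_real, norm_smul, norm_smul, inner_smul_left, inner_smul_right,
    mul_pow, mul_pow, Real.norm_eq_abs, sq_abs, Real.norm_eq_abs, sq_abs]
  simp only [conj_trivial]
  field_simp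
  ring

theorem one_le_inv_one_sub {x : E n} (hx : ‖x‖ < 1) : 1 ≤ (1 - ‖x‖ ^ 2)⁻¹ := by
  rw [one_le_inv₀ (one_sub_norm_sq_pos hx)]
  nlinarith [sq_nonneg ‖x‖]

theorem norm_sub_le_norm_smul_sub {x y : E n} (hx : ‖x‖ < 1) (hy : ‖y‖ < 1) :
    ‖x - y‖ ≤ ‖(1 - ‖x‖ ^ 2)⁻¹ • x - (1 - ‖y‖ ^ 2)⁻¹ • y‖ := by
  rw [← sq_le_sq₀ (norm_nonneg _) (norm_nonneg _), norm_smul_sub_smul_sq hx hy]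
  have h1 : 1 ≤ (1 - ‖x‖ ^ 2)⁻¹ * (1 - ‖y‖ ^ 2)⁻¹ :=
    one_le_mul_of_one_le_of_one_le (one_le_inv_one_sub hx) (one_le_inv_one_sub hy)
  nlinarith [sq_nonneg ‖x - y‖, sq_nonneg ((1 - ‖x‖ ^ 2)⁻¹ - (1 - ‖y‖ ^ 2)⁻¹)]

theorem abs_sub_le_norm_smul_sub {x y : E n} (hx : ‖x‖ < 1) (hy : ‖y‖ < 1) :
    |(1 - ‖x‖ ^ 2)⁻¹ - (1 - ‖y‖ ^ 2)⁻¹| ≤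
      ‖(1 - ‖x‖ ^ 2)⁻¹ • x - (1 - ‖y‖ ^ 2)⁻¹ • y‖ := by
  rw [← sq_le_sq₀ (abs_nonneg _) (norm_nonneg _), norm_smul_sub_smul_sq hx hy, sq_abs]
  have h1 : 0 ≤ (1 - ‖x‖ ^ 2)⁻¹ * (1 - ‖y‖ ^ 2)⁻¹ := by
    have := one_le_inv_one_sub hx
    have := one_le_inv_one_sub hy
    positivity
  have := mul_nonneg h1 (sq_nonneg ‖x - y‖)
  linarith

/-- The Poisson kernel of the upper half space (up to a constant). -/
def poisson (ε : ℝ) (z : E n) : ℝ := ε * (ε ^ 2 + ‖z‖ ^ 2) ^ (-(((n : ℝ) + 1) / 2))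

theorem poisson_nonneg {ε : ℝ} (hε : 0 ≤ ε) (z : E n) : 0 ≤ poisson ε z := by
  unfold poisson; positivity

theorem continuous_poisson {ε : ℝ} (hε : 0 < ε) : Continuous (poisson ε : E n → ℝ) := by
  unfold poisson
  refine continuous_const.mul (Continuous.rpow_const (by fun_prop) fun z => Or.inl ?_)
  positivity

theorem poisson_scale {ε : ℝ} (hε : 0 < ε) (z : E n) :
    ε ^ n * poisson ε (ε • z) = poisson 1 z := by
  unfold poisson
  rw [norm_smul, mul_pow, Real.norm_eq_abs, sq_abs,
    show ε ^ 2 + ε ^ 2 * ‖z‖ ^ 2 = ε ^ (2 : ℝ) * (1 ^ 2 + ‖z‖ ^ 2) by rw [Real.rpow_two]; ring,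
    Real.mul_rpow (by positivity) (by positivity), ← Real.rpow_mul hε.le,
    show (2 : ℝ) * (-(((n : ℝ) + 1) / 2)) = -((n : ℝ) + 1) by ring, Real.rpow_neg hε.le,
    Real.rpow_add hε, Real.rpow_one, Real.rpow_natCast]
  field_simp

theorem integrable_poisson_one : Integrable (poisson 1 : E n → ℝ) := by
  have h := integrable_rpow_neg_one_add_norm_sq (E := E n) (μ := volume) (r := (n : ℝ) + 1)
    (by simp)
  refine h.congr (Eventually.of_forall fun z => ?_)
  simp only [poisson, one_mul, one_pow, neg_div]

theorem integrable_poisson {ε : ℝ} (hε : 0 < ε) : Integrable (poisson ε : E n → ℝ) := by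
  rw [← integrable_comp_smul_iff volume _ hε.ne']
  have := (integrable_poisson_one (n := n)).const_mul ((ε ^ n)⁻¹)
  refine this.congr (Eventually.of_forall fun z => ?_)
  simp only
  rw [← poisson_scale hε]
  field_simp

theorem integral_poisson {ε : ℝ} (hε : 0 < ε) :
    ∫ z : E n, poisson ε z = ∫ z : E n, poisson 1 z := by
  have h := Measure.integral_comp_smul (volume : Measure (E n)) (poisson ε) ε
  simp only [finrank_euclideanSpace, Fintype.card_fin] at h
  rw [abs_of_pos (by positivity), smul_eq_mul, eq_inv_mul_iff_mul_eq₀ (by positivity),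
    ← integral_const_mul] at h
  rw [← h]
  exact integral_congr_ae (Eventually.of_forall fun z => poisson_scale hε z)

/-- The mean over `Θ` of the filters in the phase difference: the integral kernel of filtered
backprojection. -/
def backprojectionKernel (p ε : ℝ) (y x : E n) : ℝ :=
  ∫ Θ : S n, filterKernel n ε (phase p Θ x - phase p Θ y) ∂(surf n)

theorem exists_abs_backprojectionKernel_le (hn : 1 ≤ n) (hp0 : 0 < p) (hp1 : p < 1) :
    ∃ C : ℝ, 0 ≤ C ∧ ∀ (ε : ℝ) (x y : E n), 0 < ε → ‖x‖ < 1 → ‖y‖ < 1 →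
      |backprojectionKernel p ε y x| ≤ C * poisson ε (x - y) := by
  obtain ⟨C, hC0, hC⟩ := exists_abs_integral_filterKernel_le hn hp0.le hp1
  refine ⟨C, hC0, fun ε x y hε hx hy => ?_⟩
  simp only [backprojectionKernel, phase_sub_phase]
  refine (hC ε _ _ hε ?_).trans ?_
  · rw [abs_mul, abs_of_pos hp0]
    gcongr
    exact abs_sub_le_norm_smul_sub hx hy
  · unfold poisson
    gcongr C * (ε * ?_)
    refine Real.rpow_le_rpow_of_nonpos (by positivity) ?_ (by
      have : (0 : ℝ) ≤ n := by positivity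
      linarith)
    gcongr
    exact norm_sub_le_norm_smul_sub hx hy

theorem measurable_phase_uncurry (p : ℝ) :
    Measurable fun q : S n × E n => phase p q.1 q.2 := by
  unfold phase
  fun_prop

theorem measurable_filterKernel_phase (p : ℝ) {ε : ℝ} (hε : 0 < ε) :
    Measurable fun q : (E n × E n) × S n =>
      filterKernel n ε (phase p q.2 q.1.2 - phase p q.2 q.1.1) := by
  have h := measurable_phase_uncurry (n := n) p
  have h1 : Measurable fun q : (E n × E n) × S n => phase p q.2 q.1.2 :=
    h.comp (f := fun q : (E n × E n) × S n => (q.2, q.1.2)) (by fun_prop)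
  have h2 : Measurable fun q : (E n × E n) × S n => phase p q.2 q.1.1 :=
    h.comp (f := fun q : (E n × E n) × S n => (q.2, q.1.1)) (by fun_prop)
  exact (continuous_filterKernel n hε).measurable.comp (h1.sub h2)

theorem stronglyMeasurable_backprojectionKernel (p : ℝ) {ε : ℝ} (hε : 0 < ε) :
    StronglyMeasurable fun q : E n × E n => backprojectionKernel p ε q.1 q.2 :=
  (measurable_filterKernel_phase p hε).stronglyMeasurable.integral_prod_right'

/-- The filtered backprojection of the plane-wave data of `v`. -/
def kernelOperator (p ε : ℝ) (v : E n → ℂ) (y : E n) : ℂ :=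
  ∫ x, backprojectionKernel p ε y x • v x

theorem aestronglyMeasurable_kernelOperator (p : ℝ) {ε : ℝ} (hε : 0 < ε) {v : E n → ℂ}
    (hv : AEStronglyMeasurable v) : AEStronglyMeasurable (kernelOperator p ε v) := by
  have h : AEStronglyMeasurable (fun q : E n × E n => backprojectionKernel p ε q.1 q.2 • v q.2)
      ((volume : Measure (E n)).prod volume) :=
    (stronglyMeasurable_backprojectionKernel p hε).aestronglyMeasurable.smul hv.comp_snd
  exact h.integral_prod_right'

/-- The coarea formula replaces the `lam`-integral by one over the ball, with the gradient norm as
density. Dividing by `weight` leaves exactly `1 / (1 - ‖x‖²)`, which no longer depends on `Θ`, so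
Fubini collects the `Θ`-integral into the kernel. -/
theorem backprojection_levelIntegral (hn : 1 ≤ n) (hp0 : 0 < p) (hp1 : p < 1) {u : E n → ℂ}
    (hu : Integrable u) (hu0 : ∀ y, y ∉ ball (0 : E n) p → u y = 0) {ε : ℝ} (hε : 0 < ε) (y : E n) :
    backprojection p ε (fun lam Θ => levelIntegral p Θ u lam) y =
      (((n - 1).factorial : ℝ) * (1 - ‖y‖ ^ 2) / ((2 * Real.pi) ^ n * normalizer p y)) •
        kernelOperator p ε (fun x => (1 - ‖x‖ ^ 2)⁻¹ • u x) y := by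
  unfold backprojection kernelOperator
  congr 1
  have hw := (continuous_weight p).measurable
  have hκ : 0 < √(1 - p ^ 2) := Real.sqrt_pos.mpr (by nlinarith)
  have hvi : Integrable (fun x => (1 - ‖x‖ ^ 2)⁻¹ • u x) := by
    refine (hu.norm.const_mul ((1 - p ^ 2)⁻¹)).mono' ?_ (Eventually.of_forall fun x => ?_)
    · have : Measurable fun x : E n => (1 - ‖x‖ ^ 2)⁻¹ := by fun_prop
      exact this.aestronglyMeasurable.smul hu.aestronglyMeasurable
    · by_cases hx : x ∈ ball (0 : E n) p
      · have hx' := mem_ball_zero_iff.mp hx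
        have h1 := one_sub_norm_sq_pos (hx'.trans hp1)
        rw [norm_smul, norm_inv, Real.norm_of_nonneg h1.le]
        gcongr
        nlinarith
      · simp [hu0 x hx]
  have h1 : ∀ Θ : S n, ∫ lam, (filterKernel n ε (lam - phase p Θ y) / weight p lam) •
      levelIntegral p Θ u lam = ∫ x, filterKernel n ε (phase p Θ x - phase p Θ y) •
        (1 - ‖x‖ ^ 2)⁻¹ • u x := by
    intro Θ
    have hm : Measurable fun lam => filterKernel n ε (lam - phase p Θ y) / weight p lam :=
      ((continuous_filterKernel n hε).measurable.comp (measurable_id.sub_const _)).div hw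
    rw [integral_smul_levelIntegral hn hp0 hp1 Θ hu hu0 hm
      (C := (ε ^ n)⁻¹ / √(1 - p ^ 2)) ?_]
    · refine integral_congr_ae (Eventually.of_forall fun x => ?_)
      simp only
      by_cases hx : x ∈ ball (0 : E n) p
      · have hx' := (mem_ball_zero_iff.mp hx).trans hp1
        rw [norm_gradient_phase hp0 hp1 hx', smul_smul, smul_smul]
        congr 1
        have := (weight_pos hp0 hp1 (phase p Θ x)).ne'
        field_simp
      · simp [hu0 x hx]
    · intro lam
      rw [abs_div, abs_of_pos (weight_pos hp0 hp1 lam)]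
      gcongr
      · exact abs_filterKernel_le n hε _
      · exact sqrt_le_weight hp0 hp1 lam
  simp only [h1]
  have hsw : Integrable (Function.uncurry fun (Θ : S n) (x : E n) =>
      filterKernel n ε (phase p Θ x - phase p Θ y) • (1 - ‖x‖ ^ 2)⁻¹ • u x)
      ((surf n).prod volume) := by
    have hm : Measurable fun q : S n × E n => filterKernel n ε (phase p q.1 q.2 - phase p q.1 y) :=
      (measurable_filterKernel_phase p hε).comp
        (f := fun q : S n × E n => ((y, q.2), q.1)) (by fun_prop)
    exact (hvi.comp_snd (surf n)).bdd_smul ((ε ^ n)⁻¹) hm.aestronglyMeasurable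
      (Eventually.of_forall fun q => abs_filterKernel_le n hε _)
  rw [integral_integral_swap hsw]
  refine integral_congr_ae (Eventually.of_forall fun x => ?_)
  simp only [backprojectionKernel]
  rw [integral_smul_const]

end Kernel

/-! ### Schur's test -/

section SchurTest

variable {n : ℕ}

/-- Cauchy–Schwarz for the splitting `k w = k^(1/2) · (k^(1/2) w)`. -/
theorem sq_lintegral_mul_le {α : Type*} [MeasurableSpace α] (μ : Measure α) {k w : α → ℝ≥0∞}
    (hk : AEMeasurable k μ) (hw : AEMeasurable w μ) :
    (∫⁻ x, k x * w x ∂μ) ^ (2 : ℝ) ≤ (∫⁻ x, k x ∂μ) * ∫⁻ x, k x * w x ^ (2 : ℝ) ∂μ := by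
  have h := ENNReal.lintegral_mul_le_Lp_mul_Lq μ Real.HolderConjugate.two_two
    (f := fun x => k x ^ (1 / 2 : ℝ)) (g := fun x => k x ^ (1 / 2 : ℝ) * w x)
    (hk.pow_const _) ((hk.pow_const _).mul hw)
  have e1 : ∀ x, ((fun x => k x ^ (1 / 2 : ℝ)) * fun x => k x ^ (1 / 2 : ℝ) * w x) x
      = k x * w x := by
    intro x
    simp only [Pi.mul_apply]
    rw [← mul_assoc, ← ENNReal.rpow_add_of_nonneg _ _ (by norm_num) (by norm_num)]
    norm_num
  have e2 : ∀ x, (k x ^ (1 / 2 : ℝ)) ^ (2 : ℝ) = k x := by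
    intro x
    rw [← ENNReal.rpow_mul]; norm_num
  have e3 : ∀ x, (k x ^ (1 / 2 : ℝ) * w x) ^ (2 : ℝ) = k x * w x ^ (2 : ℝ) := by
    intro x
    rw [ENNReal.mul_rpow_of_nonneg _ _ (by norm_num), e2]
  simp only [e1, e2, e3] at h
  refine (ENNReal.rpow_le_rpow h (by norm_num : (0 : ℝ) ≤ 2)).trans ?_
  rw [ENNReal.mul_rpow_of_nonneg _ _ (by norm_num), ← ENNReal.rpow_mul, ← ENNReal.rpow_mul]
  norm_num

/-- Young's inequality for an operator whose kernel is dominated by a convolution kernel. -/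
theorem eLpNorm_two_le_of_enorm_le {T : E n → ℂ} {v : E n → ℂ} {k : E n → ℝ≥0∞} {s : Set (E n)}
    (hs : MeasurableSet s) (hk : Measurable k) (hv : AEStronglyMeasurable v)
    (hT : ∀ y ∈ s, ‖T y‖ₑ ≤ ∫⁻ x, k (x - y) * ‖v x‖ₑ) :
    eLpNorm T 2 (volume.restrict s) ≤ (∫⁻ z, k z) * eLpNorm v 2 volume := by
  set A := ∫⁻ z, k z with hA
  have hv' : AEMeasurable (fun x => ‖v x‖ₑ) volume := hv.enorm
  have hA1 : ∀ y, ∫⁻ x, k (x - y) = A := fun y => lintegral_sub_right_eq_self k y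
  have hA2 : ∀ x, ∫⁻ y, k (x - y) = A := fun x => lintegral_sub_left_eq_self k x
  have hmain : ∫⁻ y in s, ‖T y‖ₑ ^ (2 : ℝ) ≤ A ^ (2 : ℝ) * ∫⁻ x, ‖v x‖ₑ ^ (2 : ℝ) := by
    calc ∫⁻ y in s, ‖T y‖ₑ ^ (2 : ℝ)
        ≤ ∫⁻ y in s, A * ∫⁻ x, k (x - y) * ‖v x‖ₑ ^ (2 : ℝ) := by
          refine setLIntegral_mono' hs fun y hy => ?_
          refine (ENNReal.rpow_le_rpow (hT y hy) (by norm_num)).trans ?_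
          have := sq_lintegral_mul_le volume (k := fun x => k (x - y))
            (by fun_prop) hv'
          rwa [hA1] at this
      _ ≤ ∫⁻ y, A * ∫⁻ x, k (x - y) * ‖v x‖ₑ ^ (2 : ℝ) := setLIntegral_le_lintegral _ _
      _ = A * ∫⁻ y, ∫⁻ x, k (x - y) * ‖v x‖ₑ ^ (2 : ℝ) := by
          refine lintegral_const_mul'' _ ?_
          have hj : AEMeasurable (fun q : E n × E n => k (q.2 - q.1) * ‖v q.2‖ₑ ^ (2 : ℝ))
              ((volume : Measure (E n)).prod volume) := by
            have h1 : AEMeasurable (fun q : E n × E n => ‖v q.2‖ₑ)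
              ((volume : Measure (E n)).prod volume) := hv.comp_snd.enorm
            exact AEMeasurable.mul (by fun_prop) (h1.pow_const _)
          exact hj.lintegral_prod_right'
      _ = A * ∫⁻ x, ∫⁻ y, k (x - y) * ‖v x‖ₑ ^ (2 : ℝ) := by
          rw [lintegral_lintegral_swap]
          have h1 : AEMeasurable (fun q : E n × E n => ‖v q.2‖ₑ)
            ((volume : Measure (E n)).prod volume) := hv.comp_snd.enorm
          exact AEMeasurable.mul (by fun_prop) (h1.pow_const _)
      _ = A * ∫⁻ x, A * ‖v x‖ₑ ^ (2 : ℝ) := by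
          congr 1
          refine lintegral_congr fun x => ?_
          rw [lintegral_mul_const _ (by fun_prop), hA2]
      _ = A ^ (2 : ℝ) * ∫⁻ x, ‖v x‖ₑ ^ (2 : ℝ) := by
          rw [lintegral_const_mul'' _ (hv'.pow_const _), ← mul_assoc, ENNReal.rpow_two, sq]
  rw [eLpNorm_eq_lintegral_rpow_enorm_toReal two_ne_zero ENNReal.ofNat_ne_top,
    eLpNorm_eq_lintegral_rpow_enorm_toReal two_ne_zero ENNReal.ofNat_ne_top, ENNReal.toReal_ofNat]
  refine (ENNReal.rpow_le_rpow hmain (by norm_num : (0 : ℝ) ≤ 1 / 2)).trans (le_of_eq ?_)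
  rw [ENNReal.mul_rpow_of_nonneg _ _ (by norm_num), ← ENNReal.rpow_mul]
  norm_num

end SchurTest

/-! ### Pointwise convergence of the kernel operators -/

section ApproximateIdentity

variable {n : ℕ} {p : ℝ}

theorem enorm_kernelOperator_le {C : ℝ} {ε : ℝ}
    (hC : ∀ (x y : E n), ‖x‖ < 1 → ‖y‖ < 1 →
      |backprojectionKernel p ε y x| ≤ C * poisson ε (x - y))
    {v : E n → ℂ} (hv0 : ∀ x, x ∉ ball (0 : E n) 1 → v x = 0) {y : E n} (hy : ‖y‖ < 1) :
    ‖kernelOperator p ε v y‖ₑ ≤ ∫⁻ x, ENNReal.ofReal (C * poisson ε (x - y)) * ‖v x‖ₑ := by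
  refine (enorm_integral_le_lintegral_enorm _).trans (lintegral_mono fun x => ?_)
  by_cases hx : x ∈ ball (0 : E n) 1
  · rw [enorm_smul]
    gcongr
    rw [Real.enorm_eq_ofReal_abs]
    exact ENNReal.ofReal_le_ofReal (hC x y (mem_ball_zero_iff.mp hx) hy)
  · simp [hv0 x hx]

theorem lintegral_poisson {C ε : ℝ} (hC0 : 0 ≤ C) (hε : 0 < ε) :
    ∫⁻ z : E n, ENNReal.ofReal (C * poisson ε z) =
      ENNReal.ofReal (C * ∫ z : E n, poisson 1 z) := by
  rw [← integral_poisson hε, ← integral_const_mul, ofReal_integral_eq_lintegral_ofReal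
    ((integrable_poisson hε).const_mul C)
    (Eventually.of_forall fun z => mul_nonneg hC0 (poisson_nonneg hε.le z))]

theorem norm_kernelOperator_le {C : ℝ} (hC0 : 0 ≤ C) {ε : ℝ} (hε : 0 < ε)
    (hC : ∀ (x y : E n), ‖x‖ < 1 → ‖y‖ < 1 →
      |backprojectionKernel p ε y x| ≤ C * poisson ε (x - y))
    {v : E n → ℂ} (hv0 : ∀ x, x ∉ ball (0 : E n) 1 → v x = 0) {B : ℝ} (hB0 : 0 ≤ B)
    (hB : ∀ x, ‖v x‖ ≤ B) {y : E n} (hy : ‖y‖ < 1) :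
    ‖kernelOperator p ε v y‖ ≤ C * (∫ z : E n, poisson 1 z) * B := by
  have hM : 0 ≤ ∫ z : E n, poisson 1 z := integral_nonneg fun z => poisson_nonneg zero_le_one z
  have h := enorm_kernelOperator_le hC hv0 hy
  have hk : Measurable fun z : E n => ENNReal.ofReal (C * poisson ε z) :=
    ((continuous_poisson hε).measurable.const_mul C).ennreal_ofReal
  have hk' : Measurable fun x : E n => ENNReal.ofReal (C * poisson ε (x - y)) :=
    hk.comp (measurable_id.sub_const y)
  have h2 : ∫⁻ x, ENNReal.ofReal (C * poisson ε (x - y)) * ‖v x‖ₑ ≤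
      ENNReal.ofReal (C * (∫ z : E n, poisson 1 z) * B) := by
    rw [ENNReal.ofReal_mul (by positivity), ← lintegral_poisson hC0 hε,
      ← lintegral_sub_right_eq_self (fun z => ENNReal.ofReal (C * poisson ε z)) y,
      ← lintegral_mul_const _ hk']
    refine lintegral_mono fun x => ?_
    gcongr
    rw [← ofReal_norm]
    exact ENNReal.ofReal_le_ofReal (hB x)
  have h3 := h.trans h2
  rw [← ofReal_norm] at h3
  exact (ENNReal.ofReal_le_ofReal_iff (by positivity)).mp h3

theorem continuous_gradient_phase {y : E n} (hy : ‖y‖ < 1) :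
    Continuous fun Θ : S n => gradient (phase p Θ) y := by
  simp only [gradient_phase hy, phase]
  fun_prop

theorem pow_mul_backprojectionKernel {ε : ℝ} (hε : 0 < ε) (y x : E n) :
    ε ^ n * backprojectionKernel p ε y x =
      ∫ Θ : S n, filterKernel n 1 ((phase p Θ x - phase p Θ y) / ε) ∂(surf n) := by
  rw [backprojectionKernel, ← integral_const_mul]
  simp only [filterKernel_scale n hε]

/-- The filter is homogeneous of degree `-n` in `(ε, s)`, so the rescaled kernel depends on the
difference quotients of the phase, which tend to its directional derivatives. -/
theorem tendsto_pow_mul_backprojectionKernel {y : E n} (hy : ‖y‖ < 1) (z : E n) :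
    Tendsto (fun ε : ℝ => ε ^ n * backprojectionKernel p ε y (y + ε • z)) (𝓝[>] 0)
      (𝓝 (∫ Θ : S n, filterKernel n 1 (inner ℝ (gradient (phase p Θ) y) z) ∂(surf n))) := by
  have hcont := continuous_filterKernel n one_pos
  have h : Tendsto (fun ε : ℝ => ∫ Θ : S n,
      filterKernel n 1 ((phase p Θ (y + ε • z) - phase p Θ y) / ε) ∂(surf n)) (𝓝[>] 0)
      (𝓝 (∫ Θ : S n, filterKernel n 1 (inner ℝ (gradient (phase p Θ) y) z) ∂(surf n))) := by
    refine tendsto_integral_filter_of_dominated_convergence (fun _ => 1) ?_ ?_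
      (integrable_const _) ?_
    · refine Eventually.of_forall fun ε => Continuous.aestronglyMeasurable ?_
      unfold phase
      fun_prop
    · refine Eventually.of_forall fun ε => Eventually.of_forall fun Θ => ?_
      simpa using abs_filterKernel_le n one_pos _
    · refine Eventually.of_forall fun Θ => (hcont.tendsto _).comp ?_
      have hg := hasGradientAt_phase (p := p) (Θ := Θ) hy
      rw [← gradient_phase hy, hasGradientAt_iff_hasFDerivAt] at hg
      have := (hg.hasLineDerivAt z).tendsto_slope_zero_right
      refine this.congr fun ε => ?_
      rw [smul_eq_mul, div_eq_inv_mul]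
  refine h.congr' ?_
  filter_upwards [self_mem_nhdsWithin] with ε hε
  exact (pow_mul_backprojectionKernel hε y _).symm

theorem eventually_add_smul_mem_ball {y : E n} (hy : ‖y‖ < 1) (z : E n) :
    ∀ᶠ ε : ℝ in 𝓝[>] 0, ‖y + ε • z‖ < 1 := by
  have h : ContinuousAt (fun ε : ℝ => ‖y + ε • z‖) 0 := by fun_prop
  exact eventually_nhdsWithin_of_eventually_nhds (h.eventually_lt_const (by simpa using hy))

theorem abs_pow_mul_backprojectionKernel_le {C : ℝ} {ε : ℝ} (hε : 0 < ε)
    (hC : ∀ (x y : E n), ‖x‖ < 1 → ‖y‖ < 1 →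
      |backprojectionKernel p ε y x| ≤ C * poisson ε (x - y))
    {y z : E n} (hy : ‖y‖ < 1) (hz : ‖y + ε • z‖ < 1) :
    |ε ^ n * backprojectionKernel p ε y (y + ε • z)| ≤ C * poisson 1 z := by
  rw [abs_mul, abs_of_pos (by positivity), ← poisson_scale hε]
  have := hC _ y hz hy
  rw [add_sub_cancel_left] at this
  calc ε ^ n * |backprojectionKernel p ε y (y + ε • z)| ≤ ε ^ n * (C * poisson ε (ε • z)) := by
        gcongr
    _ = _ := by ring

/-- Integrability is inherited from the Poisson bound, which survives the limit `ε → 0`. -/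
theorem integral_limitKernel (hn : 1 ≤ n) (hp0 : 0 < p) (hp1 : p < 1) {y : E n} (hy : ‖y‖ < 1) :
    Integrable (fun z : E n => ∫ Θ : S n,
      filterKernel n 1 (inner ℝ (gradient (phase p Θ) y) z) ∂(surf n)) ∧
    ∫ z : E n, ∫ Θ : S n, filterKernel n 1 (inner ℝ (gradient (phase p Θ) y) z) ∂(surf n) =
      (2 * Real.pi) ^ n / ((n - 1).factorial : ℝ) * normalizer p y := by
  obtain ⟨C, hC0, hC⟩ := exists_abs_backprojectionKernel_le hn hp0 hp1
  have hgc := continuous_gradient_phase (p := p) hy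
  have hcont := continuous_filterKernel n one_pos
  have hi : Integrable (fun z : E n => ∫ Θ : S n,
      filterKernel n 1 (inner ℝ (gradient (phase p Θ) y) z) ∂(surf n)) := by
    refine ((integrable_poisson_one).const_mul C).mono' ?_ (Eventually.of_forall fun z => ?_)
    · have : StronglyMeasurable (Function.uncurry fun (z : E n) (Θ : S n) =>
          filterKernel n 1 (inner ℝ (gradient (phase p Θ) y) z)) := by
        apply Continuous.stronglyMeasurable
        have := hgc.comp (continuous_snd (X := E n))
        exact hcont.comp (this.inner continuous_fst)
      exact this.integral_prod_right.aestronglyMeasurable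
    · refine le_of_tendsto (tendsto_pow_mul_backprojectionKernel hy z).norm ?_
      filter_upwards [self_mem_nhdsWithin, eventually_add_smul_mem_ball hy z] with ε hε hz
      exact abs_pow_mul_backprojectionKernel_le hε (fun x y => hC ε x y hε) hy hz
  refine ⟨hi, ?_⟩
  exact integral_integral_filterKernel hn hgc (Real.sqrt_pos.mpr (by nlinarith : 0 < 1 - p ^ 2))
    (fun Θ => le_norm_gradient_phase hp0 hp1 hy) hi

/-- Substituting `x = y + εz` turns the operator into the integral of the rescaled kernel against `w
(y + εz)`; the Poisson kernel at height 1 dominates. -/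
theorem tendsto_kernelOperator (hn : 1 ≤ n) (hp0 : 0 < p) (hp1 : p < 1) {w : E n → ℂ}
    (hw : Measurable w) (hw0 : ∀ x, x ∉ ball (0 : E n) 1 → w x = 0) {B : ℝ}
    (hB : ∀ x, ‖w x‖ ≤ B) {y : E n} (hy : ‖y‖ < 1) (hwy : ContinuousAt w y) :
    Tendsto (fun ε => kernelOperator p ε w y) (𝓝[>] 0)
      (𝓝 (((2 * Real.pi) ^ n / ((n - 1).factorial : ℝ) * normalizer p y) • w y)) := by
  obtain ⟨C, hC0, hC⟩ := exists_abs_backprojectionKernel_le hn hp0 hp1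
  have hB0 : 0 ≤ B := (norm_nonneg _).trans (hB 0)
  obtain ⟨-, hk2⟩ := integral_limitKernel hn hp0 hp1 hy
  rw [← hk2, ← integral_smul_const]
  have hsub : ∀ᶠ ε : ℝ in 𝓝[>] 0, ∫ z : E n,
      (ε ^ n * backprojectionKernel p ε y (y + ε • z)) • w (y + ε • z) =
        kernelOperator p ε w y := by
    filter_upwards [self_mem_nhdsWithin] with ε hε
    have hε' : (0 : ℝ) < ε := hε
    have h := Measure.integral_comp_smul (volume : Measure (E n))
      (fun x => backprojectionKernel p ε y (y + x) • w (y + x)) ε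
    simp only [finrank_euclideanSpace, Fintype.card_fin] at h
    rw [integral_add_left_eq_self (fun x => backprojectionKernel p ε y x • w x),
      abs_of_pos (by positivity)] at h
    simp only [mul_smul]
    rw [integral_smul, h, smul_smul, mul_inv_cancel₀ (by positivity), one_smul]
    rfl
  refine Tendsto.congr' hsub ?_
  refine tendsto_integral_filter_of_dominated_convergence (fun z => C * poisson 1 z * B) ?_ ?_
    ((integrable_poisson_one.const_mul C).mul_const B) ?_
  · filter_upwards [self_mem_nhdsWithin] with ε hε
    have h1 := (stronglyMeasurable_backprojectionKernel (n := n) p hε).measurable.comp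
      (f := fun z : E n => (y, y + ε • z)) (by fun_prop)
    have h2 := hw.comp (f := fun z : E n => y + ε • z) (by fun_prop)
    exact ((h1.const_mul (ε ^ n)).smul h2).aestronglyMeasurable
  · filter_upwards [self_mem_nhdsWithin] with ε hε
    refine Eventually.of_forall fun z => ?_
    by_cases hz : y + ε • z ∈ ball (0 : E n) 1
    · rw [norm_smul]
      have h1 := abs_pow_mul_backprojectionKernel_le hε (fun x y => hC ε x y hε) hy
        (mem_ball_zero_iff.mp hz)
      have h2 := poisson_nonneg zero_le_one z
      gcongr
      · exact h1
      · exact hB _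
    · rw [hw0 _ hz, smul_zero, norm_zero]
      have := poisson_nonneg zero_le_one z
      positivity
  · refine Eventually.of_forall fun z => (tendsto_pow_mul_backprojectionKernel hy z).smul ?_
    refine Tendsto.comp (y := 𝓝 y) hwy ?_
    have h : ContinuousAt (fun ε : ℝ => y + ε • z) 0 := by fun_prop
    have h' := h.tendsto
    simp only [zero_smul, add_zero] at h'
    exact tendsto_nhdsWithin_of_tendsto_nhds h'

end ApproximateIdentity

/-! ### Convergence in mean square -/

section Inversion

variable {n : ℕ} {p : ℝ}

theorem surf_real_univ_pos (hn : 1 ≤ n) : 0 < (surf n).real univ := by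
  rw [surf_real_univ hn]
  have hn0 : (0 : ℝ) < n := by exact_mod_cast hn
  have := Real.Gamma_pos_of_pos (show (0 : ℝ) < n / 2 by positivity)
  positivity

theorem normalizer_le (hn : 1 ≤ n) (hp0 : 0 < p) (hp1 : p < 1) {y : E n} (hy : ‖y‖ < 1) :
    0 ≤ normalizer p y ∧ normalizer p y ≤ (√(1 - p ^ 2) ^ n)⁻¹ := by
  have hs := surf_real_univ_pos hn
  have hκ : 0 < √(1 - p ^ 2) := Real.sqrt_pos.mpr (by nlinarith)
  rw [normalizer, average_eq, smul_eq_mul]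
  constructor
  · exact mul_nonneg (by positivity) (integral_nonneg fun Θ => by positivity)
  · rw [inv_mul_le_iff₀ hs]
    have h := norm_integral_le_of_norm_le_const (μ := surf n) (C := (√(1 - p ^ 2) ^ n)⁻¹)
      (f := fun Θ => (‖gradient (phase p Θ) y‖ ^ n)⁻¹) (Eventually.of_forall fun Θ => by
        rw [Real.norm_of_nonneg (by positivity)]
        have := le_norm_gradient_phase (Θ := Θ) hp0 hp1 hy
        gcongr)
    rw [mul_comm]
    exact (le_abs_self _).trans h

theorem exists_le_normalizer (hn : 1 ≤ n) (hp0 : 0 < p) (hp1 : p < 1) {k : ℝ} (hk : k < 1) :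
    ∃ c : ℝ, 0 < c ∧ ∀ y : E n, ‖y‖ ≤ k → c ≤ normalizer p y := by
  obtain ⟨C, hC0, hC⟩ := exists_norm_gradient_phase_le (n := n) hp0 hp1 hk
  have hs := surf_real_univ_pos hn
  refine ⟨((C + 1) ^ n)⁻¹, by positivity, fun y hy => ?_⟩
  have hy1 := hy.trans_lt hk
  rw [normalizer, average_eq, smul_eq_mul, le_inv_mul_iff₀ hs]
  have hgc := continuous_gradient_phase (p := p) hy1
  have h : ∫ _ : S n, ((C + 1) ^ n)⁻¹ ∂(surf n) ≤
      ∫ Θ : S n, (‖gradient (phase p Θ) y‖ ^ n)⁻¹ ∂(surf n) := by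
    refine integral_mono (integrable_const _) ?_ fun Θ => ?_
    · refine (integrable_const ((√(1 - p ^ 2) ^ n)⁻¹)).mono' ?_ (Eventually.of_forall fun Θ => ?_)
      · refine Continuous.aestronglyMeasurable (Continuous.inv₀ (by fun_prop) fun Θ => ?_)
        exact pow_ne_zero _ (norm_gradient_phase_pos hp0 hp1 hy1).ne'
      · rw [Real.norm_of_nonneg (by positivity)]
        have := le_norm_gradient_phase (Θ := Θ) hp0 hp1 hy1
        have hκ : 0 < √(1 - p ^ 2) := Real.sqrt_pos.mpr (by nlinarith)
        gcongr
    · have h1 := norm_gradient_phase_pos (Θ := Θ) hp0 hp1 hy1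
      have h2 := hC Θ y hy
      simp only
      gcongr
      linarith
  rwa [integral_const, smul_eq_mul] at h

theorem aestronglyMeasurable_normalizer (hp0 : 0 < p) (hp1 : p < 1) :
    AEStronglyMeasurable (normalizer p : E n → ℝ) (volume.restrict (ball 0 1)) := by
  have hm : StronglyMeasurable (Function.uncurry fun (y : E n) (Θ : S n) =>
      ((weight p (phase p Θ y) / (1 - ‖y‖ ^ 2)) ^ n)⁻¹) := by
    have h1 : Measurable fun q : E n × S n => phase p q.2 q.1 :=
      (measurable_phase_uncurry p).comp (f := fun q : E n × S n => (q.2, q.1)) (by fun_prop)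
    have h2 := (continuous_weight p).measurable.comp h1
    refine Measurable.stronglyMeasurable (Measurable.inv (Measurable.pow_const ?_ n))
    exact h2.div (by fun_prop)
  have h := (hm.integral_prod_right (ν := surf n)).const_mul (((surf n).real univ)⁻¹)
  refine h.aestronglyMeasurable.congr ?_
  filter_upwards [ae_restrict_mem measurableSet_ball] with y hy
  rw [normalizer, average_eq, smul_eq_mul]
  congr 1
  refine integral_congr_ae (Eventually.of_forall fun Θ => ?_)
  simp only
  rw [norm_gradient_phase hp0 hp1 (mem_ball_zero_iff.mp hy)]

/-- Needed only for uniqueness of the limit, where the triangle inequality for `eLpNorm` asks for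
measurability. -/
theorem aestronglyMeasurable_backprojection (hn : 1 ≤ n) (hp0 : 0 < p) (hp1 : p < 1)
    {u : E n → ℂ} (hu : Integrable u) (hu0 : ∀ y, y ∉ ball (0 : E n) p → u y = 0) {ε : ℝ}
    (hε : 0 < ε) : AEStronglyMeasurable
      (backprojection p ε (fun lam (Θ : S n) => levelIntegral p Θ u lam))
      (volume.restrict (ball 0 1)) := by
  have h : backprojection p ε (fun lam (Θ : S n) => levelIntegral p Θ u lam) = fun y =>
      (((n - 1).factorial : ℝ) * (1 - ‖y‖ ^ 2) / ((2 * Real.pi) ^ n * normalizer p y)) •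
        kernelOperator p ε (fun x => (1 - ‖x‖ ^ 2)⁻¹ • u x) y := by
    ext1 y
    exact backprojection_levelIntegral hn hp0 hp1 hu hu0 hε y
  rw [h]
  have hm : Measurable fun x : E n => (1 - ‖x‖ ^ 2)⁻¹ := by fun_prop
  have hm2 : Measurable fun x : E n => ((n - 1).factorial : ℝ) * (1 - ‖x‖ ^ 2) := by fun_prop
  have h3 := (aestronglyMeasurable_normalizer (n := n) hp0 hp1).aemeasurable.const_mul
    ((2 * Real.pi) ^ n)
  have h4 := (aestronglyMeasurable_kernelOperator p hε
    (hm.aestronglyMeasurable.smul hu.aestronglyMeasurable)).restrict (s := ball 0 1)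
  exact (hm2.aemeasurable.div h3).aestronglyMeasurable.smul h4

/-- On bounded functions that are continuous in the unit ball, the kernel operators converge in
mean square on compact subsets of the ball. -/
theorem tendsto_eLpNorm_kernelOperator_sub (hn : 1 ≤ n) (hp0 : 0 < p) (hp1 : p < 1) {w : E n → ℂ}
    (hw : Measurable w) (hw0 : ∀ x, x ∉ ball (0 : E n) 1 → w x = 0) {B : ℝ}
    (hB : ∀ x, ‖w x‖ ≤ B) (hwc : ∀ y ∈ ball (0 : E n) 1, ContinuousAt w y) :
    Tendsto (fun ε => eLpNorm (fun y => kernelOperator p ε w y -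
      ((2 * Real.pi) ^ n / ((n - 1).factorial : ℝ) * normalizer p y) • w y) 2
      (volume.restrict (ball 0 1))) (𝓝[>] 0) (𝓝 0) := by
  obtain ⟨C, hC0, hC⟩ := exists_abs_backprojectionKernel_le hn hp0 hp1
  have hB0 : 0 ≤ B := (norm_nonneg _).trans (hB 0)
  set m : E n → ℝ := fun y => (2 * Real.pi) ^ n / ((n - 1).factorial : ℝ) * normalizer p y with hm
  set Q := C * (∫ z : E n, poisson 1 z) * B +
    ((2 * Real.pi) ^ n / ((n - 1).factorial : ℝ) * (√(1 - p ^ 2) ^ n)⁻¹) * B with hQ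
  have hmm : AEStronglyMeasurable m (volume.restrict (ball 0 1)) :=
    (aestronglyMeasurable_normalizer hp0 hp1).const_mul _
  have hl : Tendsto (fun ε => ∫⁻ y in ball (0 : E n) 1,
      ‖kernelOperator p ε w y - m y • w y‖ₑ ^ (2 : ℝ)) (𝓝[>] 0) (𝓝 0) := by
    have h0 : ∫⁻ _ in ball (0 : E n) 1, (0 : ℝ≥0∞) = 0 := lintegral_zero
    rw [← h0]
    refine tendsto_lintegral_filter_of_dominated_convergence' (fun _ => ENNReal.ofReal Q ^ (2 : ℝ))
      ?_ ?_ ?_ ?_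
    · filter_upwards [self_mem_nhdsWithin] with ε hε
      have h1 := (aestronglyMeasurable_kernelOperator p hε hw.aestronglyMeasurable).restrict
        (s := ball 0 1)
      exact ((h1.sub (hmm.smul hw.aestronglyMeasurable)).enorm).pow_const _
    · filter_upwards [self_mem_nhdsWithin] with ε hε
      filter_upwards [ae_restrict_mem measurableSet_ball] with y hy
      have hy' := mem_ball_zero_iff.mp hy
      gcongr
      rw [← ofReal_norm]
      apply ENNReal.ofReal_le_ofReal
      refine (norm_sub_le _ _).trans (add_le_add ?_ ?_)
      · exact norm_kernelOperator_le hC0 hε (fun x y => hC ε x y hε) hw0 hB0 hB hy'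
      · obtain ⟨h1, h2⟩ := normalizer_le hn hp0 hp1 hy'
        rw [norm_smul, hm, Real.norm_of_nonneg (by positivity)]
        exact mul_le_mul (mul_le_mul_of_nonneg_left h2 (by positivity)) (hB y) (norm_nonneg _)
          (by positivity)
    · rw [lintegral_const, Measure.restrict_apply_univ]
      exact ENNReal.mul_ne_top (by simp) measure_ball_lt_top.ne
    · filter_upwards [ae_restrict_mem measurableSet_ball] with y hy
      have h1 : Tendsto (fun ε => kernelOperator p ε w y) (𝓝[>] 0) (𝓝 (m y • w y)) :=
        tendsto_kernelOperator hn hp0 hp1 hw hw0 hB (mem_ball_zero_iff.mp hy) (hwc y hy)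
      have h2 := (h1.sub_const (m y • w y)).enorm
      rw [sub_self, enorm_zero] at h2
      have h3 := ((ENNReal.continuous_rpow_const (y := 2)).tendsto 0).comp h2
      rw [ENNReal.zero_rpow_of_pos two_pos] at h3
      exact h3
  have h4 := ((ENNReal.continuous_rpow_const (y := 1 / 2)).tendsto 0).comp hl
  simp only [Function.comp_def] at h4
  rw [ENNReal.zero_rpow_of_pos (by norm_num)] at h4
  refine h4.congr fun ε => ?_
  rw [eLpNorm_eq_lintegral_rpow_enorm_toReal two_ne_zero ENNReal.ofNat_ne_top,
    ENNReal.toReal_ofNat]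

theorem exists_eLpNorm_kernelOperator_le (hn : 1 ≤ n) (hp0 : 0 < p) (hp1 : p < 1) :
    ∃ A : ℝ≥0∞, A ≠ ⊤ ∧ ∀ ε : ℝ, 0 < ε → ∀ v : E n → ℂ, AEStronglyMeasurable v →
      (∀ x, x ∉ ball (0 : E n) 1 → v x = 0) →
      eLpNorm (kernelOperator p ε v) 2 (volume.restrict (ball 0 1)) ≤ A * eLpNorm v 2 volume := by
  obtain ⟨C, hC0, hC⟩ := exists_abs_backprojectionKernel_le hn hp0 hp1
  refine ⟨ENNReal.ofReal (C * ∫ z : E n, poisson 1 z), ENNReal.ofReal_ne_top,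
    fun ε hε v hv hv0 => ?_⟩
  rw [← lintegral_poisson hC0 hε]
  exact eLpNorm_two_le_of_enorm_le measurableSet_ball
    ((continuous_poisson hε).measurable.const_mul C).ennreal_ofReal hv fun y hy =>
      enorm_kernelOperator_le (fun x y => hC ε x y hε) hv0 (mem_ball_zero_iff.mp hy)

theorem kernelOperator_sub {ε : ℝ} (hε : 0 < ε) {v w : E n → ℂ} (hv : Integrable v)
    (hw : Integrable w) (y : E n) :
    kernelOperator p ε (fun x => v x - w x) y = kernelOperator p ε v y - kernelOperator p ε w y := by
  have hm : AEStronglyMeasurable (fun x : E n => backprojectionKernel p ε y x) :=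
    ((stronglyMeasurable_backprojectionKernel p hε).comp_measurable
      (measurable_prodMk_left (x := y))).aestronglyMeasurable
  have hb : ∀ x : E n, ‖backprojectionKernel p ε y x‖ ≤ (ε ^ n)⁻¹ * (surf n).real univ := fun x =>
    norm_integral_le_of_norm_le_const (Eventually.of_forall fun Θ => abs_filterKernel_le n hε _)
  have h1 : ∀ {f : E n → ℂ}, Integrable f →
      Integrable fun x => backprojectionKernel p ε y x • f x := fun hf =>
    hf.bdd_smul _ hm (Eventually.of_forall hb)
  unfold kernelOperator
  rw [← integral_sub (h1 hv) (h1 hw)]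
  simp only [smul_sub]

/-- The kernel operators converge strongly in mean square. -/
theorem tendsto_eLpNorm_kernelOperator_sub_of_memLp (hn : 1 ≤ n) (hp0 : 0 < p) (hp1 : p < 1)
    {v : E n → ℂ} (hv : MemLp v 2) (hv0 : ∀ x, x ∉ ball (0 : E n) 1 → v x = 0) :
    Tendsto (fun ε => eLpNorm (fun y => kernelOperator p ε v y -
      ((2 * Real.pi) ^ n / ((n - 1).factorial : ℝ) * normalizer p y) • v y) 2
      (volume.restrict (ball 0 1))) (𝓝[>] 0) (𝓝 0) := by
  obtain ⟨A, hA, hAb⟩ := exists_eLpNorm_kernelOperator_le (n := n) hn hp0 hp1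
  set m : E n → ℝ := fun y => (2 * Real.pi) ^ n / ((n - 1).factorial : ℝ) * normalizer p y with hm
  set M : ℝ := (2 * Real.pi) ^ n / ((n - 1).factorial : ℝ) * (√(1 - p ^ 2) ^ n)⁻¹ with hM
  have hM0 : 0 ≤ M := by positivity
  have hmm : AEStronglyMeasurable m (volume.restrict (ball 0 1)) :=
    (aestronglyMeasurable_normalizer hp0 hp1).const_mul _
  have hint : ∀ {f : E n → ℂ}, MemLp f 2 → (∀ x, x ∉ ball (0 : E n) 1 → f x = 0) →
      Integrable f := by
    intro f hf hf0
    rw [← integrableOn_iff_integrable_of_support_subset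
      (fun x hx => by_contra fun h => hx (hf0 x h) : Function.support f ⊆ ball (0 : E n) 1)]
    have : IsFiniteMeasure ((volume : Measure (E n)).restrict (ball 0 1)) :=
      ⟨by simpa using measure_ball_lt_top⟩
    exact (hf.restrict (ball 0 1)).integrable one_le_two
  rw [ENNReal.tendsto_nhds_zero]
  intro δ hδ
  set N : ℝ≥0∞ := A + ENNReal.ofReal M + 1 with hN
  have hNt : N ≠ ⊤ := by simp [hN, hA]
  have hη : δ / 2 / N ≠ 0 := by
    simp [ENNReal.div_eq_zero_iff, hδ.ne', hNt]
  obtain ⟨g, hgs, hgv, hgc, hg2⟩ := hv.exists_hasCompactSupport_eLpNorm_sub_le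
    ENNReal.ofNat_ne_top hη
  obtain ⟨B, hB⟩ := hgc.bounded_above_of_compact_support hgs
  -- Truncation to the ball is needed because the Poisson bound holds only for points inside it.
  -- Continuity is lost only on the boundary sphere, and the distance to `v` does not grow since `v`
  -- vanishes outside.
  set w : E n → ℂ := (ball (0 : E n) 1).indicator g with hw
  have hwm : Measurable w := hgc.measurable.indicator measurableSet_ball
  have hw0 : ∀ x, x ∉ ball (0 : E n) 1 → w x = 0 := fun x hx => indicator_of_notMem hx _
  have hwB : ∀ x, ‖w x‖ ≤ B := fun x => (norm_indicator_le_norm_self _ _).trans (hB x)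
  have hwc : ∀ y ∈ ball (0 : E n) 1, ContinuousAt w y := fun y hy => by
    refine hgc.continuousAt.congr ?_
    filter_upwards [isOpen_ball.mem_nhds hy] with x hx
    rw [hw, indicator_of_mem hx]
  have hw2 : MemLp w 2 := hg2.indicator measurableSet_ball
  have hvw : eLpNorm (fun x => v x - w x) 2 ≤ δ / 2 / N := by
    refine (eLpNorm_mono fun x => ?_).trans hgv
    by_cases hx : x ∈ ball (0 : E n) 1
    · simp [hw, indicator_of_mem hx]
    · simp [hw0 x hx, hv0 x hx]
  have ht := tendsto_eLpNorm_kernelOperator_sub hn hp0 hp1 hwm hw0 hwB hwc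
  rw [ENNReal.tendsto_nhds_zero] at ht
  filter_upwards [self_mem_nhdsWithin, ht (δ / 2) (by simp [hδ.ne'])] with ε hε hε2
  have hT1 := hAb ε hε (fun x => v x - w x) (hv.aestronglyMeasurable.sub hwm.aestronglyMeasurable)
    (fun x hx => by rw [hv0 x hx, hw0 x hx, sub_zero])
  have hdec : (fun y => kernelOperator p ε v y - m y • v y) =
      (kernelOperator p ε (fun x => v x - w x) - fun y => m y • (v y - w y)) +
        fun y => kernelOperator p ε w y - m y • w y := by
    ext1 y
    simp only [Pi.add_apply, Pi.sub_apply,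
      kernelOperator_sub hε (hint hv hv0) (hint hw2 hw0), smul_sub]
    ring
  have hm1 : AEStronglyMeasurable (kernelOperator p ε (fun x => v x - w x))
      (volume.restrict (ball 0 1)) := (aestronglyMeasurable_kernelOperator p hε
    (hv.aestronglyMeasurable.sub hwm.aestronglyMeasurable)).restrict
  have hm2 : AEStronglyMeasurable (fun y => m y • (v y - w y)) (volume.restrict (ball 0 1)) :=
    hmm.smul (hv.aestronglyMeasurable.sub hwm.aestronglyMeasurable).restrict
  have hm3 : AEStronglyMeasurable (fun y => kernelOperator p ε w y - m y • w y)
      (volume.restrict (ball 0 1)) :=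
    (aestronglyMeasurable_kernelOperator p hε hwm.aestronglyMeasurable).restrict.sub
      (hmm.smul hwm.aestronglyMeasurable)
  have hT2 : eLpNorm (fun y => m y • (v y - w y)) 2 (volume.restrict (ball 0 1)) ≤
      ENNReal.ofReal M * eLpNorm (fun x => v x - w x) 2 := by
    refine (eLpNorm_le_mul_eLpNorm_of_ae_le_mul (c := M) (g := fun x => v x - w x) ?_ 2).trans ?_
    · filter_upwards [ae_restrict_mem measurableSet_ball] with y hy
      obtain ⟨h1, h2⟩ := normalizer_le hn hp0 hp1 (mem_ball_zero_iff.mp hy)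
      rw [norm_smul, hm, Real.norm_of_nonneg (by positivity)]
      exact mul_le_mul_of_nonneg_right (mul_le_mul_of_nonneg_left h2 (by positivity))
        (norm_nonneg _)
    · gcongr
      exact Measure.restrict_le_self
  rw [hdec]
  refine (eLpNorm_add_le (hm1.sub hm2) hm3 one_le_two).trans ?_
  calc eLpNorm (kernelOperator p ε (fun x => v x - w x) - fun y => m y • (v y - w y)) 2
        (volume.restrict (ball 0 1)) + eLpNorm (fun y => kernelOperator p ε w y - m y • w y) 2
        (volume.restrict (ball 0 1))
      ≤ (A * (δ / 2 / N) + ENNReal.ofReal M * (δ / 2 / N)) + δ / 2 := by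
        refine add_le_add ((eLpNorm_sub_le hm1 hm2 one_le_two).trans (add_le_add ?_ ?_)) hε2
        · exact hT1.trans (by gcongr)
        · exact hT2.trans (by gcongr)
    _ ≤ N * (δ / 2 / N) + δ / 2 := by
        rw [← add_mul]
        gcongr
        exact le_self_add
    _ ≤ δ / 2 + δ / 2 := by
        gcongr
        exact ENNReal.mul_div_le
    _ = δ := ENNReal.add_halves δ

end Inversion

/-! ### Inversion, uniqueness of the limit, and dilations -/

section Main

variable {n : ℕ} {p : ℝ}

theorem integrable_of_memLp_of_eq_zero {u : E n → ℂ} (hu : MemLp u 2)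
    (hu0 : ∀ y, y ∉ ball (0 : E n) p → u y = 0) : Integrable u := by
  rw [← integrableOn_iff_integrable_of_support_subset
    (fun x hx => by_contra fun h => hx (hu0 x h) : Function.support u ⊆ ball (0 : E n) p)]
  have : IsFiniteMeasure ((volume : Measure (E n)).restrict (ball 0 p)) :=
    ⟨by simpa using measure_ball_lt_top⟩
  exact (hu.restrict (ball 0 p)).integrable one_le_two

/-- Filtered backprojection inverts the equidistant sphere transform. -/
theorem hasEquidistantInverse_levelIntegral (hn : 1 ≤ n) (hp0 : 0 < p) (hp1 : p < 1) {u : E n → ℂ}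
    (hu : MemLp u 2) (hu0 : ∀ y, y ∉ ball (0 : E n) p → u y = 0) :
    HasEquidistantInverse p (fun lam (Θ : S n) => levelIntegral p Θ u lam) u := by
  refine ⟨hu.aestronglyMeasurable.restrict, fun K hK hKb => ?_⟩
  have hui := integrable_of_memLp_of_eq_zero hu hu0
  -- Compactness matters here: the gradient, and with it the reciprocal of `normalizer`, is bounded
  -- only on balls of radius less than 1.
  obtain ⟨k, hk1, hKk⟩ : ∃ k < (1 : ℝ), ∀ y ∈ K, ‖y‖ ≤ k := by
    rcases K.eq_empty_or_nonempty with rfl | hne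
    · exact ⟨0, one_pos, fun y hy => absurd hy (notMem_empty y)⟩
    · obtain ⟨y₀, hy₀, hmax⟩ := hK.exists_isMaxOn hne continuous_norm.continuousOn
      exact ⟨‖y₀‖, mem_ball_zero_iff.mp (hKb hy₀), fun y hy => hmax hy⟩
  obtain ⟨c, hc0, hc⟩ := exists_le_normalizer (n := n) hn hp0 hp1 hk1
  set v : E n → ℂ := fun x => (1 - ‖x‖ ^ 2)⁻¹ • u x with hv
  have hv0 : ∀ x, x ∉ ball (0 : E n) 1 → v x = 0 := fun x hx => by
    rw [hv]
    simp only
    rw [hu0 x fun h => hx (ball_subset_ball hp1.le h), smul_zero]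
  have hv2 : MemLp v 2 := by
    have hm : Measurable fun x : E n => (1 - ‖x‖ ^ 2)⁻¹ := by fun_prop
    refine hu.of_le_mul (c := (1 - p ^ 2)⁻¹) (hm.aestronglyMeasurable.smul hu.aestronglyMeasurable)
      (Eventually.of_forall fun x => ?_)
    by_cases hx : x ∈ ball (0 : E n) p
    · have hx' := mem_ball_zero_iff.mp hx
      have h1 := one_sub_norm_sq_pos (hx'.trans hp1)
      rw [hv, norm_smul, norm_inv, Real.norm_of_nonneg h1.le]
      gcongr
      nlinarith
    · simp [hv, hu0 x hx]
  have ht := tendsto_eLpNorm_kernelOperator_sub_of_memLp hn hp0 hp1 hv2 hv0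
  set m : E n → ℝ := fun y => (2 * Real.pi) ^ n / ((n - 1).factorial : ℝ) * normalizer p y with hm
  set Q : ℝ := ((n - 1).factorial : ℝ) / ((2 * Real.pi) ^ n * c) with hQ
  have hbound : ∀ᶠ ε : ℝ in 𝓝[>] 0, eLpNorm (fun y =>
      backprojection p ε (fun lam (Θ : S n) => levelIntegral p Θ u lam) y - u y) 2
      (volume.restrict K) ≤ ENNReal.ofReal Q * eLpNorm (fun y => kernelOperator p ε v y - m y • v y)
        2 (volume.restrict (ball 0 1)) := by
    filter_upwards [self_mem_nhdsWithin] with ε hε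
    refine (eLpNorm_le_mul_eLpNorm_of_ae_le_mul (c := Q)
      (g := fun y => kernelOperator p ε v y - m y • v y) ?_ 2).trans ?_
    · filter_upwards [ae_restrict_mem hK.measurableSet] with y hy
      have hyk := hKk y hy
      have h1 := one_sub_norm_sq_pos (hyk.trans_lt hk1)
      have h2 := hc y hyk
      have h3 : 0 < normalizer p y := hc0.trans_le h2
      rw [backprojection_levelIntegral hn hp0 hp1 hui hu0 hε]
      -- The prefactor of `backprojection` undoes both the mass `m` and the division by `1 - ‖y‖²`,
      -- so the error is this bounded prefactor times the error of the kernel operator.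
      have e : u y = (((n - 1).factorial : ℝ) * (1 - ‖y‖ ^ 2) /
          ((2 * Real.pi) ^ n * normalizer p y)) • m y • v y := by
        simp only [hm, hv, smul_smul]
        have hf : ((n - 1).factorial : ℝ) ≠ 0 := by exact_mod_cast Nat.factorial_ne_zero _
        have h1' := h1.ne'
        rw [show ((n - 1).factorial : ℝ) * (1 - ‖y‖ ^ 2) / ((2 * Real.pi) ^ n * normalizer p y) *
          ((2 * Real.pi) ^ n / ((n - 1).factorial : ℝ) * normalizer p y * (1 - ‖y‖ ^ 2)⁻¹) = 1 by
            field_simp, one_smul]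
      conv_lhs => rw [e]
      rw [← smul_sub, norm_smul, Real.norm_of_nonneg (by positivity), hQ]
      refine mul_le_mul_of_nonneg_right ?_ (norm_nonneg _)
      have h4 : ((n - 1).factorial : ℝ) * (1 - ‖y‖ ^ 2) ≤ ((n - 1).factorial : ℝ) :=
        mul_le_of_le_one_right (by positivity) (by nlinarith [sq_nonneg ‖y‖])
      gcongr
    · gcongr
  have hlim := ENNReal.Tendsto.const_mul ht (Or.inr (ENNReal.ofReal_ne_top (r := Q)))
  rw [mul_zero] at hlim
  exact tendsto_of_tendsto_of_tendsto_of_le_of_le' tendsto_const_nhds hlim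
    (Eventually.of_forall fun _ => zero_le) hbound

/-- Uniqueness of limits in `L²(K)`. -/
theorem HasEquidistantInverse.ae_eq {g : ℝ → S n → ℂ} {h₁ h₂ : E n → ℂ}
    (hg : ∀ ε : ℝ, 0 < ε → AEStronglyMeasurable (backprojection p ε g)
      (volume.restrict (ball (0 : E n) 1)))
    (H₁ : HasEquidistantInverse p g h₁) (H₂ : HasEquidistantInverse p g h₂) {K : Set (E n)}
    (hK : IsCompact K) (hKb : K ⊆ ball 0 1) : h₁ =ᵐ[volume.restrict K] h₂ := by
  have m₁ := H₁.1.mono_set hKb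
  have m₂ := H₂.1.mono_set hKb
  have hlim := (H₂.2 K hK hKb).add (H₁.2 K hK hKb)
  rw [add_zero] at hlim
  have hle : ∀ᶠ ε : ℝ in 𝓝[>] 0, eLpNorm (h₁ - h₂) 2 (volume.restrict K) ≤
      eLpNorm (fun y => backprojection p ε g y - h₂ y) 2 (volume.restrict K) +
        eLpNorm (fun y => backprojection p ε g y - h₁ y) 2 (volume.restrict K) := by
    filter_upwards [self_mem_nhdsWithin] with ε hε
    have mb := (hg ε hε).mono_set hKb
    have e : h₁ - h₂ = (fun y => backprojection p ε g y - h₂ y) -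
        fun y => backprojection p ε g y - h₁ y := by
      ext1 y
      simp
    rw [e]
    exact eLpNorm_sub_le (mb.sub m₂) (mb.sub m₁) one_le_two
  have h0 : eLpNorm (h₁ - h₂) 2 (volume.restrict K) = 0 :=
    le_antisymm (ge_of_tendsto hlim hle) zero_le
  rw [eLpNorm_eq_zero_iff (m₁.sub m₂) two_ne_zero] at h0
  filter_upwards [h0] with y hy
  exact sub_eq_zero.mp hy

theorem quasiMeasurePreserving_const_smul {c : ℝ} (hc : c ≠ 0) :
    Measure.QuasiMeasurePreserving (fun x : E n => c • x) volume volume := by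
  refine ⟨by fun_prop, ?_⟩
  rw [Measure.map_addHaar_smul volume hc]
  exact Measure.smul_absolutelyContinuous

theorem memLp_comp_const_smul {f : E n → ℂ} (hf : MemLp f 2) {c : ℝ} (hc : c ≠ 0) :
    MemLp (fun x => f (c • x)) 2 := by
  have hm : AEMeasurable (fun x : E n => c • x) volume := by fun_prop
  have h := (memLp_map_measure_iff (f := fun x : E n => c • x) (g := f) (p := 2) (μ := volume)
    ?_ hm).mp ?_
  · exact h
  · rw [Measure.map_addHaar_smul volume hc]
    exact hf.aestronglyMeasurable.smul_measure _
  · rw [Measure.map_addHaar_smul volume hc]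
    exact hf.smul_measure ENNReal.ofReal_ne_top

end Main

end SphRadon
end

theorem theorem4p11 (n : ℕ) (hn : 1 ≤ n) (α : ℝ) (hα : 0 < α) (p : ℝ)
    (hp : p = 1 / √(1 + α ^ 2)) (f : SphRadon.E n → ℂ)
    (hf : ∀ x, x ∉ ball (0 : SphRadon.E n) 1 → f x = 0) :
    -- integrable `f`: the identity for every direction and almost every `lam`
    (Integrable f volume → ∀ Θ : SphRadon.S n, ∀ᵐ lam : ℝ ∂volume,
      (0 < lam → SphRadon.SphereIntegrable (SphRadon.center α lam Θ)
        (SphRadon.radius α (SphRadon.center α lam Θ)) f) ∧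
      ∃ v : ℂ, SphRadon.HasEquidistantTransform p (fun y => f (p⁻¹ • y)) lam Θ v ∧
        SphRadon.radonPolar α f lam Θ = (1 / p ^ (n - 1)) • v) ∧
    -- continuous `f`: the identity everywhere
    (Continuous f → ∀ (Θ : SphRadon.S n) (lam : ℝ),
      ∃ v : ℂ, SphRadon.HasEquidistantTransform p (fun y => f (p⁻¹ • y)) lam Θ v ∧
        SphRadon.radonPolar α f lam Θ = (1 / p ^ (n - 1)) • v) ∧
    -- square integrable `f`: inversion
    (MemLp f 2 volume →
      (∃ h : SphRadon.E n → ℂ, SphRadon.HasEquidistantInverse p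
        (fun lam Θ => (p ^ (n - 1)) • SphRadon.radonPolar α f lam Θ) h) ∧
      ∀ h : SphRadon.E n → ℂ, SphRadon.HasEquidistantInverse p
        (fun lam Θ => (p ^ (n - 1)) • SphRadon.radonPolar α f lam Θ) h →
        ∀ᵐ x ∂volume.restrict (ball (0 : SphRadon.E n) 1), f x = h (p • x)) := by
  have hs : 1 < √(1 + α ^ 2) := by
    rw [Real.lt_sqrt zero_le_one]
    nlinarith [pow_pos hα 2]
  have hp0 : 0 < p := by rw [hp]; positivity
  have hp1 : p < 1 := by
    rw [hp, div_lt_one (by positivity)]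
    exact hs
  have hu0 := SphRadon.comp_inv_smul_eq_zero hp0 hf
  refine ⟨fun hfi Θ => ?_, fun hfc Θ lam => ?_, fun hf2 => ?_⟩
  · have hu : Integrable (fun y => f (p⁻¹ • y)) := hfi.comp_smul (inv_ne_zero hp0.ne')
    filter_upwards [SphRadon.ae_integrable_levelPoint hn hp0 hp1 Θ hu hu0,
      SphRadon.ae_hasEquidistantTransform hn hp0 hp1 Θ hu hu0] with lam h1 h2
    refine ⟨fun hl => ?_, _, h2, SphRadon.radonPolar_eq hp hp0 hp1 f lam Θ⟩
    simp only [SphRadon.SphereIntegrable, SphRadon.center_add_radius_smul hp hp0 hp1 hl]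
    exact h1 hl
  · have hu : Continuous (fun y => f (p⁻¹ • y)) := hfc.comp (continuous_const_smul _)
    exact ⟨_, SphRadon.hasEquidistantTransform_of_continuous hn hp0 hp1 Θ hu hu0 lam,
      SphRadon.radonPolar_eq hp hp0 hp1 f lam Θ⟩
  · have hu := SphRadon.memLp_comp_const_smul hf2 (inv_ne_zero hp0.ne')
    have hui := SphRadon.integrable_of_memLp_of_eq_zero hu hu0
    simp only [SphRadon.pow_smul_radonPolar hp hp0 hp1]
    have hinv := SphRadon.hasEquidistantInverse_levelIntegral hn hp0 hp1 hu hu0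
    refine ⟨⟨_, hinv⟩, fun h hh => ?_⟩
    -- One compact set suffices: dilation by `p` maps the unit ball into the closed ball of radius
    -- `p`, and it pulls null sets back to null sets.
    have hae := hinv.ae_eq (fun ε hε =>
      SphRadon.aestronglyMeasurable_backprojection hn hp0 hp1 hui hu0 hε) hh
      (isCompact_closedBall 0 p) (closedBall_subset_ball hp1)
    rw [EventuallyEq, ae_restrict_iff' measurableSet_closedBall] at hae
    rw [ae_restrict_iff' measurableSet_ball]
    filter_upwards [(SphRadon.quasiMeasurePreserving_const_smul hp0.ne').ae hae] with x hx hxb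
    have hmem : p • x ∈ closedBall (0 : SphRadon.E n) p := by
      rw [mem_closedBall_zero_iff, norm_smul, Real.norm_of_nonneg hp0.le]
      exact mul_le_of_le_one_right hp0.le (mem_ball_zero_iff.mp hxb).le
    have := hx hmem
    rwa [smul_smul, inv_mul_cancel₀ hp0.ne', one_smul] at this
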